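/- **Theorem 5.3.** Let $p\ge 2$ and let $(M,g)$ be either the Euclidean space $\mathbb R^n$ or a compact $n$-dimensional smooth Riemannian manifold (without boundary), with Riemannian volume $dv$ and Levi-Civita connection $\nabla$. There is a function $C'\colon\mathbb R\to\mathbb R$ (depending only on $M$ and $p$) such that the following holds for all $c,T>0$, all $V\in C^3((0,\infty))$ (in particular for $V(\rho)=\rho\log\rho$) and all $m\in\{2,3,\dots,\infty\}$. Let $(\rho,u)$, where $\rho>0$ is a function and $u$ a time-dependent vector field, solve on $[0,T]\times M$ the compressible $p$-Euler equation with damping $$\partial_t\rho+\nabla\cdot(\rho v)=0,\qquad c^p\left(\partial_t u+\nabla_v u\right)=-u-\nabla V'(\rho),\qquad v=|u|^{p-2}u,$$ where $u$ is of class $C^m$ on $[0,T]\times M$, $\rho$ is of class $C^1$ on $[0,T]\times M$ and $\rho(t,\cdot)$ is of class $C^2$ for each $t$ (smooth solutions being a special case). Let $u^*=\langle u,\cdot\rangle$ be the dual one-form and $\omega=du^*$. 1. The one-form $|u|^{p-2}\nabla_uu^*$ is differentiable in space, $\omega$ is differentiable in time, and on $[0,T]\times M$ $$\partial_t\omega+d\left(|u|^{p-2}\nabla_uu^*\right)=-c^{-p}\,\omega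 .$$ 2. If $|u|\le C$ and $|\nabla u|\le C$ on $[0,T]\times M$ ($|\nabla u|$ being the operator norm), then for all $t\in[0,T]$ $$\|\omega(t)\|_{L^p(M,dv)}\le e^{(C'(C)-c^{-p})t}\,\|\omega(0)\|_{L^p(M,dv)},$$ where $|\omega|$ is the Hilbert–Schmidt norm and both sides may be infinite. 3. Suppose that $M$ is compact, or that $u$ and $\nabla u$ are bounded on $[0,T]\times M$. If $du^*(0,\cdot)=0$, then $du^*(t,\cdot)=0$ for all $t\in[0,T]$, and $u$ is locally a gradient: every point of $M$ has an open neighbourhood $U$ with a function $\varphi$ of class $C^m$ on $[0,T]\times U$, each $\varphi(t,\cdot)$ being of class $C^{m+1}$, such that $u=\nabla\varphi$ on $[0,T]\times U$; if $M=\mathbb R^n$, one can take $U=M$. Moreover, if $u(0,\cdot)=\nabla\varphi_0$ on $M$ for some $\varphi_0\in C^1(M)$, then there is such a $\varphi$ on $[0,T]\times M$ with $u=\nabla\varphi$ there. -/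

import Mathlib

open Set MeasureTheory
open scoped Manifold ContDiff ENNReal

noncomputable section

namespace PEuler

/-- The model space of the manifold. -/
abbrev Eucl (n : ℕ) : Type := EuclideanSpace ℝ (Fin n)

section Charts

variable {n : ℕ} {M : Type*} [TopologicalSpace M] [ChartedSpace (Eucl n) M]

/-- The differential at `y` of the preferred chart around `x`. -/
def toChart (x y : M) : TangentSpace (𝓡 n) y →L[ℝ] Eucl n :=
  mfderiv (𝓡 n) 𝓘(ℝ, Eucl n) (extChartAt (𝓡 n) x) y

/-- The differential at `y` of the inverse of the preferred chart around `x`. -/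
def fromChart (x : M) (y : Eucl n) :
    Eucl n →L[ℝ] TangentSpace (𝓡 n) ((extChartAt (𝓡 n) x).symm y) :=
  mfderiv 𝓘(ℝ, Eucl n) (𝓡 n) (extChartAt (𝓡 n) x).symm y

/-- The expression of a vector field in the preferred chart around `x`. -/
def vecInChart (Y : (y : M) → TangentSpace (𝓡 n) y) (x : M) (y : Eucl n) : Eucl n :=
  toChart x ((extChartAt (𝓡 n) x).symm y) (Y ((extChartAt (𝓡 n) x).symm y))

/-- The expression of a one-form in the preferred chart around `x`. -/
def formInChart (α : (y : M) → TangentSpace (𝓡 n) y →L[ℝ] ℝ) (x : M) (y : Eucl n) :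
    Eucl n →L[ℝ] ℝ :=
  (α ((extChartAt (𝓡 n) x).symm y)).comp (fromChart x y)

/-- The one-form `α` is differentiable at `x`. -/
def FormDifferentiableAt (α : (y : M) → TangentSpace (𝓡 n) y →L[ℝ] ℝ) (x : M) : Prop :=
  DifferentiableAt ℝ (formInChart α x) (extChartAt (𝓡 n) x x)

/-- The exterior derivative of a one-form,
`dα(a, b) = ∑ i j, (∂ᵢ αⱼ - ∂ⱼ αᵢ) aⁱ bʲ`, computed at `x` in the preferred chart around `x`. -/
def extD (α : (y : M) → TangentSpace (𝓡 n) y →L[ℝ] ℝ) (x : M) (a b : TangentSpace (𝓡 n) x) :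
    ℝ :=
  fderiv ℝ (formInChart α x) (extChartAt (𝓡 n) x x) (toChart x x a) (toChart x x b)
    - fderiv ℝ (formInChart α x) (extChartAt (𝓡 n) x x) (toChart x x b) (toChart x x a)

end Charts

/-- The Christoffel symbols of the first kind at `y` of a metric tensor `g` on a vector space,
`Γ(a, b, c) = (∂ₐ g(b, c) + ∂_b g(a, c) - ∂_c g(a, b)) / 2`. -/
def koszul {n : ℕ} (g : Eucl n → Eucl n →L[ℝ] Eucl n →L[ℝ] ℝ) (y a : Eucl n) :
    Eucl n →L[ℝ] Eucl n →L[ℝ] ℝ :=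
  let Dg : Eucl n →L[ℝ] Eucl n →L[ℝ] Eucl n →L[ℝ] ℝ := fderiv ℝ g y
  (1 / 2 : ℝ) • (Dg a + Dg.flip a - (Dg.flip a).flip)

section Riemannian

open scoped Bundle

variable {n : ℕ} {M : Type*} [TopologicalSpace M] [ChartedSpace (Eucl n) M]

instance (x : M) : FiniteDimensional ℝ (TangentSpace (𝓡 n) x) :=
  inferInstanceAs (FiniteDimensional ℝ (Eucl n))

variable [Bundle.RiemannianBundle (fun x : M => TangentSpace (𝓡 n) x)]

instance (x : M) : CompleteSpace (TangentSpace (𝓡 n) x) := FiniteDimensional.complete ℝ _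

variable (n M) in
/-- The Riemannian metric on the tangent bundle of `M` is smooth. -/
abbrev SmoothMetric [IsManifold (𝓡 n) ∞ M] : Prop :=
  IsContMDiffRiemannianBundle (𝓡 n) ∞ (Eucl n) (fun x : M => TangentSpace (𝓡 n) x)

/-- The metric dual `Y^*` of a tangent vector, `Y^*(b) = ⟨Y, b⟩`. -/
def flat (x : M) (a : TangentSpace (𝓡 n) x) :
    TangentSpace (𝓡 n) x →L[ℝ] ℝ :=
  innerSL ℝ a

/-- The inverse of `flat`. -/
def sharp (x : M) (α : TangentSpace (𝓡 n) x →L[ℝ] ℝ) : TangentSpace (𝓡 n) x :=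
  (InnerProductSpace.toDual ℝ (TangentSpace (𝓡 n) x)).symm α

/-- The gradient of a function, `⟨∇f, b⟩ = df(b)`. -/
def grad (f : M → ℝ) (x : M) : TangentSpace (𝓡 n) x :=
  sharp x (mfderiv (𝓡 n) 𝓘(ℝ, ℝ) f x)

/-- The metric tensor in the preferred chart around `x`. -/
def metricInChart (x : M) (y : Eucl n) : Eucl n →L[ℝ] Eucl n →L[ℝ] ℝ :=
  let q : M := (extChartAt (𝓡 n) x).symm y
  let g : TangentSpace (𝓡 n) q →L[ℝ] TangentSpace (𝓡 n) q →L[ℝ] ℝ := innerSL ℝ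
  g.bilinearComp (fromChart x y) (fromChart x y)

/-- The Christoffel symbols of the first kind at `x`, in the preferred chart around `x`. -/
def christoffel (x : M) (a : Eucl n) : Eucl n →L[ℝ] Eucl n →L[ℝ] ℝ :=
  koszul (metricInChart x) (extChartAt (𝓡 n) x x) a

/-- The Levi-Civita covariant derivative `∇ₐ Y` at `x` of a vector field `Y`, given by the
classical formula `⟨∇ₐ Y, c⟩ = g(∂ₐ Y, c) + Γ(a, Y, c)` in the preferred chart around `x`. -/
def covDeriv (Y : (y : M) → TangentSpace (𝓡 n) y) (x : M) (a : TangentSpace (𝓡 n) x) :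
    TangentSpace (𝓡 n) x :=
  sharp x <|
    (metricInChart x (extChartAt (𝓡 n) x x)
        (fderiv ℝ (vecInChart Y x) (extChartAt (𝓡 n) x x) (toChart x x a))
      + christoffel x (toChart x x a) (toChart x x (Y x))).comp (toChart x x)

/-- The Levi-Civita covariant derivative `∇ₐ α` at `x` of a one-form `α`:
`(∇ₐ α)(b) = (∂ₐ α)(b) - Γ(a, b, α^♯)` in the preferred chart around `x`. -/
def covDerivForm (α : (y : M) → TangentSpace (𝓡 n) y →L[ℝ] ℝ) (x : M) (a : TangentSpace (𝓡 n) x) :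
    TangentSpace (𝓡 n) x →L[ℝ] ℝ :=
  (fderiv ℝ (formInChart α x) (extChartAt (𝓡 n) x x) (toChart x x a)
    - (christoffel x (toChart x x a)).flip (toChart x x (sharp x (α x)))).comp (toChart x x)

/-- The divergence of a vector field, `∑ᵢ ⟨∇_{eᵢ} Y, eᵢ⟩` for an orthonormal basis `e`. -/
def divergence (Y : (y : M) → TangentSpace (𝓡 n) y) (x : M) : ℝ :=
  ∑ i, inner ℝ (covDeriv Y x (stdOrthonormalBasis ℝ (TangentSpace (𝓡 n) x) i))
    (stdOrthonormalBasis ℝ (TangentSpace (𝓡 n) x) i)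

/-- The Hilbert-Schmidt norm of a bilinear form on a tangent space. -/
def hsNorm (x : M) (w : TangentSpace (𝓡 n) x → TangentSpace (𝓡 n) x → ℝ) : ℝ :=
  √(∑ i, ∑ j, w (stdOrthonormalBasis ℝ (TangentSpace (𝓡 n) x) i)
    (stdOrthonormalBasis ℝ (TangentSpace (𝓡 n) x) j) ^ 2)

/-- The Riemannian volume density `√(det g)` in the preferred chart around `x`. -/
def volDensity (x : M) (y : Eucl n) : ℝ :=
  √(Matrix.det (Matrix.of fun i j : Fin n =>
    metricInChart x y (EuclideanSpace.single i 1) (EuclideanSpace.single j 1)))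

variable (n M) in
/-- The Riemannian volume measure `dv = √(det g) dx`, glued from the preferred charts by means of
a smooth partition of unity subordinate to the chart domains. -/
def riemVolume [MeasurableSpace M] [T2Space M] [SigmaCompactSpace M]
    [IsManifold (𝓡 n) ∞ M] : Measure M :=
  let f := (SmoothPartitionOfUnity.exists_isSubordinate_chartAt_source (𝓡 n) M).choose
  Measure.sum fun i : M =>
    ((volume.restrict (extChartAt (𝓡 n) i).target).withDensity fun y =>
      ENNReal.ofReal (f i ((extChartAt (𝓡 n) i).symm y) * volDensity i y)).map
        (extChartAt (𝓡 n) i).symm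

variable (n M) in
/-- The Riemannian manifold `M` is (isometric to) the Euclidean space `ℝⁿ`. -/
def IsEuclidean : Prop :=
  ∃ Φ : M ≃ₘ⟮𝓡 n, 𝓘(ℝ, Eucl n)⟯ Eucl n, ∀ (x : M) (a b : TangentSpace (𝓡 n) x),
    let dΦ : TangentSpace (𝓡 n) x → Eucl n := mfderiv (𝓡 n) 𝓘(ℝ, Eucl n) Φ x
    inner ℝ (dΦ a) (dΦ b) = inner ℝ a b

/-- `(ρ, u)` is a solution on `[0, T] × M`, with `u` of class `C^m` (`m = ∞` being the smooth
case) and `ρ > 0`, of the compressible `p`-Euler equation with damping, with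
`𝒱(ρ) = ∫ V(ρ) dv`, so that `δ𝒱/δρ = V'(ρ)`, and `v = |u|^{p-2} u`. -/
structure IsSolution [IsManifold (𝓡 n) ∞ M] (m : ℕ∞) (c p T : ℝ) (V : ℝ → ℝ)
    (ρ : ℝ → M → ℝ) (u : ℝ → (x : M) → TangentSpace (𝓡 n) x) : Prop where
  contMDiffOn_u : ContMDiffOn (𝓘(ℝ, ℝ).prod (𝓡 n)) (𝓡 n).tangent (m : ℕ∞ω)
    (fun z : ℝ × M => (⟨z.2, u z.1 z.2⟩ : TangentBundle (𝓡 n) M)) (Icc 0 T ×ˢ univ)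
  contMDiffOn_rho : ContMDiffOn (𝓘(ℝ, ℝ).prod (𝓡 n)) 𝓘(ℝ, ℝ) 1
    (fun z : ℝ × M => ρ z.1 z.2) (Icc 0 T ×ˢ univ)
  contMDiff_rho : ∀ t ∈ Icc 0 T, ContMDiff (𝓡 n) 𝓘(ℝ, ℝ) 2 (ρ t)
  rho_pos : ∀ t ∈ Icc 0 T, ∀ x, 0 < ρ t x
  continuity : ∀ t ∈ Icc 0 T, ∀ x,
    derivWithin (fun s => ρ s x) (Icc 0 T) t
      + divergence (fun y => ρ t y • ‖u t y‖ ^ (p - 2) • u t y) x = 0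
  momentum : ∀ t ∈ Icc 0 T, ∀ x,
    c ^ p • (derivWithin (fun s => u s x) (Icc 0 T) t
        + covDeriv (u t) x (‖u t x‖ ^ (p - 2) • u t x))
      = - u t x - grad (fun y => deriv V (ρ t y)) x

/-- The bounds `|u| ≤ C` and `|∇u| ≤ C` on `[0, T] × M`, with the operator norm of `∇u`. -/
def BoundedBy (T C : ℝ) (u : ℝ → (x : M) → TangentSpace (𝓡 n) x) : Prop :=
  ∀ t ∈ Icc 0 T, ∀ x, ‖u t x‖ ≤ C ∧
    ∀ a : TangentSpace (𝓡 n) x, ‖covDeriv (u t) x a‖ ≤ C * ‖a‖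

/-- The two-form `ω = d u^*` at time `t`. -/
def vorticity (u : ℝ → (x : M) → TangentSpace (𝓡 n) x) (t : ℝ) (x : M)
    (a b : TangentSpace (𝓡 n) x) : ℝ :=
  extD (fun y => flat y (u t y)) x a b

/-- The one-form `|u|^{p-2} ∇_u u^*` at time `t`. -/
def convection (p : ℝ) (u : ℝ → (x : M) → TangentSpace (𝓡 n) x) (t : ℝ) (x : M) :
    TangentSpace (𝓡 n) x →L[ℝ] ℝ :=
  ‖u t x‖ ^ (p - 2) • covDerivForm (fun y => flat y (u t y)) x (u t x)

/-- `u = ∇φ` on `[0, T] × U`, where `φ` is of class `C^m` there and of class `C^{m+1}` in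
space. -/
def IsPotentialOn (m : ℕ∞) (T : ℝ) (U : Set M) (u : ℝ → (x : M) → TangentSpace (𝓡 n) x)
    (φ : ℝ → M → ℝ) : Prop :=
  ContMDiffOn (𝓘(ℝ, ℝ).prod (𝓡 n)) 𝓘(ℝ, ℝ) (m : ℕ∞ω)
      (fun z : ℝ × M => φ z.1 z.2) (Icc 0 T ×ˢ U) ∧
    ∀ t ∈ Icc 0 T, ContMDiffOn (𝓡 n) 𝓘(ℝ, ℝ) ((m + 1 : ℕ∞) : ℕ∞ω) (φ t) U ∧
      ∀ x ∈ U, u t x = grad (φ t) x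

end Riemannian

end PEuler

end

/-!
Lowering the index of the momentum equation gives
`∂ₜu^* + |u|^{p-2} ∇_u u^* = -c^{-p} (u^* + dV'(ρ))`, and the exterior derivative removes the
pressure term. Since `∇` is metric and torsion free, `|u|^{p-2} ∇_u u^* = ω(v, ·) + d(|u|^p / p)`
with `v = |u|^{p-2} u` (`formInChart_convection_eq`). By Cartan's formula the vorticity equation
is therefore the transport equation `∂ₜω + L_v ω = -c^{-p} ω` (`IsSolution.fderiv_vortForm`).
All identities are computed in the preferred charts; the exterior derivative of a one-form and the
Lie derivative of the metric do not depend on the chart (`dForm_pullback`, `lieMetric_pullback`).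

For the `L^p` bound, suppose that `|(L_v g)(a, a)| ≤ 2K |a|²` for all `a`. Moving along `v`, the
norm `|ω|` then grows at rate at most `2K - c^{-p}` and the volume density `J` at rate at most
`n K`, so that `h = |ω|^p` satisfies `∂ₜ(hJ) + div(hJv) ≤ κ hJ` with `κ = p (2K - c^{-p}) + n K`
(`transport_hsSq_rpow_le`). Under `|u|, |∇u| ≤ C` one may take `K = (p - 1) C^{p-1}`
(`BoundedBy.lieBoundAt`). The field `v` is of class `C¹` even at the zeros of `u`, where `|u|` is
not smooth (`contDiffOn_rpow_form_smul`). A partition of unity turns the pointwise inequality into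
an integral one. As the two sides may be infinite, and on `ℝⁿ` nothing decays at infinity, the
integrals are first cut off at `r + B t ≤ R`, where `r` has compact sublevel sets and `B` bounds
the derivative of `r` along `v`: by finite propagation speed the cutoff only decreases along the
flow (`integral_density_le`). Grönwall's inequality and Fatou's lemma for `R → ∞` conclude
(`lintegral_density_le`, `IsSolution.eLpNorm_vorticity_le`). The velocity is bounded, so `r` may be
a smoothed Euclidean distance on `ℝⁿ` and `0` on a compact manifold.

If `ω` vanishes at time zero, the bound, together with the continuity of `ω` and the positivity
of the volume on open sets, makes it vanish at all times; on a compact manifold the constant `K`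
exists by compactness. Local potentials come from the Poincaré lemma
`φ(t, y) = ∫₀¹ α(t, y₀ + s (y - y₀)) (y - y₀) ds` in a ball of a chart. They have the required
joint regularity by differentiation under the integral, for parameters in a convex set which need
not be open, as time ranges over a closed interval.

Given a potential `φ₀` at time zero, the equation integrates to a potential
`e^{-λt} (φ₀ - ∫₀ᵗ e^{λs} b ds)` at every time, where `λ = c^{-p}` and `b` is the Bernoulli
function. Its regularity in time is limited by that of `ρ`, which is only `C¹`. It is therefore
normalised to vanish at a base point of each connected component; the difference to a local
potential then depends on time alone, so that regularity in time at a point is an open and closed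
condition on the point, and holds at the base point (`exists_potential_of_forall_hasMFDerivAt`).
On `ℝⁿ` the initial potential is given by the Poincaré lemma once more
(`IsEuclidean.exists_potential`).
-/

noncomputable section

namespace PEuler

open Filter Topology

/-! ### Charts and coordinate changes -/

section ChartCalculus

variable {n : ℕ} {M : Type*} [TopologicalSpace M] [ChartedSpace (Eucl n) M]
  [IsManifold (𝓡 n) ∞ M]

theorem toChart_fromChart {x : M} {y : Eucl n} (hy : y ∈ (extChartAt (𝓡 n) x).target)
    (a : Eucl n) : toChart x ((extChartAt (𝓡 n) x).symm y) (fromChart x y a) = a := by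
  have h := mfderiv_extChartAt_comp_mfderivWithin_extChartAt_symm (I := 𝓡 n) hy
  rw [modelWithCornersSelf_coe, range_id, mfderivWithin_univ] at h
  exact DFunLike.congr_fun h a

theorem fromChart_toChart {x : M} {y : Eucl n} (hy : y ∈ (extChartAt (𝓡 n) x).target)
    (a : TangentSpace (𝓡 n) ((extChartAt (𝓡 n) x).symm y)) :
    fromChart x y (toChart x ((extChartAt (𝓡 n) x).symm y) a) = a := by
  have h := mfderivWithin_extChartAt_symm_comp_mfderiv_extChartAt (I := 𝓡 n) hy
  rw [modelWithCornersSelf_coe, range_id, mfderivWithin_univ] at h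
  exact DFunLike.congr_fun h a

theorem formInChart_toChart (α : (y : M) → TangentSpace (𝓡 n) y →L[ℝ] ℝ) {x q : M}
    (hq : q ∈ (extChartAt (𝓡 n) x).source) (a : TangentSpace (𝓡 n) q) :
    formInChart α x (extChartAt (𝓡 n) x q) (toChart x q a) = α q a := by
  obtain ⟨y, hy, rfl⟩ : ∃ y ∈ (extChartAt (𝓡 n) x).target, (extChartAt (𝓡 n) x).symm y = q :=
    ⟨_, (extChartAt (𝓡 n) x).map_source hq, (extChartAt (𝓡 n) x).left_inv hq⟩
  rw [(extChartAt (𝓡 n) x).right_inv hy]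
  exact congrArg (α _) (fromChart_toChart hy a)

omit [IsManifold (𝓡 n) ∞ M] in
theorem vecInChart_extChartAt (Y : (y : M) → TangentSpace (𝓡 n) y) {x q : M}
    (hq : q ∈ (extChartAt (𝓡 n) x).source) :
    vecInChart Y x (extChartAt (𝓡 n) x q) = toChart x q (Y q) := by
  obtain ⟨y, hy, rfl⟩ : ∃ y ∈ (extChartAt (𝓡 n) x).target, (extChartAt (𝓡 n) x).symm y = q :=
    ⟨_, (extChartAt (𝓡 n) x).map_source hq, (extChartAt (𝓡 n) x).left_inv hq⟩
  rw [(extChartAt (𝓡 n) x).right_inv hy]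
  rfl

theorem exists_toChart_eq {x q : M} (hq : q ∈ (extChartAt (𝓡 n) x).source) (b : Eucl n) :
    ∃ a : TangentSpace (𝓡 n) q, toChart x q a = b := by
  obtain ⟨y, hy, rfl⟩ : ∃ y ∈ (extChartAt (𝓡 n) x).target, (extChartAt (𝓡 n) x).symm y = q :=
    ⟨_, (extChartAt (𝓡 n) x).map_source hq, (extChartAt (𝓡 n) x).left_inv hq⟩
  exact ⟨_, toChart_fromChart hy b⟩

theorem toChart_injective {x q : M} (hq : q ∈ (extChartAt (𝓡 n) x).source) :
    Function.Injective (toChart (n := n) x q) := by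
  obtain ⟨y, hy, rfl⟩ : ∃ y ∈ (extChartAt (𝓡 n) x).target, (extChartAt (𝓡 n) x).symm y = q :=
    ⟨_, (extChartAt (𝓡 n) x).map_source hq, (extChartAt (𝓡 n) x).left_inv hq⟩
  exact Function.LeftInverse.injective (fromChart_toChart hy)

/-- The part of the target of the chart around `x` that is covered by the chart around `x'`. -/
def overlap (x x' : M) : Set (Eucl n) :=
  (extChartAt (𝓡 n) x).target ∩
    (extChartAt (𝓡 n) x).symm ⁻¹' (extChartAt (𝓡 n) x').source

/-- The coordinate change from the chart around `x` to the chart around `x'`. -/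
def transition (x x' : M) (y : Eucl n) : Eucl n :=
  extChartAt (𝓡 n) x' ((extChartAt (𝓡 n) x).symm y)

omit [IsManifold (𝓡 n) ∞ M] in
theorem isOpen_overlap (x x' : M) : IsOpen (overlap (n := n) x x') :=
  (continuousOn_extChartAt_symm x).isOpen_inter_preimage (isOpen_extChartAt_target x)
    (isOpen_extChartAt_source x')

omit [IsManifold (𝓡 n) ∞ M] in
theorem extChartAt_mem_overlap {x x' q : M} (hq : q ∈ (extChartAt (𝓡 n) x).source)
    (hq' : q ∈ (extChartAt (𝓡 n) x').source) :
    extChartAt (𝓡 n) x q ∈ overlap x x' :=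
  ⟨(extChartAt (𝓡 n) x).map_source hq, by
    rw [mem_preimage, (extChartAt (𝓡 n) x).left_inv hq]; exact hq'⟩

theorem contDiffOn_transition (x x' : M) :
    ContDiffOn ℝ ∞ (transition (n := n) x x') (overlap x x') := by
  have h := contDiffOn_ext_coord_change (I := 𝓡 n) (n := ∞) x' x
  rwa [PartialEquiv.trans_source, PartialEquiv.symm_source] at h

theorem fderiv_transition {x x' q : M} (hq : q ∈ (extChartAt (𝓡 n) x).source)
    (hq' : q ∈ (extChartAt (𝓡 n) x').source) (a : TangentSpace (𝓡 n) q) :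
    fderiv ℝ (transition x x') (extChartAt (𝓡 n) x q) (toChart x q a) = toChart x' q a := by
  obtain ⟨y, hy, rfl⟩ : ∃ y ∈ (extChartAt (𝓡 n) x).target, (extChartAt (𝓡 n) x).symm y = q :=
    ⟨_, (extChartAt (𝓡 n) x).map_source hq, (extChartAt (𝓡 n) x).left_inv hq⟩
  rw [(extChartAt (𝓡 n) x).right_inv hy, ← mfderiv_eq_fderiv]
  have h1 : MDifferentiableAt 𝓘(ℝ, Eucl n) (𝓡 n) (extChartAt (𝓡 n) x).symm y := by
    have := mdifferentiableWithinAt_extChartAt_symm (I := 𝓡 n) hy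
    rwa [modelWithCornersSelf_coe, range_id, mdifferentiableWithinAt_univ] at this
  have h2 : MDifferentiableAt (𝓡 n) 𝓘(ℝ, Eucl n) (extChartAt (𝓡 n) x')
      ((extChartAt (𝓡 n) x).symm y) :=
    mdifferentiableAt_extChartAt (by rwa [extChartAt_source] at hq')
  have h3 := mfderiv_comp y h2 h1
  refine (DFunLike.congr_fun h3 _).trans ?_
  exact congrArg (toChart x' _) (fromChart_toChart hy a)

end ChartCalculus

/-! ### Regularity in charts -/

section ChartRegularity

open scoped Bundle

variable {n : ℕ} {M : Type*} [TopologicalSpace M] [ChartedSpace (Eucl n) M]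
  [IsManifold (𝓡 n) ∞ M]

theorem contMDiffOn_extChartAt_symm' (x : M) {k : ℕ∞} :
    ContMDiffOn 𝓘(ℝ, Eucl n) (𝓡 n) (k : ℕ∞ω) (extChartAt (𝓡 n) x).symm
      (extChartAt (𝓡 n) x).target :=
  (contMDiffOn_extChartAt_symm (n := ∞) x).of_le (by exact_mod_cast le_top)

theorem contMDiffOn_prod_extChartAt_symm (x : M) {k : ℕ∞} (s : Set ℝ) :
    ContMDiffOn 𝓘(ℝ, ℝ × Eucl n) (𝓘(ℝ, ℝ).prod (𝓡 n)) (k : ℕ∞ω)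
      (fun z : ℝ × Eucl n => (z.1, (extChartAt (𝓡 n) x).symm z.2))
      (s ×ˢ (extChartAt (𝓡 n) x).target) := by
  refine ContMDiffOn.prodMk ?_ ?_
  · exact contDiff_fst.contMDiff.contMDiffOn
  · exact (contMDiffOn_extChartAt_symm' x).comp (contDiff_snd.contMDiff.contMDiffOn)
      (fun z hz => hz.2)

theorem contDiffOn_comp_extChartAt_symm {F : Type*} [NormedAddCommGroup F] [NormedSpace ℝ F]
    {f : ℝ → M → F} {k : ℕ∞} {s : Set ℝ}
    {U : Set M}
    (hf : ContMDiffOn (𝓘(ℝ, ℝ).prod (𝓡 n)) 𝓘(ℝ, F) (k : ℕ∞ω)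
      (fun z : ℝ × M => f z.1 z.2) (s ×ˢ U)) (x : M) :
    ContDiffOn ℝ (k : ℕ∞ω) (fun z : ℝ × Eucl n => f z.1 ((extChartAt (𝓡 n) x).symm z.2))
      (s ×ˢ ((extChartAt (𝓡 n) x).target ∩ (extChartAt (𝓡 n) x).symm ⁻¹' U)) := by
  rw [← contMDiffOn_iff_contDiffOn]
  exact hf.comp ((contMDiffOn_prod_extChartAt_symm x s).mono
    (prod_mono le_rfl inter_subset_left)) (fun z hz => ⟨hz.1, hz.2.2⟩)

theorem trivializationAt_eq_toChart {x q : M} (hq : q ∈ (extChartAt (𝓡 n) x).source)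
    (a : TangentSpace (𝓡 n) q) :
    (trivializationAt (Eucl n) (TangentSpace (𝓡 n)) x ⟨q, a⟩).2 = toChart x q a := by
  rw [extChartAt_source] at hq
  rw [toChart, ← TangentBundle.continuousLinearMapAt_trivializationAt hq,
    Bundle.Trivialization.continuousLinearMapAt_apply, Bundle.Trivialization.linearMapAt_apply,
    if_pos (by simpa using hq)]

theorem contDiffOn_vecInChart {u : ℝ → (x : M) → TangentSpace (𝓡 n) x} {k : ℕ∞} {s : Set ℝ}
    (hu : ContMDiffOn (𝓘(ℝ, ℝ).prod (𝓡 n)) (𝓡 n).tangent (k : ℕ∞ω)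
      (fun z : ℝ × M => (⟨z.2, u z.1 z.2⟩ : TangentBundle (𝓡 n) M)) (s ×ˢ univ)) (x : M) :
    ContDiffOn ℝ (k : ℕ∞ω) (fun z : ℝ × Eucl n => vecInChart (u z.1) x z.2)
      (s ×ˢ (extChartAt (𝓡 n) x).target) := by
  rw [← contMDiffOn_iff_contDiffOn]
  have h1 := hu.comp (contMDiffOn_prod_extChartAt_symm x s (k := k)) (fun z hz => ⟨hz.1, trivial⟩)
  have hmap : MapsTo (fun z : ℝ × Eucl n => (⟨(extChartAt (𝓡 n) x).symm z.2,
        u z.1 ((extChartAt (𝓡 n) x).symm z.2)⟩ : TangentBundle (𝓡 n) M))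
      (s ×ˢ (extChartAt (𝓡 n) x).target)
      (trivializationAt (Eucl n) (TangentSpace (𝓡 n)) x).source := by
    intro z hz
    have := (extChartAt (𝓡 n) x).map_target hz.2
    rw [extChartAt_source] at this
    simpa [Bundle.Trivialization.mem_source] using this
  have h2 := ((trivializationAt (Eucl n) (TangentSpace (𝓡 n)) x).contMDiffOn_iff hmap).1 h1
  refine h2.2.congr fun z hz => ?_
  exact (trivializationAt_eq_toChart ((extChartAt (𝓡 n) x).map_target hz.2) _).symm

theorem contMDiffOn_fromChart (x : M) (a : Eucl n) :
    ContMDiffOn 𝓘(ℝ, Eucl n) (𝓡 n).tangent ∞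
      (fun y : Eucl n => (⟨(extChartAt (𝓡 n) x).symm y, fromChart x y a⟩ : TangentBundle (𝓡 n) M))
      (extChartAt (𝓡 n) x).target := by
  have hmap : MapsTo (fun y : Eucl n => (⟨(extChartAt (𝓡 n) x).symm y,
        fromChart x y a⟩ : TangentBundle (𝓡 n) M))
      (extChartAt (𝓡 n) x).target
      (trivializationAt (Eucl n) (TangentSpace (𝓡 n)) x).source := by
    intro z hz
    have := (extChartAt (𝓡 n) x).map_target hz
    rw [extChartAt_source] at this
    simpa [Bundle.Trivialization.mem_source] using this
  refine ((trivializationAt (Eucl n) (TangentSpace (𝓡 n)) x).contMDiffOn_iff hmap).2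
    ⟨contMDiffOn_extChartAt_symm' x, ?_⟩
  refine (contMDiffOn_const (c := a)).congr fun y hy => ?_
  rw [trivializationAt_eq_toChart ((extChartAt (𝓡 n) x).map_target hy)]
  exact toChart_fromChart hy a

variable [Bundle.RiemannianBundle (fun x : M => TangentSpace (𝓡 n) x)]

omit [IsManifold (𝓡 n) ∞ M] in
theorem metricInChart_apply (x : M) (y a b : Eucl n) :
    metricInChart x y a b =
      inner ℝ (fromChart x y a) (fromChart x y b) := rfl

omit [IsManifold (𝓡 n) ∞ M] in
theorem metricInChart_symm (x : M) (y a b : Eucl n) :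
    metricInChart x y a b = metricInChart x y b a := by
  rw [metricInChart_apply, metricInChart_apply, real_inner_comm]

theorem metricInChart_pos {x : M} {y : Eucl n} (hy : y ∈ (extChartAt (𝓡 n) x).target)
    {a : Eucl n} (ha : a ≠ 0) : 0 < metricInChart x y a a := by
  rw [metricInChart_apply, real_inner_self_eq_norm_sq]
  refine pow_pos (norm_pos_iff.2 fun h => ha ?_) 2
  rw [← toChart_fromChart hy a, h, map_zero]

theorem metricInChart_toChart {x q : M} (hq : q ∈ (extChartAt (𝓡 n) x).source)
    (a b : TangentSpace (𝓡 n) q) :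
    metricInChart x (extChartAt (𝓡 n) x q) (toChart x q a) (toChart x q b) = inner ℝ a b := by
  obtain ⟨y, hy, rfl⟩ : ∃ y ∈ (extChartAt (𝓡 n) x).target, (extChartAt (𝓡 n) x).symm y = q :=
    ⟨_, (extChartAt (𝓡 n) x).map_source hq, (extChartAt (𝓡 n) x).left_inv hq⟩
  rw [(extChartAt (𝓡 n) x).right_inv hy, metricInChart_apply, fromChart_toChart hy,
    fromChart_toChart hy]

theorem formInChart_flat (Y : (y : M) → TangentSpace (𝓡 n) y) {x : M} {y : Eucl n}
    (hy : y ∈ (extChartAt (𝓡 n) x).target) :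
    formInChart (fun q => flat q (Y q)) x y = metricInChart x y (vecInChart Y x y) := by
  ext b
  rw [metricInChart_apply]
  exact congrArg (fun a => inner ℝ a (fromChart x y b))
    (fromChart_toChart hy (Y ((extChartAt (𝓡 n) x).symm y))).symm

theorem contDiffOn_metricInChart [SmoothMetric n M] (x : M) :
    ContDiffOn ℝ ∞ (metricInChart (n := n) x) (extChartAt (𝓡 n) x).target := by
  rw [contDiffOn_clm_apply]
  intro a
  rw [contDiffOn_clm_apply]
  intro b
  rw [← contMDiffOn_iff_contDiffOn]
  exact (contMDiffOn_fromChart x a).inner_bundle (contMDiffOn_fromChart x b)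

end ChartRegularity

/-! ### Naturality of the exterior derivative and of the Lie derivative of the metric -/

section Naturality

variable {E E' : Type*} [NormedAddCommGroup E] [NormedSpace ℝ E] [NormedAddCommGroup E']
  [NormedSpace ℝ E']

/-- The exterior derivative `dα(a, b) = (∂ₐ α)(b) - (∂_b α)(a)` of a one-form on a vector space. -/
def dForm (α : E → E →L[ℝ] ℝ) (y : E) : E →L[ℝ] E →L[ℝ] ℝ :=
  fderiv ℝ α y - (fderiv ℝ α y).flip

theorem dForm_apply (α : E → E →L[ℝ] ℝ) (y a b : E) :
    dForm α y a b = fderiv ℝ α y a b - fderiv ℝ α y b a := rfl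

/-- The Lie derivative `L_v g(a, b) = (∂_v g)(a, b) + g(∂ₐ v, b) + g(a, ∂_b v)` of a metric tensor
on a vector space along a vector field. -/
def lieMetric (g : E → E →L[ℝ] E →L[ℝ] ℝ) (v : E → E) (y a b : E) : ℝ :=
  fderiv ℝ g y (v y) a b + g y (fderiv ℝ v y a) b + g y a (fderiv ℝ v y b)

/-- Exterior differentiation commutes with pullback. -/
theorem dForm_pullback {τ : E → E'} {α : E → E →L[ℝ] ℝ} {β : E' → E' →L[ℝ] ℝ} {y : E}
    (hτ : ContDiffAt ℝ 2 τ y) (hβ : DifferentiableAt ℝ β (τ y))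
    (h : α =ᶠ[𝓝 y] fun y' => (β (τ y')).comp (fderiv ℝ τ y')) :
    DifferentiableAt ℝ α y ∧
      ∀ a b, dForm α y a b = dForm β (τ y) (fderiv ℝ τ y a) (fderiv ℝ τ y b) := by
  have h1 : HasFDerivAt τ (fderiv ℝ τ y) y :=
    (hτ.differentiableAt (by norm_num)).hasFDerivAt
  have h2 : HasFDerivAt (fderiv ℝ τ) (fderiv ℝ (fderiv ℝ τ) y) y :=
    ((hτ.fderiv_right (m := 1) (by norm_num)).differentiableAt (by norm_num)).hasFDerivAt
  have h3 := ((hβ.hasFDerivAt.comp y h1).clm_comp h2).congr_of_eventuallyEq h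
  have hsymm := hτ.isSymmSndFDerivAt (by simp)
  refine ⟨h3.differentiableAt, fun a b => ?_⟩
  simp only [dForm_apply, h3.fderiv]
  simp [hsymm.eq a b]

/-- The Lie derivative of the metric is natural under isometries. -/
theorem lieMetric_pullback {τ : E → E'} {g : E → E →L[ℝ] E →L[ℝ] ℝ}
    {g' : E' → E' →L[ℝ] E' →L[ℝ] ℝ} {v : E → E} {v' : E' → E'} {y : E}
    (hτ : ContDiffAt ℝ 2 τ y) (hg : DifferentiableAt ℝ g y) (hg' : DifferentiableAt ℝ g' (τ y))
    (hv : DifferentiableAt ℝ v y) (hv' : DifferentiableAt ℝ v' (τ y))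
    (hgg : ∀ᶠ y' in 𝓝 y, ∀ a b, g y' a b = g' (τ y') (fderiv ℝ τ y' a) (fderiv ℝ τ y' b))
    (hvv : ∀ᶠ y' in 𝓝 y, v' (τ y') = fderiv ℝ τ y' (v y')) (a b : E) :
    lieMetric g v y a b = lieMetric g' v' (τ y) (fderiv ℝ τ y a) (fderiv ℝ τ y b) := by
  have h1 : HasFDerivAt τ (fderiv ℝ τ y) y :=
    (hτ.differentiableAt (by norm_num)).hasFDerivAt
  have h2 : HasFDerivAt (fderiv ℝ τ) (fderiv ℝ (fderiv ℝ τ) y) y :=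
    ((hτ.fderiv_right (m := 1) (by norm_num)).differentiableAt (by norm_num)).hasFDerivAt
  have hsymm := hτ.isSymmSndFDerivAt (by simp)
  -- differentiate the two relations
  have e1 : ∀ c a b, fderiv ℝ g y c a b =
      fderiv ℝ g' (τ y) (fderiv ℝ τ y c) (fderiv ℝ τ y a) (fderiv ℝ τ y b)
      + g' (τ y) (fderiv ℝ (fderiv ℝ τ) y c a) (fderiv ℝ τ y b)
      + g' (τ y) (fderiv ℝ τ y a) (fderiv ℝ (fderiv ℝ τ) y c b) := by
    intro c a b
    have L : HasFDerivAt (fun y' => g y' a b) _ y :=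
      (hg.hasFDerivAt.clm_apply (hasFDerivAt_const a y)).clm_apply (hasFDerivAt_const b y)
    have R : HasFDerivAt (fun y' => g' (τ y') (fderiv ℝ τ y' a) (fderiv ℝ τ y' b)) _ y :=
      ((hg'.hasFDerivAt.comp y h1).clm_apply (h2.clm_apply (hasFDerivAt_const a y))).clm_apply
        (h2.clm_apply (hasFDerivAt_const b y))
    have := L.unique (R.congr_of_eventuallyEq (hgg.mono fun y' h => h a b))
    have := DFunLike.congr_fun this c
    simp at this
    rw [this]
    ring
  have e2 : ∀ c, fderiv ℝ v' (τ y) (fderiv ℝ τ y c) =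
      fderiv ℝ (fderiv ℝ τ) y c (v y) + fderiv ℝ τ y (fderiv ℝ v y c) := by
    intro c
    have L : HasFDerivAt (fun y' => v' (τ y')) _ y := hv'.hasFDerivAt.comp y h1
    have R : HasFDerivAt (fun y' => fderiv ℝ τ y' (v y')) _ y := h2.clm_apply hv.hasFDerivAt
    have := DFunLike.congr_fun (L.unique (R.congr_of_eventuallyEq hvv)) c
    simpa [add_comm] using this
  have e3 := hgg.self_of_nhds
  have e4 := hvv.self_of_nhds
  simp only [lieMetric, e1, e2, e3, e4, map_add, add_apply]
  rw [hsymm.eq (v y) a, hsymm.eq (v y) b]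
  ring

end Naturality

section ChartNaturality

open scoped Bundle

variable {n : ℕ} {M : Type*} [TopologicalSpace M] [ChartedSpace (Eucl n) M]

theorem extD_eq_dForm (α : (y : M) → TangentSpace (𝓡 n) y →L[ℝ] ℝ) (x : M)
    (a b : TangentSpace (𝓡 n) x) :
    extD α x a b =
      dForm (formInChart α x) (extChartAt (𝓡 n) x x) (toChart x x a) (toChart x x b) := rfl

variable [IsManifold (𝓡 n) ∞ M]

theorem transition_contDiffAt {x x' : M} {y : Eucl n} (hy : y ∈ overlap x x') :
    ContDiffAt ℝ 2 (transition x x') y :=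
  ((contDiffOn_transition x x').contDiffAt ((isOpen_overlap x x').mem_nhds hy)).of_le
    ENat.LEInfty.out

omit [IsManifold (𝓡 n) ∞ M] in
theorem transition_extChartAt {x x' q : M} (hq : q ∈ (extChartAt (𝓡 n) x).source) :
    transition x x' (extChartAt (𝓡 n) x q) = extChartAt (𝓡 n) x' q := by
  rw [transition, (extChartAt (𝓡 n) x).left_inv hq]

omit [IsManifold (𝓡 n) ∞ M] in
theorem exists_of_mem_overlap {x x' : M} {y : Eucl n} (hy : y ∈ overlap x x') :
    ∃ q ∈ (extChartAt (𝓡 n) x).source, q ∈ (extChartAt (𝓡 n) x').source ∧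
      y = extChartAt (𝓡 n) x q :=
  ⟨_, (extChartAt (𝓡 n) x).map_target hy.1, hy.2, ((extChartAt (𝓡 n) x).right_inv hy.1).symm⟩

theorem formInChart_transition (α : (y : M) → TangentSpace (𝓡 n) y →L[ℝ] ℝ) {x x' : M}
    {y : Eucl n} (hy : y ∈ overlap x x') :
    formInChart α x y =
      (formInChart α x' (transition x x' y)).comp (fderiv ℝ (transition x x') y) := by
  obtain ⟨q, hq, hq', rfl⟩ := exists_of_mem_overlap hy
  ext b
  obtain ⟨a, rfl⟩ := exists_toChart_eq hq b
  rw [formInChart_toChart α hq, ContinuousLinearMap.comp_apply, fderiv_transition hq hq',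
    transition_extChartAt hq, formInChart_toChart α hq']

theorem vecInChart_transition (Y : (y : M) → TangentSpace (𝓡 n) y) {x x' : M}
    {y : Eucl n} (hy : y ∈ overlap x x') :
    vecInChart Y x' (transition x x' y) = fderiv ℝ (transition x x') y (vecInChart Y x y) := by
  obtain ⟨q, hq, hq', rfl⟩ := exists_of_mem_overlap hy
  rw [transition_extChartAt hq, vecInChart_extChartAt Y hq, vecInChart_extChartAt Y hq',
    fderiv_transition hq hq']

/-- Differentiability and the exterior derivative of a one-form may be read off in any chart. -/
theorem extD_eq_of_differentiableAt {α : (y : M) → TangentSpace (𝓡 n) y →L[ℝ] ℝ} {x q : M}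
    (hq : q ∈ (extChartAt (𝓡 n) x).source)
    (hα : DifferentiableAt ℝ (formInChart α x) (extChartAt (𝓡 n) x q)) :
    FormDifferentiableAt α q ∧ ∀ a b : TangentSpace (𝓡 n) q, extD α q a b =
      dForm (formInChart α x) (extChartAt (𝓡 n) x q) (toChart x q a) (toChart x q b) := by
  have hqq := mem_extChartAt_source (I := 𝓡 n) q
  have hy := extChartAt_mem_overlap hqq hq
  have h := dForm_pullback (α := formInChart α q) (β := formInChart α x)
    (transition_contDiffAt hy)
    (by rwa [transition_extChartAt hqq])
    (eventually_of_mem ((isOpen_overlap q x).mem_nhds hy)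
      fun y hy => formInChart_transition α hy)
  refine ⟨h.1, fun a b => ?_⟩
  rw [extD_eq_dForm, h.2, fderiv_transition hqq hq, fderiv_transition hqq hq,
    transition_extChartAt hqq]

variable [Bundle.RiemannianBundle (fun x : M => TangentSpace (𝓡 n) x)]

theorem metricInChart_transition {x x' : M} {y : Eucl n} (hy : y ∈ overlap x x') (a b : Eucl n) :
    metricInChart x y a b = metricInChart x' (transition x x' y)
      (fderiv ℝ (transition x x') y a) (fderiv ℝ (transition x x') y b) := by
  obtain ⟨q, hq, hq', rfl⟩ := exists_of_mem_overlap hy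
  obtain ⟨a, rfl⟩ := exists_toChart_eq hq a
  obtain ⟨b, rfl⟩ := exists_toChart_eq hq b
  rw [transition_extChartAt hq, metricInChart_toChart hq, fderiv_transition hq hq',
    fderiv_transition hq hq', metricInChart_toChart hq']

theorem differentiableAt_metricInChart [SmoothMetric n M] {x : M} {y : Eucl n}
    (hy : y ∈ (extChartAt (𝓡 n) x).target) : DifferentiableAt ℝ (metricInChart (n := n) x) y :=
  ((contDiffOn_metricInChart x).differentiableOn (by simp)).differentiableAt
    ((isOpen_extChartAt_target x).mem_nhds hy)

/-- The Lie derivative of the metric does not depend on the chart. -/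
theorem lieMetric_chart [SmoothMetric n M] {Y : (y : M) → TangentSpace (𝓡 n) y} {x x' q : M}
    (hq : q ∈ (extChartAt (𝓡 n) x).source) (hq' : q ∈ (extChartAt (𝓡 n) x').source)
    (hY : DifferentiableAt ℝ (vecInChart Y x) (extChartAt (𝓡 n) x q))
    (hY' : DifferentiableAt ℝ (vecInChart Y x') (extChartAt (𝓡 n) x' q))
    (a b : TangentSpace (𝓡 n) q) :
    lieMetric (metricInChart x) (vecInChart Y x) (extChartAt (𝓡 n) x q)
        (toChart x q a) (toChart x q b) =
      lieMetric (metricInChart x') (vecInChart Y x') (extChartAt (𝓡 n) x' q)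
        (toChart x' q a) (toChart x' q b) := by
  have hy := extChartAt_mem_overlap hq hq'
  have hnear := (isOpen_overlap x x').mem_nhds hy
  rw [lieMetric_pullback (τ := transition x x') (g' := metricInChart x') (v' := vecInChart Y x')
    (transition_contDiffAt hy)
    (differentiableAt_metricInChart hy.1)
    (differentiableAt_metricInChart (by
      rw [transition_extChartAt hq]; exact (extChartAt (𝓡 n) x').map_source hq')) hY
    (by rwa [transition_extChartAt hq])
    (eventually_of_mem hnear fun y hy => metricInChart_transition hy)
    (eventually_of_mem hnear fun y hy => vecInChart_transition Y hy),
    fderiv_transition hq hq', fderiv_transition hq hq', transition_extChartAt hq]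

end ChartNaturality

open scoped Matrix

/-! ### Calculus of matrix-valued functions -/

section MatrixCalculus

variable {n : ℕ} {X : Type*} [NormedAddCommGroup X] [NormedSpace ℝ X]

theorem contDiffWithinAt_det {k : ℕ∞ω} {A : X → Matrix (Fin n) (Fin n) ℝ} {s : Set X} {z : X}
    (hA : ∀ i j, ContDiffWithinAt ℝ k (fun z => A z i j) s z) :
    ContDiffWithinAt ℝ k (fun z => (A z).det) s z := by
  simp only [Matrix.det_apply']
  exact ContDiffWithinAt.sum fun σ _ => contDiffWithinAt_const.mul
    (contDiffWithinAt_prod fun i _ => hA _ _)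

theorem contDiffWithinAt_matrix_inv {k : ℕ∞ω} {A : X → Matrix (Fin n) (Fin n) ℝ} {s : Set X}
    {z : X} (hA : ∀ i j, ContDiffWithinAt ℝ k (fun z => A z i j) s z) (hz : (A z).det ≠ 0)
    (i j : Fin n) : ContDiffWithinAt ℝ k (fun z => (A z)⁻¹ i j) s z := by
  simp only [Matrix.inv_def, Ring.inverse_eq_inv', Matrix.smul_apply, smul_eq_mul,
    Matrix.adjugate_apply]
  refine ((contDiffWithinAt_det hA).inv hz).mul (contDiffWithinAt_det fun i' j' => ?_)
  by_cases h : i' = j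
  · subst h
    simpa using contDiffWithinAt_const
  · simpa [Matrix.updateRow_ne h] using hA i' j'

theorem hasDerivAt_matrix_mul {A B : ℝ → Matrix (Fin n) (Fin n) ℝ}
    {A' B' : Matrix (Fin n) (Fin n) ℝ} {t : ℝ}
    (hA : ∀ i j, HasDerivAt (fun s => A s i j) (A' i j) t)
    (hB : ∀ i j, HasDerivAt (fun s => B s i j) (B' i j) t) (i j : Fin n) :
    HasDerivAt (fun s => (A s * B s) i j) ((A' * B t + A t * B') i j) t := by
  simp only [Matrix.mul_apply, Matrix.add_apply, ← Finset.sum_add_distrib]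
  exact HasDerivAt.fun_sum fun k _ => (hA i k).mul (hB k j)

theorem hasDerivAt_matrix_trace {A : ℝ → Matrix (Fin n) (Fin n) ℝ}
    {A' : Matrix (Fin n) (Fin n) ℝ} {t : ℝ}
    (hA : ∀ i j, HasDerivAt (fun s => A s i j) (A' i j) t) :
    HasDerivAt (fun s => (A s).trace) A'.trace t :=
  HasDerivAt.fun_sum fun i _ => hA i i

/-- The derivative of the determinant at the identity is the trace. -/
theorem hasDerivAt_det {A : ℝ → Matrix (Fin n) (Fin n) ℝ} {A' : Matrix (Fin n) (Fin n) ℝ} {t : ℝ}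
    (hA : ∀ i j, HasDerivAt (fun s => A s i j) (A' i j) t) (h1 : A t = 1) :
    HasDerivAt (fun s => (A s).det) A'.trace t := by
  simp only [Matrix.det_apply']
  have h := HasDerivAt.fun_sum (u := Finset.univ) fun (σ : Equiv.Perm (Fin n)) _ =>
    (HasDerivAt.fun_finsetProd (u := Finset.univ) fun i _ => hA (σ i) i).const_mul
      ((Equiv.Perm.sign σ : ℤ) : ℝ)
  refine h.congr_deriv ?_
  rw [Finset.sum_eq_single (1 : Equiv.Perm (Fin n))]
  · simp only [Equiv.Perm.sign_one, Equiv.Perm.one_apply, h1, Matrix.one_apply_eq]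
    simp [Matrix.trace]
  · intro σ _ hσ
    -- a permutation other than the identity moves at least two points
    rw [Finset.sum_eq_zero, mul_zero]
    intro i _
    obtain ⟨j, hj, hji⟩ : ∃ j, σ j ≠ j ∧ j ≠ i := by
      by_contra hcon
      push Not at hcon
      apply hσ
      ext k
      by_cases hk : σ k = k
      · rw [hk]; rfl
      · have hki := hcon k hk
        by_cases hk2 : σ (σ k) = σ k
        · exact absurd (σ.injective hk2) hk
        · exact absurd ((hcon _ hk2).trans hki.symm) hk
    rw [Finset.prod_eq_zero (Finset.mem_erase.2 ⟨hji, Finset.mem_univ j⟩), zero_smul]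
    rw [h1, Matrix.one_apply_ne hj]
  · simp

/-- The derivative of the inverse at the identity. -/
theorem hasDerivAt_matrix_inv {A : ℝ → Matrix (Fin n) (Fin n) ℝ} {A' : Matrix (Fin n) (Fin n) ℝ}
    {t : ℝ} (hA : ∀ i j, HasDerivAt (fun s => A s i j) (A' i j) t) (h1 : A t = 1) (i j : Fin n) :
    HasDerivAt (fun s => (A s)⁻¹ i j) (-A' i j) t := by
  have hdet : ∀ᶠ s in 𝓝 t, IsUnit (A s).det := by
    have : ContinuousAt (fun s => (A s).det) t := (hasDerivAt_det hA h1).continuousAt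
    filter_upwards [this.eventually_ne (y := 0) (by simp [h1])] with s hs using hs.isUnit
  have h0 : ∃ B' : Matrix (Fin n) (Fin n) ℝ, ∀ i j,
      HasDerivAt (fun s => (A s)⁻¹ i j) (B' i j) t := by
    have hdiff : ∀ i j, DifferentiableAt ℝ (fun s => (A s)⁻¹ i j) t := by
      intro i j
      simp only [Matrix.inv_def, Ring.inverse_eq_inv', Matrix.smul_apply, smul_eq_mul,
        Matrix.adjugate_apply, Matrix.det_apply']
      refine DifferentiableAt.mul (DifferentiableAt.inv ?_ ?_) ?_
      · exact DifferentiableAt.fun_sum fun σ _ => (DifferentiableAt.fun_finsetProd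
          fun i _ => (hA _ _).differentiableAt).const_mul _
      · rw [← Matrix.det_apply', h1]; simp
      · refine DifferentiableAt.fun_sum fun σ _ => (DifferentiableAt.fun_finsetProd
          fun i' _ => ?_).const_mul _
        by_cases h : σ i' = j
        · simp [h]
        · simpa [Matrix.updateRow_ne h] using (hA _ _).differentiableAt
    exact ⟨Matrix.of fun i j => deriv (fun s => (A s)⁻¹ i j) t, fun i j => (hdiff i j).hasDerivAt⟩
  obtain ⟨B', hB'⟩ := h0
  have h2 : ∀ i j, (B' * A t + (A t)⁻¹ * A') i j = 0 := by
    intro i j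
    have h3 := hasDerivAt_matrix_mul hB' hA i j
    have h4 : HasDerivAt (fun s => ((A s)⁻¹ * A s) i j) 0 t := by
      refine (hasDerivAt_const t ((1 : Matrix (Fin n) (Fin n) ℝ) i j)).congr_of_eventuallyEq ?_
      filter_upwards [hdet] with s hs
      rw [Matrix.nonsing_inv_mul _ hs]
    exact h3.unique h4
  have h5 : B' i j = -A' i j := by
    have := h2 i j
    rw [h1, inv_one, mul_one, one_mul, Matrix.add_apply] at this
    linarith
  exact h5 ▸ hB' i j

theorem hasDerivAt_trace_inv_mul {G W : ℝ → Matrix (Fin n) (Fin n) ℝ}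
    {G' W' : Matrix (Fin n) (Fin n) ℝ} {t : ℝ}
    (hG : ∀ i j, HasDerivAt (fun s => G s i j) (G' i j) t)
    (hW : ∀ i j, HasDerivAt (fun s => W s i j) (W' i j) t) (h1 : G t = 1) :
    HasDerivAt (fun s => ((G s)⁻¹ * W s * (G s)⁻¹ * (W s)ᵀ).trace)
      (2 * (W' * (W t)ᵀ).trace - (G' * W t * (W t)ᵀ).trace - (W t * G' * (W t)ᵀ).trace) t := by
  have hI : ∀ i j, HasDerivAt (fun s => (G s)⁻¹ i j) ((-G') i j) t :=
    hasDerivAt_matrix_inv hG h1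
  have h := hasDerivAt_matrix_trace (hasDerivAt_matrix_mul (hasDerivAt_matrix_mul
    (hasDerivAt_matrix_mul hI hW) hI) (B := fun s => (W s)ᵀ) (B' := W'ᵀ) fun i j => hW j i)
  refine h.congr_deriv ?_
  have e : (W t * W'ᵀ).trace = (W' * (W t)ᵀ).trace := by
    rw [← Matrix.trace_transpose, Matrix.transpose_mul, Matrix.transpose_transpose]
  simp only [h1, inv_one, mul_one, one_mul, add_mul, neg_mul, mul_neg, Matrix.trace_add,
    Matrix.trace_neg, e]
  ring

/-- The rate of change of `tr (G⁻¹ W G⁻¹ Wᵀ)` at `G = 1` for a skew-symmetric matrix `W` that is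
transported by a linear flow with generator `A` and damped at rate `lam`. -/
theorem trace_transport {A G' L W : Matrix (Fin n) (Fin n) ℝ} {lam : ℝ}
    (hW : Wᵀ = -W) (hL : L = A + Aᵀ + G') :
    2 * ((-lam • W - (A * W + W * Aᵀ)) * Wᵀ).trace - (G' * W * Wᵀ).trace - (W * G' * Wᵀ).trace =
      -2 * lam * (W * Wᵀ).trace - 2 * (L * (W * Wᵀ)).trace := by
  have hc : Wᵀ * W = W * Wᵀ := by rw [hW]; simp
  have e1 : (W * G' * Wᵀ).trace = (G' * (W * Wᵀ)).trace := by
    rw [Matrix.trace_mul_cycle, hc, Matrix.trace_mul_comm]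
  have e2 : (W * Aᵀ * Wᵀ).trace = (Aᵀ * (W * Wᵀ)).trace := by
    rw [Matrix.trace_mul_cycle, hc, Matrix.trace_mul_comm]
  rw [hL]
  simp only [sub_mul, add_mul, Matrix.trace_add, Matrix.trace_sub, Matrix.mul_assoc,
    Matrix.smul_mul, Matrix.trace_smul, smul_eq_mul]
  rw [← Matrix.mul_assoc W Aᵀ Wᵀ, ← Matrix.mul_assoc W G' Wᵀ, e1, e2]
  ring

theorem trace_mul_mul_transpose_eq (L W : Matrix (Fin n) (Fin n) ℝ) :
    (L * (W * Wᵀ)).trace = ∑ k, ∑ i, ∑ j, W i k * W j k * L i j := by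
  simp only [Matrix.trace, Matrix.diag, Matrix.mul_apply, Matrix.transpose_apply, Finset.mul_sum]
  symm
  rw [Finset.sum_comm]
  refine Finset.sum_congr rfl fun i _ => ?_
  rw [Finset.sum_comm]
  exact Finset.sum_congr rfl fun j _ => Finset.sum_congr rfl fun k _ => by ring

/-- `tr (L W Wᵀ)` is the sum of the values of the quadratic form `L` on the columns of `W`. -/
theorem abs_trace_mul_mul_transpose_le {L W : Matrix (Fin n) (Fin n) ℝ} {K : ℝ}
    (hL : ∀ c : Fin n → ℝ, |∑ i, ∑ j, c i * c j * L i j| ≤ 2 * K * ∑ i, c i ^ 2) :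
    |(L * (W * Wᵀ)).trace| ≤ 2 * K * (W * Wᵀ).trace := by
  have h : (W * Wᵀ).trace = ∑ k, ∑ i, W i k ^ 2 := by
    simp only [Matrix.trace, Matrix.diag, Matrix.mul_apply, Matrix.transpose_apply, ← pow_two]
    rw [Finset.sum_comm]
  rw [trace_mul_mul_transpose_eq, h, Finset.mul_sum]
  exact (Finset.abs_sum_le_sum_abs _ _).trans
    (Finset.sum_le_sum fun k _ => hL fun i => W i k)

theorem abs_trace_le {L : Matrix (Fin n) (Fin n) ℝ} {K : ℝ}
    (hL : ∀ c : Fin n → ℝ, |∑ i, ∑ j, c i * c j * L i j| ≤ 2 * K * ∑ i, c i ^ 2) :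
    |L.trace| ≤ n * (2 * K) := by
  refine (Finset.abs_sum_le_sum_abs _ _).trans ?_
  have : ∀ i ∈ Finset.univ, |L.diag i| ≤ 2 * K := by
    intro k _
    have := hL (Pi.single k 1)
    simpa [Pi.single_apply, ite_and, Finset.sum_ite_eq] using this
  refine (Finset.sum_le_sum this).trans ?_
  simp

end MatrixCalculus

open scoped Matrix

/-! ### The Hilbert-Schmidt norm and the volume density in coordinates -/

section Gram

variable {n : ℕ}

/-- The matrix of a bilinear form with respect to a family of vectors. -/
def gram (B : Eucl n →L[ℝ] Eucl n →L[ℝ] ℝ) (b : Fin n → Eucl n) : Matrix (Fin n) (Fin n) ℝ :=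
  Matrix.of fun i j => B (b i) (b j)

variable (n) in
/-- The standard basis of the model space. -/
abbrev stdB : Module.Basis (Fin n) ℝ (Eucl n) := (EuclideanSpace.basisFun (Fin n) ℝ).toBasis

/-- The squared Hilbert-Schmidt norm of a bilinear form `w` with respect to a metric `g`, in terms
of the matrices of `w` and `g` in the standard basis. -/
def hsSq (g w : Eucl n →L[ℝ] Eucl n →L[ℝ] ℝ) : ℝ :=
  ((gram g (stdB n))⁻¹ * gram w (stdB n) * (gram g (stdB n))⁻¹ * (gram w (stdB n))ᵀ).trace

/-- The volume density of a metric `g`. -/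
def dens (g : Eucl n →L[ℝ] Eucl n →L[ℝ] ℝ) : ℝ := √(gram g (stdB n)).det

theorem gram_apply (B : Eucl n →L[ℝ] Eucl n →L[ℝ] ℝ) (b : Fin n → Eucl n) (i j : Fin n) :
    gram B b i j = B (b i) (b j) := rfl

theorem gram_basis (B : Eucl n →L[ℝ] Eucl n →L[ℝ] ℝ) (b : Fin n → Eucl n) :
    gram B b = ((stdB n).toMatrix b)ᵀ * gram B (stdB n) * (stdB n).toMatrix b := by
  ext i j
  have h : ∀ k, b k = ∑ l, (stdB n).toMatrix b l k • stdB n l := fun k =>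
    ((stdB n).sum_toMatrix_smul_self b k).symm
  rw [gram_apply, h i, h j]
  simp only [map_sum, map_smul, sum_apply, smul_apply,
    smul_eq_mul, Matrix.mul_apply, Matrix.transpose_apply, gram_apply, Finset.sum_mul,
    Finset.mul_sum]
  exact Finset.sum_congr rfl fun k _ => Finset.sum_congr rfl fun l _ => by ring

theorem isUnit_det_toMatrix (b : Module.Basis (Fin n) ℝ (Eucl n)) :
    IsUnit ((stdB n).toMatrix b).det := by
  have h := (stdB n).toMatrix_mul_toMatrix_flip b
  exact Matrix.isUnit_det_of_right_inverse h

theorem hsSq_eq (g w : Eucl n →L[ℝ] Eucl n →L[ℝ] ℝ) (b : Module.Basis (Fin n) ℝ (Eucl n)) :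
    hsSq g w = ((gram g b)⁻¹ * gram w b * (gram g b)⁻¹ * (gram w b)ᵀ).trace := by
  rw [hsSq, gram_basis g b, gram_basis w b]
  set P := (stdB n).toMatrix b
  set S := gram g (stdB n)
  set V := gram w (stdB n)
  have hP : IsUnit P.det := isUnit_det_toMatrix b
  have hPt : IsUnit Pᵀ.det := by rwa [Matrix.det_transpose]
  simp only [Matrix.mul_inv_rev, Matrix.transpose_mul, Matrix.transpose_transpose]
  have e : P⁻¹ * (S⁻¹ * Pᵀ⁻¹) * (Pᵀ * V * P) * (P⁻¹ * (S⁻¹ * Pᵀ⁻¹)) * (Pᵀ * (Vᵀ * P)) =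
      P⁻¹ * (S⁻¹ * V * S⁻¹ * Vᵀ * P) := by
    simp only [Matrix.mul_assoc]
    rw [Matrix.nonsing_inv_mul_cancel_left _ _ hPt, Matrix.nonsing_inv_mul_cancel_left _ _ hPt,
      Matrix.mul_nonsing_inv_cancel_left _ _ hP]
  rw [e, Matrix.trace_mul_comm P⁻¹, Matrix.mul_assoc _ P, Matrix.mul_nonsing_inv _ hP,
    Matrix.mul_one]

theorem hsSq_eq_sum (g w : Eucl n →L[ℝ] Eucl n →L[ℝ] ℝ) {b : Module.Basis (Fin n) ℝ (Eucl n)}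
    (hb : gram g b = 1) : hsSq g w = ∑ i, ∑ j, w (b i) (b j) ^ 2 := by
  rw [hsSq_eq g w b, hb]
  simp [Matrix.trace, Matrix.mul_apply, gram_apply, pow_two]

theorem det_gram_eq (g : Eucl n →L[ℝ] Eucl n →L[ℝ] ℝ) (b : Fin n → Eucl n) :
    (gram g b).det = ((stdB n).toMatrix b).det ^ 2 * (gram g (stdB n)).det := by
  rw [gram_basis g b, Matrix.det_mul, Matrix.det_mul, Matrix.det_transpose]
  ring

theorem dens_eq (g : Eucl n →L[ℝ] Eucl n →L[ℝ] ℝ) (b : Module.Basis (Fin n) ℝ (Eucl n)) :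
    dens g = |((stdB n).toMatrix b).det|⁻¹ * √(gram g b).det := by
  have h0 : |((stdB n).toMatrix b).det| ≠ 0 := abs_ne_zero.2 (isUnit_det_toMatrix b).ne_zero
  rw [det_gram_eq g b, Real.sqrt_mul (sq_nonneg _), Real.sqrt_sq_eq_abs,
    inv_mul_cancel_left₀ h0, dens]

theorem det_gram_pos {g : Eucl n →L[ℝ] Eucl n →L[ℝ] ℝ} {b : Module.Basis (Fin n) ℝ (Eucl n)}
    (hb : gram g b = 1) : 0 < (gram g (stdB n)).det := by
  have h := det_gram_eq g b
  rw [hb, Matrix.det_one] at h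
  by_contra hneg
  nlinarith [sq_nonneg ((stdB n).toMatrix b).det]

theorem dens_pos {g : Eucl n →L[ℝ] Eucl n →L[ℝ] ℝ} {b : Module.Basis (Fin n) ℝ (Eucl n)}
    (hb : gram g b = 1) : 0 < dens g := Real.sqrt_pos.2 (det_gram_pos hb)

/-- Change of variables for the volume density. -/
theorem dens_pullback {g g' : Eucl n →L[ℝ] Eucl n →L[ℝ] ℝ} (T : Eucl n →L[ℝ] Eucl n)
    (h : ∀ a b, g a b = g' (T a) (T b)) : dens g = |T.det| * dens g' := by
  have e : gram g (stdB n) = gram g' (fun i => T (stdB n i)) := by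
    ext i j; exact h _ _
  have hdet : ((stdB n).toMatrix fun i => T (stdB n i)).det = T.det := by
    rw [ContinuousLinearMap.det, ← LinearMap.det_toMatrix (stdB n)]
    congr 1
    ext i j
    simp [Module.Basis.toMatrix_apply, LinearMap.toMatrix_apply]
  rw [dens, dens, e, det_gram_eq, hdet, Real.sqrt_mul (sq_nonneg _), Real.sqrt_sq_eq_abs]

theorem contDiffWithinAt_gram {X : Type*} [NormedAddCommGroup X] [NormedSpace ℝ X] {k : ℕ∞ω}
    {B : X → Eucl n →L[ℝ] Eucl n →L[ℝ] ℝ} {s : Set X} {z : X} (hB : ContDiffWithinAt ℝ k B s z)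
    (b : Fin n → Eucl n) (i j : Fin n) :
    ContDiffWithinAt ℝ k (fun z => gram (B z) b i j) s z :=
  (hB.clm_apply contDiffWithinAt_const).clm_apply contDiffWithinAt_const

theorem contDiffWithinAt_hsSq {X : Type*} [NormedAddCommGroup X] [NormedSpace ℝ X] {k : ℕ∞ω}
    {g w : X → Eucl n →L[ℝ] Eucl n →L[ℝ] ℝ} {s : Set X} {z : X}
    (hg : ContDiffWithinAt ℝ k g s z) (hw : ContDiffWithinAt ℝ k w s z)
    (hz : (gram (g z) (stdB n)).det ≠ 0) :
    ContDiffWithinAt ℝ k (fun z => hsSq (g z) (w z)) s z := by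
  have hI := contDiffWithinAt_matrix_inv (contDiffWithinAt_gram hg (stdB n)) hz
  simp only [hsSq, Matrix.trace, Matrix.diag, Matrix.mul_apply, Matrix.transpose_apply]
  refine ContDiffWithinAt.sum fun i _ => ContDiffWithinAt.sum fun j _ =>
    ContDiffWithinAt.mul (ContDiffWithinAt.sum fun k _ => ContDiffWithinAt.mul
      (ContDiffWithinAt.sum fun l _ => ContDiffWithinAt.mul ?_ ?_) ?_) ?_
  · exact hI _ _
  · exact contDiffWithinAt_gram hw _ _ _
  · exact hI _ _
  · exact contDiffWithinAt_gram hw _ _ _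

theorem contDiffWithinAt_dens {X : Type*} [NormedAddCommGroup X] [NormedSpace ℝ X] {k : ℕ∞ω}
    {g : X → Eucl n →L[ℝ] Eucl n →L[ℝ] ℝ} {s : Set X} {z : X}
    (hg : ContDiffWithinAt ℝ k g s z) (hz : (gram (g z) (stdB n)).det ≠ 0) :
    ContDiffWithinAt ℝ k (fun z => dens (g z)) s z :=
  (contDiffWithinAt_det (contDiffWithinAt_gram hg (stdB n))).sqrt hz

variable {g : Eucl n → Eucl n →L[ℝ] Eucl n →L[ℝ] ℝ} {v : Eucl n → Eucl n} {y : Eucl n}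
  {b : Module.Basis (Fin n) ℝ (Eucl n)} {K : ℝ}

theorem apply_eq_repr (hb : gram (g y) b = 1) (a : Eucl n) (j : Fin n) :
    g y a (b j) = b.repr a j ∧ g y (b j) a = b.repr a j := by
  have h : ∀ i j, g y (b i) (b j) = if i = j then 1 else 0 := fun i j => by
    rw [← gram_apply, hb, Matrix.one_apply]
  constructor
  · conv_lhs => rw [← b.sum_repr a]
    simp only [map_sum, map_smul, sum_apply,
      smul_apply, h]
    simp
  · conv_lhs => rw [← b.sum_repr a]
    simp only [map_sum, map_smul, h]
    simp

/-- The matrix of the Lie derivative of the metric in an orthonormal basis. -/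
theorem lieMetric_basis (hb : gram (g y) b = 1) (i j : Fin n) :
    lieMetric g v y (b i) (b j) = b.repr (fderiv ℝ v y (b i)) j + b.repr (fderiv ℝ v y (b j)) i
      + fderiv ℝ g y (v y) (b i) (b j) := by
  rw [lieMetric, (apply_eq_repr hb _ _).1, (apply_eq_repr hb _ _).2]
  ring

theorem abs_lieMetric_basis_le (hb : gram (g y) b = 1)
    (hL : ∀ a, |lieMetric g v y a a| ≤ 2 * K * g y a a) (c : Fin n → ℝ) :
    |∑ i, ∑ j, c i * c j * lieMetric g v y (b i) (b j)| ≤ 2 * K * ∑ i, c i ^ 2 := by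
  have h := hL (∑ i, c i • b i)
  have e1 : lieMetric g v y (∑ i, c i • b i) (∑ i, c i • b i) =
      ∑ i, ∑ j, c i * c j * lieMetric g v y (b i) (b j) := by
    simp only [lieMetric, map_sum, map_smul, sum_apply,
      smul_apply, smul_eq_mul, Finset.mul_sum, mul_add, Finset.sum_add_distrib]
    refine congrArg₂ _ (congrArg₂ _ ?_ ?_) ?_
    all_goals
      rw [Finset.sum_comm]
      exact Finset.sum_congr rfl fun i _ => Finset.sum_congr rfl fun j _ => by ring
  have e2 : g y (∑ i, c i • b i) (∑ i, c i • b i) = ∑ i, c i ^ 2 := by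
    simp only [map_sum, map_smul, sum_apply,
      smul_apply, smul_eq_mul, ← gram_apply, hb, Matrix.one_apply]
    simp [pow_two]
  rwa [e1, e2] at h

/-- The chain rule along a curve for the entries of a field of bilinear forms. -/
theorem hasDerivAt_bilin_comp {X E : Type*} [NormedAddCommGroup X] [NormedSpace ℝ X]
    [NormedAddCommGroup E] [NormedSpace ℝ E] {B : X → E →L[ℝ] E →L[ℝ] ℝ} {x x' : X} {c : ℝ → X}
    {s : ℝ} (hB : DifferentiableAt ℝ B x) (hc : HasDerivAt c x' s) (hx : c s = x) (a b : E) :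
    HasDerivAt (fun s => B (c s) a b) (fderiv ℝ B x x' a b) s := by
  subst hx
  have h : HasFDerivAt (fun x => B x a b) _ (c s) :=
    (hB.hasFDerivAt.clm_apply (hasFDerivAt_const a _)).clm_apply (hasFDerivAt_const b _)
  exact (h.comp_hasDerivAt s hc).congr_deriv (by simp)

theorem hasDerivAt_line (t : ℝ) (y w : Eucl n) :
    HasDerivAt (fun s : ℝ => (t + s, y + s • w)) ((1 : ℝ), w) 0 := by
  refine HasDerivAt.prodMk ?_ ?_
  · simpa using (hasDerivAt_id (0 : ℝ)).const_add t
  · simpa using ((hasDerivAt_id (0 : ℝ)).smul_const w).const_add y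

theorem hasDerivAt_gram_line (hg : DifferentiableAt ℝ g y) (i j : Fin n) :
    HasDerivAt (fun s : ℝ => gram (g (y + s • v y)) b i j)
      (fderiv ℝ g y (v y) (b i) (b j)) 0 := by
  have h1 : HasDerivAt (fun s : ℝ => y + s • v y) (v y) 0 := by
    simpa using ((hasDerivAt_id (0 : ℝ)).smul_const (v y)).const_add y
  exact hasDerivAt_bilin_comp hg h1 (by simp) (b i) (b j)

/-- The squared norm of a two-form `w` that is transported by `v` and damped at rate `lam` changes
along `v` at a rate between `-2 lam - 4 K` and `-2 lam + 4 K`, where `2 K` bounds `L_v g`. -/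
theorem hasDerivAt_hsSq_line {w : ℝ × Eucl n → Eucl n →L[ℝ] Eucl n →L[ℝ] ℝ} {t lam : ℝ}
    (hg : DifferentiableAt ℝ g y) (hw : DifferentiableAt ℝ w (t, y))
    (hb : gram (g y) b = 1) (hL : ∀ a, |lieMetric g v y a a| ≤ 2 * K * g y a a)
    (hskew : ∀ a c, w (t, y) a c = - w (t, y) c a)
    (hev : ∀ a c, fderiv ℝ w (t, y) (1, v y) a c = -lam * w (t, y) a c
      - w (t, y) (fderiv ℝ v y a) c - w (t, y) a (fderiv ℝ v y c)) :
    ∃ H' : ℝ, HasDerivAt (fun s : ℝ => hsSq (g (y + s • v y)) (w (t + s, y + s • v y))) H' 0 ∧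
      |H' + 2 * lam * hsSq (g y) (w (t, y))| ≤ 4 * K * hsSq (g y) (w (t, y)) := by
  -- the matrices of `w`, `Dv`, `∂_v g` and `L_v g` in the basis `b`, orthonormal at `y`
  set W := gram (w (t, y)) b with hWdef
  set A : Matrix (Fin n) (Fin n) ℝ := Matrix.of fun i k => b.repr (fderiv ℝ v y (b i)) k with hA
  set G' : Matrix (Fin n) (Fin n) ℝ :=
    Matrix.of fun i j => fderiv ℝ g y (v y) (b i) (b j) with hG'
  set L : Matrix (Fin n) (Fin n) ℝ := Matrix.of fun i j => lieMetric g v y (b i) (b j) with hLdef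
  have hLA : L = A + Aᵀ + G' := by
    ext i j
    exact lieMetric_basis hb i j
  have hWt : Wᵀ = -W := by
    ext i j
    exact hskew _ _
  have hH : hsSq (g y) (w (t, y)) = (W * Wᵀ).trace := by
    rw [hsSq_eq _ _ b, hb]; simp [hWdef]
  have hW : ∀ i j, HasDerivAt (fun s : ℝ => gram (w (t + s, y + s • v y)) b i j)
      ((-lam • W - (A * W + W * Aᵀ)) i j) 0 := by
    intro i j
    have h4 := hasDerivAt_bilin_comp hw (hasDerivAt_line t y (v y)) (by simp) (b i) (b j)
    refine h4.congr_deriv ?_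
    have e1 : w (t, y) (fderiv ℝ v y (b i)) (b j) = (A * W) i j := by
      conv_lhs => rw [← b.sum_repr (fderiv ℝ v y (b i))]
      simp only [map_sum, map_smul, sum_apply, smul_apply]
      simp [Matrix.mul_apply, hWdef, gram_apply, hA]
    have e2 : w (t, y) (b i) (fderiv ℝ v y (b j)) = (W * Aᵀ) i j := by
      conv_lhs => rw [← b.sum_repr (fderiv ℝ v y (b j))]
      simp only [map_sum, map_smul]
      simp [Matrix.mul_apply, hWdef, gram_apply, hA, mul_comm]
    have e3 := hev (b i) (b j)
    rw [e1, e2] at e3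
    rw [e3]
    simp [hWdef, gram_apply]
    ring
  have h0 : gram (g (y + (0 : ℝ) • v y)) b = 1 := by simpa using hb
  have h := hasDerivAt_trace_inv_mul (G' := G') (fun i j => hasDerivAt_gram_line (v := v) hg i j)
    hW h0
  have hW0 : gram (w (t + 0, y + (0 : ℝ) • v y)) b = W := by simp [hWdef]
  rw [hW0, trace_transport hWt hLA] at h
  simp only [← hsSq_eq] at h
  refine ⟨_, h, ?_⟩
  have hbd := abs_trace_mul_mul_transpose_le (L := L) (W := W) (abs_lieMetric_basis_le hb hL)
  rw [hH]
  have : -2 * lam * (W * Wᵀ).trace - 2 * (L * (W * Wᵀ)).trace + 2 * lam * (W * Wᵀ).trace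
    = -(2 * (L * (W * Wᵀ)).trace) := by ring
  rw [this, abs_neg, abs_mul, abs_two]
  linarith

/-- The logarithmic rate of change of the volume of a metric along a vector field is at most
`n K`, where `2 K` bounds `L_v g`. -/
theorem hasDerivAt_dens_line (hg : DifferentiableAt ℝ g y) (hb : gram (g y) b = 1)
    (hL : ∀ a, |lieMetric g v y a a| ≤ 2 * K * g y a a) :
    ∃ J' : ℝ, HasDerivAt (fun s : ℝ => dens (g (y + s • v y))) J' 0 ∧
      |J' + dens (g y) * LinearMap.trace ℝ (Eucl n) (fderiv ℝ v y)| ≤ n * K * dens (g y) := by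
  set G' : Matrix (Fin n) (Fin n) ℝ :=
    Matrix.of fun i j => fderiv ℝ g y (v y) (b i) (b j) with hG'
  set L : Matrix (Fin n) (Fin n) ℝ := Matrix.of fun i j => lieMetric g v y (b i) (b j) with hLdef
  have h0 : gram (g (y + (0 : ℝ) • v y)) b = 1 := by simpa using hb
  have h1 := hasDerivAt_det (A := fun s : ℝ => gram (g (y + s • v y)) b) (A' := G')
    (fun i j => hasDerivAt_gram_line (v := v) hg i j) h0
  have h2 := (h1.sqrt (by rw [h0]; simp)).const_mul |((stdB n).toMatrix b).det|⁻¹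
  simp only [← dens_eq] at h2
  refine ⟨_, h2, ?_⟩
  have h3 : dens (g y) = |((stdB n).toMatrix b).det|⁻¹ := by
    rw [dens_eq _ b, hb]; simp
  have h4 : L.trace = 2 * LinearMap.trace ℝ (Eucl n) (fderiv ℝ v y) + G'.trace := by
    rw [LinearMap.trace_eq_matrix_trace ℝ b]
    simp only [Matrix.trace, Matrix.diag, hLdef, hG', Matrix.of_apply, lieMetric_basis hb,
      LinearMap.toMatrix_apply, Finset.sum_add_distrib, ContinuousLinearMap.coe_coe]
    ring
  have h5 := abs_trace_le (L := L) (abs_lieMetric_basis_le hb hL)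
  rw [h0, Matrix.det_one, Real.sqrt_one, ← h3]
  have h6 : dens (g y) * (G'.trace / (2 * 1)) +
      dens (g y) * LinearMap.trace ℝ (Eucl n) (fderiv ℝ v y) = dens (g y) * (L.trace / 2) := by
    rw [h4]; ring
  rw [h6, abs_mul, abs_of_pos (dens_pos hb), abs_div, abs_two]
  have := (dens_pos hb).le
  calc dens (g y) * (|L.trace| / 2) ≤ dens (g y) * (n * (2 * K) / 2) := by
        gcongr
    _ = n * K * dens (g y) := by ring

end Gram

/-! ### The Levi-Civita connection in coordinates -/

section KoszulFormulas

variable {n : ℕ}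

theorem koszul_apply (g : Eucl n → Eucl n →L[ℝ] Eucl n →L[ℝ] ℝ) (y a b c : Eucl n) :
    koszul g y a b c =
      1 / 2 * (fderiv ℝ g y a b c + fderiv ℝ g y b a c - fderiv ℝ g y c a b) := by
  simp [koszul]

theorem fderiv_symm {E : Type*} [NormedAddCommGroup E] [NormedSpace ℝ E]
    {g : E → E →L[ℝ] E →L[ℝ] ℝ} {y : E}
    (hg : DifferentiableAt ℝ g y) (hsymm : ∀ y b c, g y b c = g y c b) (a b c : E) :
    fderiv ℝ g y a b c = fderiv ℝ g y a c b := by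
  have h : ∀ b c, HasFDerivAt (fun y => g y b c) _ y := fun b c =>
    (hg.hasFDerivAt.clm_apply (hasFDerivAt_const b y)).clm_apply (hasFDerivAt_const c y)
  have h1 := h b c
  simp only [hsymm _ b c] at h1
  simpa using DFunLike.congr_fun (h1.unique (h c b)) a

/-- The Levi-Civita connection is metric: `Γ(a, b, c) + Γ(a, c, b) = ∂ₐ g(b, c)` for the lowered
Christoffel symbols. -/
theorem koszul_metric {g : Eucl n → Eucl n →L[ℝ] Eucl n →L[ℝ] ℝ} {y : Eucl n}
    (hg : DifferentiableAt ℝ g y) (hsymm : ∀ y b c, g y b c = g y c b) (a b c : Eucl n) :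
    koszul g y a b c + koszul g y a c b = fderiv ℝ g y a b c := by
  simp only [koszul_apply, fderiv_symm hg hsymm a c b, fderiv_symm hg hsymm b a c,
    fderiv_symm hg hsymm c a b]
  ring

theorem koszul_self {g : Eucl n → Eucl n →L[ℝ] Eucl n →L[ℝ] ℝ} {y : Eucl n}
    (hg : DifferentiableAt ℝ g y) (hsymm : ∀ y b c, g y b c = g y c b) (a b : Eucl n) :
    koszul g y a b a = 1 / 2 * fderiv ℝ g y b a a := by
  simp only [koszul_apply, fderiv_symm hg hsymm a b a]
  ring

theorem hasFDerivAt_lower {E : Type*} [NormedAddCommGroup E] [NormedSpace ℝ E]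
    {g : E → E →L[ℝ] E →L[ℝ] ℝ} {U : E → E} {y : E} (hg : DifferentiableAt ℝ g y)
    (hU : DifferentiableAt ℝ U y) :
    DifferentiableAt ℝ (fun y => g y (U y)) y ∧ ∀ a b, fderiv ℝ (fun y => g y (U y)) y a b =
      fderiv ℝ g y a (U y) b + g y (fderiv ℝ U y a) b := by
  have h := hg.hasFDerivAt.clm_apply hU.hasFDerivAt
  refine ⟨h.differentiableAt, fun a b => ?_⟩
  rw [h.fderiv]
  simp [add_comm]

/-- The covariant derivative of a vector field and of its dual one-form, in coordinates. -/
theorem lower_koszul {g : Eucl n → Eucl n →L[ℝ] Eucl n →L[ℝ] ℝ} {U : Eucl n → Eucl n}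
    {y : Eucl n} (hg : DifferentiableAt ℝ g y) (hsymm : ∀ y b c, g y b c = g y c b)
    (hU : DifferentiableAt ℝ U y) (a : Eucl n) :
    g y (fderiv ℝ U y a) + koszul g y a (U y) =
      fderiv ℝ (fun y => g y (U y)) y a - (koszul g y a).flip (U y) := by
  ext b
  have h2 := koszul_metric hg hsymm a (U y) b
  rw [add_apply, sub_apply, (hasFDerivAt_lower hg hU).2, ContinuousLinearMap.flip_apply, ← h2]
  ring

theorem koszul_self' {g : Eucl n → Eucl n →L[ℝ] Eucl n →L[ℝ] ℝ} {y : Eucl n}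
    (a b : Eucl n) :
    koszul g y a b b = 1 / 2 * fderiv ℝ g y a b b := by
  simp only [koszul_apply]
  ring

theorem fderiv_normSq {E : Type*} [NormedAddCommGroup E] [NormedSpace ℝ E]
    {g : E → E →L[ℝ] E →L[ℝ] ℝ} {U : E → E} {y : E} (hg : DifferentiableAt ℝ g y)
    (hU : DifferentiableAt ℝ U y) (hsymm : ∀ y b c, g y b c = g y c b) :
    DifferentiableAt ℝ (fun y => g y (U y) (U y)) y ∧
      ∀ a, fderiv ℝ (fun y => g y (U y) (U y)) y a =
        fderiv ℝ g y a (U y) (U y) + 2 * g y (fderiv ℝ U y a) (U y) := by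
  have h := (hg.hasFDerivAt.clm_apply hU.hasFDerivAt).clm_apply hU.hasFDerivAt
  refine ⟨h.differentiableAt, fun a => ?_⟩
  rw [h.fderiv]
  simp [hsymm y (U y) (fderiv ℝ U y a)]
  ring

/-- The coordinate form of `∇_u u^* = ι_u d u^* + d |u|² / 2`. -/
theorem lower_koszul_self {g : Eucl n → Eucl n →L[ℝ] Eucl n →L[ℝ] ℝ} {U : Eucl n → Eucl n}
    {y : Eucl n} (hg : DifferentiableAt ℝ g y) (hsymm : ∀ y b c, g y b c = g y c b)
    (hU : DifferentiableAt ℝ U y) (b : Eucl n) :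
    fderiv ℝ (fun y => g y (U y)) y (U y) b - koszul g y (U y) b (U y) =
      dForm (fun y => g y (U y)) y (U y) b +
        1 / 2 * fderiv ℝ (fun y => g y (U y) (U y)) y b := by
  rw [koszul_self hg hsymm, dForm_apply, (fderiv_normSq hg hU hsymm).2]
  simp only [(hasFDerivAt_lower hg hU).2]
  ring

end KoszulFormulas

section ManifoldPointwise

open scoped Bundle

variable {n : ℕ} {M : Type*} [TopologicalSpace M] [ChartedSpace (Eucl n) M]

/-- The differential of a function, as a one-form. -/
def dFun (f : M → ℝ) (q : M) : TangentSpace (𝓡 n) q →L[ℝ] ℝ := mfderiv (𝓡 n) 𝓘(ℝ, ℝ) f q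

theorem hasMFDerivAt_of_chart [IsManifold (𝓡 n) ∞ M] {f : M → ℝ} {x q : M} {D : Eucl n →L[ℝ] ℝ}
    (hq : q ∈ (extChartAt (𝓡 n) x).source)
    (h : HasFDerivAt (fun y => f ((extChartAt (𝓡 n) x).symm y)) D (extChartAt (𝓡 n) x q)) :
    HasMFDerivAt (𝓡 n) 𝓘(ℝ, ℝ) f q (D.comp (toChart x q)) := by
  have h1 : HasMFDerivAt (𝓡 n) 𝓘(ℝ, Eucl n) (extChartAt (𝓡 n) x) q (toChart x q) :=
    (mdifferentiableAt_extChartAt (by rwa [extChartAt_source] at hq)).hasMFDerivAt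
  refine (h.hasMFDerivAt.comp q h1).congr_of_eventuallyEq ?_
  filter_upwards [(isOpen_extChartAt_source (I := 𝓡 n) x).mem_nhds hq] with z hz
  exact congrArg f ((extChartAt (𝓡 n) x).left_inv hz).symm

theorem hasFDerivAt_chart_of_mdifferentiableAt [IsManifold (𝓡 n) ∞ M] {f : M → ℝ} {x q : M}
    (hq : q ∈ (extChartAt (𝓡 n) x).source) (h : MDifferentiableAt (𝓡 n) 𝓘(ℝ, ℝ) f q) :
    HasFDerivAt (fun y => f ((extChartAt (𝓡 n) x).symm y))
      (formInChart (dFun f) x (extChartAt (𝓡 n) x q))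
      (extChartAt (𝓡 n) x q) := by
  have hy := (extChartAt (𝓡 n) x).map_source hq
  have h1 : MDifferentiableAt 𝓘(ℝ, Eucl n) (𝓡 n) (extChartAt (𝓡 n) x).symm
      (extChartAt (𝓡 n) x q) := by
    have := mdifferentiableWithinAt_extChartAt_symm (I := 𝓡 n) hy
    rwa [modelWithCornersSelf_coe, range_id, mdifferentiableWithinAt_univ] at this
  rw [← (extChartAt (𝓡 n) x).left_inv hq] at h
  exact (h.hasMFDerivAt.comp _ h1.hasMFDerivAt).hasFDerivAt

variable [Bundle.RiemannianBundle (fun x : M => TangentSpace (𝓡 n) x)]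

theorem normSq_eq_metricInChart [IsManifold (𝓡 n) ∞ M] (Y : (y : M) → TangentSpace (𝓡 n) y)
    {x : M} {y : Eucl n} (hy : y ∈ (extChartAt (𝓡 n) x).target) :
    ‖Y ((extChartAt (𝓡 n) x).symm y)‖ ^ 2 =
      metricInChart x y (vecInChart Y x y) (vecInChart Y x y) := by
  rw [metricInChart_apply, ← real_inner_self_eq_norm_sq]
  exact congrArg (fun a => inner ℝ a a) (fromChart_toChart hy _).symm

theorem flat_sharp (q : M) (β : TangentSpace (𝓡 n) q →L[ℝ] ℝ) : flat q (sharp q β) = β :=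
  (InnerProductSpace.toDual ℝ (TangentSpace (𝓡 n) q)).apply_symm_apply β

theorem sharp_flat (q : M) (a : TangentSpace (𝓡 n) q) : sharp q (flat q a) = a :=
  (InnerProductSpace.toDual ℝ (TangentSpace (𝓡 n) q)).symm_apply_apply a

theorem flat_grad (f : M → ℝ) (q : M) : flat (n := n) q (grad f q) = dFun (n := n) f q :=
  flat_sharp q _

theorem flat_apply (q : M) (a b : TangentSpace (𝓡 n) q) : flat q a b = inner ℝ a b := rfl

variable [IsManifold (𝓡 n) ∞ M]

theorem exists_orthonormal_chart_basis {x q : M} (hq : q ∈ (extChartAt (𝓡 n) x).source) :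
    ∃ b : Module.Basis (Fin n) ℝ (Eucl n),
      gram (metricInChart x (extChartAt (𝓡 n) x q)) b = 1 ∧
      ∀ w : Eucl n →L[ℝ] Eucl n →L[ℝ] ℝ,
        hsNorm q (fun a c => w (toChart x q a) (toChart x q c)) =
          √(∑ i, ∑ j, w (b i) (b j) ^ 2) := by
  have hn : Module.finrank ℝ (TangentSpace (𝓡 n) q) = n := finrank_euclideanSpace_fin
  let f := (stdOrthonormalBasis ℝ (TangentSpace (𝓡 n) q))
  let e : TangentSpace (𝓡 n) q ≃ₗ[ℝ] Eucl n :=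
    LinearEquiv.ofBijective (toChart x q).toLinearMap
      ⟨toChart_injective hq, fun b => exists_toChart_eq hq b⟩
  have he : ∀ a, e a = toChart x q a := fun _ => rfl
  let σ := finCongr hn
  refine ⟨(f.toBasis.map e).reindex σ, ?_, fun w => ?_⟩
  · ext i j
    rw [gram_apply]
    have h1 : ∀ i, ((f.toBasis.map e).reindex σ) i = toChart x q (f (σ.symm i)) := fun i => by
      simp [he, f]
    rw [h1, h1, metricInChart_toChart hq, orthonormal_iff_ite.1 f.orthonormal, Matrix.one_apply]
    simp
  · rw [hsNorm]
    congr 1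
    rw [← σ.sum_comp]
    refine Finset.sum_congr rfl fun i _ => ?_
    rw [← σ.sum_comp]
    refine Finset.sum_congr rfl fun j _ => ?_
    simp [he, f]

theorem exists_gram_eq_one {x : M} {y : Eucl n} (hy : y ∈ (extChartAt (𝓡 n) x).target) :
    ∃ b : Module.Basis (Fin n) ℝ (Eucl n), gram (metricInChart x y) b = 1 := by
  obtain ⟨b, hb, -⟩ := exists_orthonormal_chart_basis ((extChartAt (𝓡 n) x).map_target hy)
  rw [(extChartAt (𝓡 n) x).right_inv hy] at hb
  exact ⟨b, hb⟩

theorem hsNorm_eq_sqrt_hsSq {x q : M} (hq : q ∈ (extChartAt (𝓡 n) x).source)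
    (w : Eucl n →L[ℝ] Eucl n →L[ℝ] ℝ) :
    hsNorm q (fun a c => w (toChart x q a) (toChart x q c)) =
      √(hsSq (metricInChart x (extChartAt (𝓡 n) x q)) w) := by
  obtain ⟨b, hb, h⟩ := exists_orthonormal_chart_basis hq
  rw [h, hsSq_eq_sum _ _ hb]

omit [IsManifold (𝓡 n) ∞ M] in
theorem volDensity_eq_dens (x : M) (y : Eucl n) : volDensity x y = dens (metricInChart x y) := by
  rw [volDensity, dens]
  congr 3
  ext i j
  simp

theorem volDensity_pos {x : M} {y : Eucl n} (hy : y ∈ (extChartAt (𝓡 n) x).target) :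
    0 < volDensity x y := by
  obtain ⟨b, hb⟩ := exists_gram_eq_one hy
  rw [volDensity_eq_dens]
  exact dens_pos hb

theorem volDensity_transition {x x' : M} {y : Eucl n} (hy : y ∈ overlap x x') :
    volDensity x y = |(fderiv ℝ (transition x x') y).det| *
      volDensity x' (transition x x' y) := by
  rw [volDensity_eq_dens, volDensity_eq_dens]
  exact dens_pullback _ (metricInChart_transition hy)

theorem contDiffOn_volDensity [SmoothMetric n M] (x : M) :
    ContDiffOn ℝ ∞ (volDensity (n := n) x) (extChartAt (𝓡 n) x).target := by
  intro y hy
  obtain ⟨b, hb⟩ := exists_gram_eq_one hy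
  have := contDiffWithinAt_dens (contDiffOn_metricInChart x y hy) (det_gram_pos hb).ne'
  exact this.congr (fun y _ => volDensity_eq_dens x y) (volDensity_eq_dens x y)

variable [SmoothMetric n M]

omit [SmoothMetric n M] in
theorem formInChart_flat_eventuallyEq (Y : (y : M) → TangentSpace (𝓡 n) y) {x : M} {y : Eucl n}
    (hy : y ∈ (extChartAt (𝓡 n) x).target) :
    formInChart (fun q => flat q (Y q)) x =ᶠ[𝓝 y]
      fun y => metricInChart x y (vecInChart Y x y) :=
  eventually_of_mem ((isOpen_extChartAt_target x).mem_nhds hy)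
    fun _ hy => formInChart_flat Y hy

theorem flat_covDeriv {Y : (y : M) → TangentSpace (𝓡 n) y} {q : M}
    (hY : DifferentiableAt ℝ (vecInChart Y q) (extChartAt (𝓡 n) q q))
    (a : TangentSpace (𝓡 n) q) :
    flat q (covDeriv Y q a) = covDerivForm (fun y => flat y (Y y)) q a := by
  have hq := mem_extChartAt_source (I := 𝓡 n) q
  have hy := (extChartAt (𝓡 n) q).map_source hq
  have h := lower_koszul (differentiableAt_metricInChart hy) (metricInChart_symm q) hY
    (toChart q q a)
  rw [← (formInChart_flat_eventuallyEq Y hy).fderiv_eq, vecInChart_extChartAt Y hq] at h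
  rw [covDeriv, flat_sharp, covDerivForm, sharp_flat]
  exact congrArg (fun β : Eucl n →L[ℝ] ℝ => β.comp (toChart q q)) h

omit [IsManifold (𝓡 n) ∞ M] [SmoothMetric n M] in
theorem inner_covDeriv {Y : (y : M) → TangentSpace (𝓡 n) y} {q : M}
    (a b : TangentSpace (𝓡 n) q) :
    inner ℝ (covDeriv Y q a) b =
      metricInChart q (extChartAt (𝓡 n) q q)
        (fderiv ℝ (vecInChart Y q) (extChartAt (𝓡 n) q q) (toChart q q a)) (toChart q q b) +
      koszul (metricInChart q) (extChartAt (𝓡 n) q q) (toChart q q a) (toChart q q (Y q))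
        (toChart q q b) := by
  rw [← flat_apply, covDeriv, flat_sharp]
  rfl

omit [SmoothMetric n M] in
theorem normSq_eventuallyEq (Y : (y : M) → TangentSpace (𝓡 n) y) {x : M} {y : Eucl n}
    (hy : y ∈ (extChartAt (𝓡 n) x).target) :
    (fun y => ‖Y ((extChartAt (𝓡 n) x).symm y)‖ ^ 2) =ᶠ[𝓝 y]
      fun y => metricInChart x y (vecInChart Y x y) (vecInChart Y x y) := by
  filter_upwards [(isOpen_extChartAt_target x).mem_nhds hy] with y hy
  rw [normSq_eq_metricInChart Y hy]

/-- The identity `∇_u u^* = ι_u d u^* + d |u|² / 2`. -/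
theorem covDerivForm_flat_self {Y : (y : M) → TangentSpace (𝓡 n) y} {q : M}
    (hY : DifferentiableAt ℝ (vecInChart Y q) (extChartAt (𝓡 n) q q))
    (b : TangentSpace (𝓡 n) q) :
    covDerivForm (fun y => flat y (Y y)) q (Y q) b = extD (fun y => flat y (Y y)) q (Y q) b +
      1 / 2 * dFun (fun q => ‖Y q‖ ^ 2) q b := by
  have hq := mem_extChartAt_source (I := 𝓡 n) q
  have hy := (extChartAt (𝓡 n) q).map_source hq
  have hg := differentiableAt_metricInChart hy
  have h := lower_koszul_self hg (metricInChart_symm q) hY (toChart q q b)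
  have hN := (fderiv_normSq hg hY (metricInChart_symm q)).1.hasFDerivAt
  have hN2 := (hasMFDerivAt_of_chart (f := fun q => ‖Y q‖ ^ 2) hq
    (hN.congr_of_eventuallyEq (normSq_eventuallyEq Y hy))).mfderiv
  rw [dForm, ← (formInChart_flat_eventuallyEq Y hy).fderiv_eq, ← dForm,
    vecInChart_extChartAt Y hq] at h
  rw [covDerivForm, sharp_flat, dFun, hN2]
  exact h

end ManifoldPointwise

/-! ### Functions on a time slab -/

section Bilinear

variable {E : Type*} [NormedAddCommGroup E] [NormedSpace ℝ E]

theorem contDiff_flip {k : ℕ∞ω} : ContDiff ℝ k (fun B : E →L[ℝ] E →L[ℝ] ℝ => B.flip) := by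
  refine IsBoundedLinearMap.contDiff ⟨⟨fun x y => rfl, fun c x => rfl⟩, 1, one_pos, fun x => ?_⟩
  rw [ContinuousLinearMap.opNorm_flip, one_mul]

theorem fderiv_bilin_apply {B : E → E →L[ℝ] E →L[ℝ] ℝ} {y : E} (hB : DifferentiableAt ℝ B y)
    (a b : E) : HasFDerivAt (fun y => B y a b) (((fderiv ℝ B y).flip a).flip b) y := by
  have h : HasFDerivAt (fun x => B x a b) _ y :=
    (hB.hasFDerivAt.clm_apply (hasFDerivAt_const a _)).clm_apply (hasFDerivAt_const b _)
  exact h.congr_fderiv (by ext; simp)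

end Bilinear

section Slab

variable {E F : Type*} [NormedAddCommGroup E] [NormedSpace ℝ E] [NormedAddCommGroup F]
  [NormedSpace ℝ F] {T : ℝ} {Ω : Set E}

theorem uniqueDiffOn_slab (hT : 0 < T) (hΩ : IsOpen Ω) : UniqueDiffOn ℝ (Icc 0 T ×ˢ Ω) :=
  (uniqueDiffOn_Icc hT).prod hΩ.uniqueDiffOn

omit [NormedSpace ℝ E] in
theorem slab_subset_closure (hT : 0 < T) (hΩ : IsOpen Ω) :
    Icc 0 T ×ˢ Ω ⊆ closure (interior (Icc 0 T ×ˢ Ω)) := by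
  rw [interior_prod_eq, interior_Icc, hΩ.interior_eq, closure_prod_eq, closure_Ioo hT.ne]
  exact prod_mono le_rfl subset_closure

theorem hasFDerivAt_slab {f : ℝ × E → F} {t : ℝ} {y : E} (hΩ : IsOpen Ω) (ht : t ∈ Icc 0 T)
    (hy : y ∈ Ω) (hf : DifferentiableWithinAt ℝ f (Icc 0 T ×ˢ Ω) (t, y)) :
    HasFDerivAt (fun y => f (t, y))
      ((fderivWithin ℝ f (Icc 0 T ×ˢ Ω) (t, y)).comp (ContinuousLinearMap.inr ℝ ℝ E)) y := by
  have h1 : HasFDerivWithinAt (fun y : E => (t, y)) (ContinuousLinearMap.inr ℝ ℝ E) Ω y :=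
    (hasFDerivAt_prodMk_right t y).hasFDerivWithinAt
  exact (hf.hasFDerivWithinAt.comp y h1 fun z hz => ⟨ht, hz⟩).hasFDerivAt (hΩ.mem_nhds hy)

theorem hasDerivWithinAt_slab {f : ℝ × E → F} {t : ℝ} {y : E}
    (hy : y ∈ Ω) (hf : DifferentiableWithinAt ℝ f (Icc 0 T ×ˢ Ω) (t, y)) :
    HasDerivWithinAt (fun s => f (s, y))
      (fderivWithin ℝ f (Icc 0 T ×ˢ Ω) (t, y) (1, 0)) (Icc 0 T) t := by
  have h1 : HasFDerivWithinAt (fun s : ℝ => (s, y)) (ContinuousLinearMap.inl ℝ ℝ E) (Icc 0 T) t :=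
    (hasFDerivAt_prodMk_left t y).hasFDerivWithinAt
  have hm : MapsTo (fun s : ℝ => (s, y)) (Icc 0 T) (Icc 0 T ×ˢ Ω) := fun z hz => ⟨hz, hy⟩
  exact (hf.hasFDerivWithinAt.comp t h1 hm).hasDerivWithinAt.congr_deriv (by simp)

theorem contDiffOn_fderiv_slab {f : ℝ × E → F} {k l : ℕ∞ω} (hT : 0 < T) (hΩ : IsOpen Ω)
    (hf : ContDiffOn ℝ l f (Icc 0 T ×ˢ Ω)) (hkl : k + 1 ≤ l) :
    ContDiffOn ℝ k (fun z : ℝ × E => fderiv ℝ (fun y => f (z.1, y)) z.2) (Icc 0 T ×ˢ Ω) := by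
  have h1 := (hf.fderivWithin (uniqueDiffOn_slab hT hΩ) hkl).clm_comp
    (contDiffOn_const (c := ContinuousLinearMap.inr ℝ ℝ E))
  refine h1.congr fun z hz => ?_
  have hl : l ≠ 0 := by
    rintro rfl
    simp at hkl
  exact (hasFDerivAt_slab hΩ hz.1 hz.2 (hf.differentiableOn hl z hz)).fderiv

theorem contDiffOn_derivWithin_slab {f : ℝ × E → F} {k l : ℕ∞ω} (hT : 0 < T) (hΩ : IsOpen Ω)
    (hf : ContDiffOn ℝ l f (Icc 0 T ×ˢ Ω)) (hkl : k + 1 ≤ l) :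
    ContDiffOn ℝ k (fun z : ℝ × E => derivWithin (fun s => f (s, z.2)) (Icc 0 T) z.1)
      (Icc 0 T ×ˢ Ω) := by
  have h1 := (hf.fderivWithin (uniqueDiffOn_slab hT hΩ) hkl).clm_apply
    (contDiffOn_const (c := ((1 : ℝ), (0 : E))))
  refine h1.congr fun z hz => ?_
  have hl : l ≠ 0 := by
    rintro rfl
    simp at hkl
  exact (hasDerivWithinAt_slab hz.2 (hf.differentiableOn hl z hz)).derivWithin
    (uniqueDiffOn_Icc hT _ hz.1)

/-- Time and space derivatives commute, up to the ends of the time interval. -/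
theorem hasDerivWithinAt_fderiv_slab {f : ℝ × E → F} (hT : 0 < T) (hΩ : IsOpen Ω)
    (hf : ContDiffOn ℝ 2 f (Icc 0 T ×ˢ Ω)) {t : ℝ} {y : E} (ht : t ∈ Icc 0 T) (hy : y ∈ Ω)
    (a : E) :
    HasDerivWithinAt (fun s => fderiv ℝ (fun y => f (s, y)) y a)
      (fderiv ℝ (fun y => derivWithin (fun s => f (s, y)) (Icc 0 T) t) y a) (Icc 0 T) t := by
  set D := Icc 0 T ×ˢ Ω with hD
  have hU : UniqueDiffOn ℝ D := uniqueDiffOn_slab hT hΩ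
  have hA : ContDiffOn ℝ 1 (fderivWithin ℝ f D) D := hf.fderivWithin hU (by norm_num)
  have hAd : DifferentiableWithinAt ℝ (fderivWithin ℝ f D) D (t, y) :=
    hA.differentiableOn (by norm_num) _ ⟨ht, hy⟩
  have hfd : ∀ z ∈ D, DifferentiableWithinAt ℝ f D z := hf.differentiableOn (by norm_num)
  have hsymm : IsSymmSndFDerivWithinAt ℝ f D (t, y) :=
    (hf (t, y) ⟨ht, hy⟩).isSymmSndFDerivWithinAt (by simp) hU
      (slab_subset_closure hT hΩ ⟨ht, hy⟩) ⟨ht, hy⟩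
  have h1 : HasDerivWithinAt (fun s => fderivWithin ℝ f D (s, y) (0, a))
      (fderivWithin ℝ (fderivWithin ℝ f D) D (t, y) (1, 0) (0, a)) (Icc 0 T) t := by
    have := (hasDerivWithinAt_slab hy hAd).clm_apply (hasDerivWithinAt_const t (Icc 0 T)
      ((0 : ℝ), a))
    simpa using this
  have h2 : HasFDerivAt (fun y => fderivWithin ℝ f D (t, y) (1, 0)) _ y :=
    (hasFDerivAt_slab hΩ ht hy hAd).clm_apply (hasFDerivAt_const ((1 : ℝ), (0 : E)) y)
  have h3 : (fun y => derivWithin (fun s => f (s, y)) (Icc 0 T) t) =ᶠ[𝓝 y]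
      fun y => fderivWithin ℝ f D (t, y) (1, 0) := by
    filter_upwards [hΩ.mem_nhds hy] with z hz
    exact (hasDerivWithinAt_slab hz (hfd _ ⟨ht, hz⟩)).derivWithin (uniqueDiffOn_Icc hT _ ht)
  have h4 : fderiv ℝ (fun y => derivWithin (fun s => f (s, y)) (Icc 0 T) t) y a =
      fderivWithin ℝ (fderivWithin ℝ f D) D (t, y) (1, 0) (0, a) := by
    rw [h3.fderiv_eq, h2.fderiv, hsymm.eq (1, 0) (0, a)]
    simp [hD]
  rw [h4]
  refine h1.congr (fun s hs => ?_) ?_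
  · rw [(hasFDerivAt_slab hΩ hs hy (hfd _ ⟨hs, hy⟩)).fderiv]; simp [hD]
  · rw [(hasFDerivAt_slab hΩ ht hy (hfd _ ⟨ht, hy⟩)).fderiv]; simp [hD]

theorem contDiffOn_dForm_slab {α : ℝ × E → E →L[ℝ] ℝ} {k l : ℕ∞ω} (hT : 0 < T) (hΩ : IsOpen Ω)
    (hα : ContDiffOn ℝ l α (Icc 0 T ×ˢ Ω)) (hkl : k + 1 ≤ l) :
    ContDiffOn ℝ k (fun z : ℝ × E => dForm (fun y => α (z.1, y)) z.2) (Icc 0 T ×ˢ Ω) := by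
  have h1 := contDiffOn_fderiv_slab hT hΩ hα hkl
  have h2 : ContDiffOn ℝ k (fun z : ℝ × E => (fderiv ℝ (fun y => α (z.1, y)) z.2).flip)
      (Icc 0 T ×ˢ Ω) :=
    contDiff_flip.comp_contDiffOn h1
  exact h1.sub h2

/-- The time derivative of `dα` is the exterior derivative of the time derivative of `α`. -/
theorem hasDerivWithinAt_dForm_slab {α : ℝ × E → E →L[ℝ] ℝ} (hT : 0 < T) (hΩ : IsOpen Ω)
    (hα : ContDiffOn ℝ 2 α (Icc 0 T ×ˢ Ω)) {t : ℝ} {y : E} (ht : t ∈ Icc 0 T) (hy : y ∈ Ω)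
    (a b : E) :
    HasDerivWithinAt (fun s => dForm (fun y => α (s, y)) y a b)
      (dForm (fun y => derivWithin (fun s => α (s, y)) (Icc 0 T) t) y a b) (Icc 0 T) t := by
  have h : ∀ a b, HasDerivWithinAt (fun s => fderiv ℝ (fun y => α (s, y)) y a b)
      (fderiv ℝ (fun y => derivWithin (fun s => α (s, y)) (Icc 0 T) t) y a b) (Icc 0 T) t := by
    intro a b
    have := (hasDerivWithinAt_fderiv_slab hT hΩ hα ht hy a).clm_apply
      (hasDerivWithinAt_const t (Icc 0 T) b)
    simpa using this
  exact (h a b).sub (h b a)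

end Slab

section Dynamics

variable {E : Type*} [NormedAddCommGroup E] [NormedSpace ℝ E]

/-- The exterior derivative of a differential vanishes. -/
theorem fderiv_fderiv_symm_of_eventually {f : E → ℝ} {α : E → E →L[ℝ] ℝ} {y : E}
    (h : ∀ᶠ y in 𝓝 y, HasFDerivAt f (α y) y) (hα : DifferentiableAt ℝ α y) (a b : E) :
    dForm α y a b = 0 := by
  rw [dForm_apply, second_derivative_symmetric_of_eventually_of_real h hα.hasFDerivAt a b, sub_self]

/-- Cartan's formula `d(ι_v dα)(a, b) = (L_v dα)(a, b)` for a one-form `α` of class `C^2`. -/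
theorem dForm_contract {α : E → E →L[ℝ] ℝ} {v : E → E} {y : E}
    (hα : ContDiffAt ℝ 2 α y) (hv : DifferentiableAt ℝ v y) :
    DifferentiableAt ℝ (dForm α) y ∧ DifferentiableAt ℝ (fun y => dForm α y (v y)) y ∧
    ∀ a b, dForm (fun y => dForm α y (v y)) y a b =
      fderiv ℝ (dForm α) y (v y) a b + dForm α y (fderiv ℝ v y a) b
        + dForm α y a (fderiv ℝ v y b) := by
  have hA : DifferentiableAt ℝ (fderiv ℝ α) y :=
    (hα.fderiv_right (m := 1) (by norm_num)).differentiableAt (by norm_num)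
  have hW : DifferentiableAt ℝ (dForm α) y :=
    hA.fun_sub (((contDiff_flip (k := 1)).differentiable (by simp)).differentiableAt.comp y hA)
  have hWap : ∀ c a b, fderiv ℝ (dForm α) y c a b =
      fderiv ℝ (fderiv ℝ α) y c a b - fderiv ℝ (fderiv ℝ α) y c b a := by
    intro c a b
    have h1 := fderiv_bilin_apply hW a b
    have h2 := (fderiv_bilin_apply hA a b).sub (fderiv_bilin_apply hA b a)
    simpa using DFunLike.congr_fun (h1.unique h2) c
  have hC := (hW.hasFDerivAt.clm_apply hv.hasFDerivAt)
  refine ⟨hW, hC.differentiableAt, fun a b => ?_⟩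
  have hs := hα.isSymmSndFDerivAt (by simp)
  have hCap : ∀ a b, fderiv ℝ (fun y => dForm α y (v y)) y a b =
      fderiv ℝ (dForm α) y a (v y) b + dForm α y (fderiv ℝ v y a) b := by
    intro a b
    rw [hC.fderiv]
    simp [add_comm]
  rw [dForm_apply, hCap, hCap, hWap, hWap, hWap, hs.eq a (v y), hs.eq b (v y), hs.eq a b]
  simp only [dForm_apply]
  ring

end Dynamics

/-! ### Regularity of the transporting velocity -/

section Positivity

variable {X E : Type*} [NormedAddCommGroup E] [NormedSpace ℝ E]

/-- A positive definite form on a finite-dimensional space is bounded below by a multiple of the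
squared norm. -/
theorem exists_lower_bound [FiniteDimensional ℝ E] {B : E →L[ℝ] E →L[ℝ] ℝ}
    (hB : ∀ a, a ≠ 0 → 0 < B a a) : ∃ r : ℝ, 0 < r ∧ ∀ a, r * ‖a‖ ^ 2 ≤ B a a := by
  have : ProperSpace E := FiniteDimensional.proper ℝ E
  have hcont : ContinuousOn (fun a => B a a) (Metric.sphere 0 1) :=
    (B.continuous.clm_apply continuous_id).continuousOn
  obtain ⟨r, hr, h⟩ := (isCompact_sphere (0 : E) 1).exists_forall_le' hcont (a := 0)
    (fun a ha => hB a (by rintro rfl; simp at ha))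
  refine ⟨r, hr, fun a => ?_⟩
  by_cases ha : a = 0
  · simp [ha]
  · have hn : 0 < ‖a‖ := norm_pos_iff.2 ha
    have h1 := h (‖a‖⁻¹ • a) (by simp [norm_smul, hn.ne'])
    simp only [map_smul, smul_apply, smul_eq_mul] at h1
    calc r * ‖a‖ ^ 2 ≤ (‖a‖⁻¹ * (‖a‖⁻¹ * B a a)) * ‖a‖ ^ 2 := by gcongr
      _ = B a a := by field_simp

theorem eventually_lower_bound [TopologicalSpace X] [FiniteDimensional ℝ E]
    {G : X → E →L[ℝ] E →L[ℝ] ℝ} {S : Set X} {x : X} (hG : ContinuousWithinAt G S x)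
    (hpos : ∀ a, a ≠ 0 → 0 < G x a a) :
    ∃ r : ℝ, 0 < r ∧ ∀ᶠ x' in 𝓝[S] x, ∀ a, r * ‖a‖ ^ 2 ≤ G x' a a := by
  obtain ⟨r, hr, h⟩ := exists_lower_bound hpos
  refine ⟨r / 2, half_pos hr, ?_⟩
  filter_upwards [hG.eventually (Metric.ball_mem_nhds (G x) (half_pos hr))] with x' hx' a
  replace hx' : ‖G x' - G x‖ < r / 2 :=
    (dist_eq_norm (G x') (G x)).symm.trans_lt hx'
  have h1 : |(G x' - G x) a a| ≤ r / 2 * ‖a‖ ^ 2 := by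
    calc |(G x' - G x) a a| = ‖(G x' - G x) a a‖ := rfl
      _ ≤ ‖G x' - G x‖ * ‖a‖ * ‖a‖ := ContinuousLinearMap.le_opNorm₂ _ _ _
      _ ≤ r / 2 * ‖a‖ * ‖a‖ := by gcongr
      _ = r / 2 * ‖a‖ ^ 2 := by ring
  have h2 := (abs_le.1 h1).1
  have h3 : (G x' - G x) a a = G x' a a - G x a a := rfl
  have := h a
  linarith

end Positivity

section Power

variable {X E : Type*} [NormedAddCommGroup X] [NormedSpace ℝ X] [NormedAddCommGroup E]
  [NormedSpace ℝ E] {S : Set X} {N : X → ℝ} {U : X → E} {q : ℝ}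

/-- The candidate for the derivative of `N ^ q • U`. -/
def powDeriv (q : ℝ) (S : Set X) (N : X → ℝ) (U : X → E) (x : X) : X →L[ℝ] E :=
  N x ^ q • fderivWithin ℝ U S x +
    (q * N x ^ (q - 1)) • (fderivWithin ℝ N S x).smulRight (U x)

theorem hasFDerivWithinAt_rpow_smul (hq : 0 < q) {x : X}
    (hN : DifferentiableWithinAt ℝ N S x) (hU : DifferentiableWithinAt ℝ U S x)
    (hNU : N x = 0 → U x = 0) :
    HasFDerivWithinAt (fun x => N x ^ q • U x) (powDeriv q S N U x) S x := by
  by_cases h0 : N x = 0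
  · -- at a zero of `N` the function is the product of `o(1)` and `O(x' - x)`
    have hD : powDeriv q S N U x = 0 := by
      ext; simp [powDeriv, hNU h0, h0, Real.zero_rpow hq.ne']
    rw [hD, hasFDerivWithinAt_iff_isLittleO]
    simp only [hNU h0, smul_zero, sub_zero, zero_apply]
    have h1 : (fun x' => N x' ^ q) =o[𝓝[S] x] (fun _ => (1 : ℝ)) := by
      rw [Asymptotics.isLittleO_one_iff]
      have : ContinuousWithinAt (fun x' => N x' ^ q) S x :=
        hN.continuousWithinAt.rpow_const (Or.inr hq.le)
      simpa [ContinuousWithinAt, h0, Real.zero_rpow hq.ne'] using this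
    have h2 : U =O[𝓝[S] x] fun x' => x' - x := by
      simpa [hNU h0] using hU.hasFDerivWithinAt.isBigO_sub
    simpa using h1.smul_isBigO h2
  · exact ((hN.hasFDerivWithinAt.rpow_const (Or.inl h0)).smul hU.hasFDerivWithinAt).congr_fderiv
      (by ext; simp [powDeriv, smul_smul])

/-- The function `N ^ q • U` is of class `C^1` also at the zeros of `N`, if `|DN| |U| ≤ C N`
there. -/
theorem contDiffOn_rpow_smul (hS : UniqueDiffOn ℝ S) (hq : 0 ≤ q)
    (hN : ContDiffOn ℝ 1 N S) (hU : ContDiffOn ℝ 1 U S) (hN0 : ∀ x ∈ S, 0 ≤ N x)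
    (hNU : ∀ x ∈ S, N x = 0 → U x = 0)
    (hbd : ∀ x ∈ S, ∃ C : ℝ, ∀ᶠ x' in 𝓝[S] x, ‖fderivWithin ℝ N S x'‖ * ‖U x'‖ ≤ C * N x') :
    ContDiffOn ℝ 1 (fun x => N x ^ q • U x) S := by
  rcases hq.eq_or_lt with rfl | hq
  · simpa using hU
  have hNd := hN.differentiableOn (by norm_num)
  have hUd := hU.differentiableOn (by norm_num)
  have hder : ∀ x ∈ S, HasFDerivWithinAt (fun x => N x ^ q • U x) (powDeriv q S N U x) S x :=
    fun x hx => hasFDerivWithinAt_rpow_smul hq (hNd x hx) (hUd x hx) (hNU x hx)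
  have hNc := hN.continuousOn
  have hUc := hU.continuousOn
  have hDN := hN.continuousOn_fderivWithin hS (by norm_num)
  have hDU := hU.continuousOn_fderivWithin hS (by norm_num)
  have hcont : ContinuousOn (powDeriv q S N U) S := by
    intro x hx
    have h1 : ContinuousWithinAt (fun x => N x ^ q • fderivWithin ℝ U S x) S x :=
      ((hNc x hx).rpow_const (Or.inr hq.le)).smul (hDU x hx)
    refine h1.add ?_
    by_cases h0 : N x = 0
    -- near a zero of `N` the second term is at most `q C N ^ q`, which tends to zero
    · obtain ⟨C, hC⟩ := hbd x hx
      have hz : (q * N x ^ (q - 1)) • (fderivWithin ℝ N S x).smulRight (U x) = 0 := by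
        ext; simp [hNU x hx h0]
      rw [ContinuousWithinAt, hz]
      have hlim : Tendsto (fun x' => q * (C * N x' ^ q)) (𝓝[S] x) (𝓝 0) := by
        have : ContinuousWithinAt (fun x' => q * (C * N x' ^ q)) S x :=
          (((hNc x hx).rpow_const (Or.inr hq.le)).const_mul C).const_mul q
        simpa [ContinuousWithinAt, h0, Real.zero_rpow hq.ne'] using this
      refine squeeze_zero_norm' ?_ hlim
      filter_upwards [hC, self_mem_nhdsWithin] with x' hx' hxS
      have hnn := hN0 x' hxS
      rw [norm_smul, ContinuousLinearMap.norm_smulRight_apply, Real.norm_eq_abs,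
        abs_of_nonneg (mul_nonneg hq.le (Real.rpow_nonneg hnn _)), mul_assoc]
      refine mul_le_mul_of_nonneg_left ?_ hq.le
      rcases hnn.eq_or_lt with h | h
      · rw [hNU x' hxS h.symm, ← h, Real.zero_rpow hq.ne']; simp
      · calc N x' ^ (q - 1) * (‖fderivWithin ℝ N S x'‖ * ‖U x'‖)
            ≤ N x' ^ (q - 1) * (C * N x') := by gcongr
          _ = C * (N x' ^ (q - 1) * N x') := by ring
          _ = C * N x' ^ q := by
            rw [← Real.rpow_add_one h.ne', sub_add_cancel]
    · exact (continuousWithinAt_const.mul ((hNc x hx).rpow_const (Or.inl h0))).smul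
        ((ContinuousLinearMap.smulRightL ℝ X E).continuous.continuousAt.comp_continuousWithinAt
          (hDN x hx) |>.clm_apply (hUc x hx))
  have h01 : (1 : ℕ∞ω) = 0 + 1 := by norm_num
  rw [h01, contDiffOn_succ_iff_fderivWithin hS]
  refine ⟨fun x hx => (hder x hx).differentiableWithinAt, by simp, ?_⟩
  rw [contDiffOn_zero]
  exact hcont.congr fun x hx => (hder x hx).fderivWithin (hS x hx)

/-- If `N = G(U, U)` then `|DN| |U|` is locally bounded by a multiple of `|U|²`. -/
theorem eventually_norm_fderivWithin_form_le {F : Type*} [NormedAddCommGroup F] [NormedSpace ℝ F]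
    {G : X → F} (ev : F → E → E → ℝ) (hev : ∀ f a b, |ev f a b| ≤ ‖f‖ * ‖a‖ * ‖b‖)
    (hS : UniqueDiffOn ℝ S) (hG : ContDiffOn ℝ 1 G S) (hU : ContDiffOn ℝ 1 U S)
    (hN : ∀ x ∈ S, ∀ a, fderivWithin ℝ N S x a = ev (G x) (U x) (fderivWithin ℝ U S x a) +
      ev (G x) (fderivWithin ℝ U S x a) (U x) + ev (fderivWithin ℝ G S x a) (U x) (U x))
    {x : X} (hx : x ∈ S) :
    ∃ C : ℝ, 0 ≤ C ∧ ∀ᶠ x' in 𝓝[S] x, ‖fderivWithin ℝ N S x'‖ * ‖U x'‖ ≤ C * ‖U x'‖ ^ 2 := by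
  have hDG := hG.continuousOn_fderivWithin hS (by norm_num)
  have hDU := hU.continuousOn_fderivWithin hS (by norm_num)
  -- `|DN| ≤ Q |U|` with a continuous, hence locally bounded, function `Q`
  let Q : X → ℝ := fun x => ‖fderivWithin ℝ G S x‖ * ‖U x‖ +
    2 * (‖G x‖ * ‖fderivWithin ℝ U S x‖)
  have hQ : ContinuousWithinAt Q S x :=
    ((hDG x hx).norm.mul (hU.continuousOn x hx).norm).add
      (continuousWithinAt_const.mul ((hG.continuousOn x hx).norm.mul (hDU x hx).norm))
  have hQ0 : ∀ x', 0 ≤ Q x' := fun x' => by positivity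
  refine ⟨Q x + 1, by linarith [hQ0 x], ?_⟩
  filter_upwards [hQ.eventually (gt_mem_nhds (lt_add_one (Q x))), self_mem_nhdsWithin]
    with x' h2 hxS
  have hDN : ‖fderivWithin ℝ N S x'‖ ≤ Q x' * ‖U x'‖ := by
    refine ContinuousLinearMap.opNorm_le_bound _ (mul_nonneg (hQ0 x') (norm_nonneg _)) fun a => ?_
    rw [hN x' hxS a, Real.norm_eq_abs]
    have e1 : |ev (G x') (U x') (fderivWithin ℝ U S x' a)| ≤
        ‖G x'‖ * ‖U x'‖ * (‖fderivWithin ℝ U S x'‖ * ‖a‖) :=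
      (hev _ _ _).trans (by gcongr; exact ContinuousLinearMap.le_opNorm _ _)
    have e2 : |ev (G x') (fderivWithin ℝ U S x' a) (U x')| ≤
        ‖G x'‖ * (‖fderivWithin ℝ U S x'‖ * ‖a‖) * ‖U x'‖ :=
      (hev _ _ _).trans (by gcongr; exact ContinuousLinearMap.le_opNorm _ _)
    have e3 : |ev (fderivWithin ℝ G S x' a) (U x') (U x')| ≤
        ‖fderivWithin ℝ G S x'‖ * ‖a‖ * ‖U x'‖ * ‖U x'‖ :=
      (hev _ _ _).trans (by gcongr; exact ContinuousLinearMap.le_opNorm _ _)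
    refine (abs_add_three _ _ _).trans ((add_le_add_three e1 e2 e3).trans (le_of_eq ?_))
    simp only [Q]
    ring
  calc ‖fderivWithin ℝ N S x'‖ * ‖U x'‖ ≤ Q x' * ‖U x'‖ * ‖U x'‖ := by gcongr
    _ = Q x' * ‖U x'‖ ^ 2 := by ring
    _ ≤ (Q x + 1) * ‖U x'‖ ^ 2 := by gcongr

/-- The field `|U|^{2q} U` is of class `C^1`, where `|U|² = G(U, U)` for a family `G` of positive
definite forms. -/
theorem contDiffOn_rpow_form_smul [FiniteDimensional ℝ E] {G : X → E →L[ℝ] E →L[ℝ] ℝ}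
    (hS : UniqueDiffOn ℝ S) (hq : 0 ≤ q) (hG : ContDiffOn ℝ 1 G S) (hU : ContDiffOn ℝ 1 U S)
    (hpos : ∀ x ∈ S, ∀ a, a ≠ 0 → 0 < G x a a) :
    ContDiffOn ℝ 1 (fun x => (G x (U x) (U x)) ^ q • U x) S := by
  have hN : ContDiffOn ℝ 1 (fun x => G x (U x) (U x)) S := (hG.clm_apply hU).clm_apply hU
  have hnn : ∀ x ∈ S, 0 ≤ G x (U x) (U x) := fun x hx => by
    by_cases h : U x = 0
    · simp [h]
    · exact (hpos x hx _ h).le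
  refine contDiffOn_rpow_smul hS hq hN hU hnn ?_ ?_
  · intro x hx h
    by_contra hne
    exact (hpos x hx _ hne).ne' h
  · intro x hx
    obtain ⟨r, hr, hev⟩ := eventually_lower_bound (hG.continuousOn x hx) (hpos x hx)
    have hN' : ∀ x' ∈ S, ∀ a, fderivWithin ℝ (fun x => G x (U x) (U x)) S x' a =
        G x' (U x') (fderivWithin ℝ U S x' a) + G x' (fderivWithin ℝ U S x' a) (U x') +
          fderivWithin ℝ G S x' a (U x') (U x') := by
      intro x' hxS a
      have hd1 := (hU.differentiableOn (by norm_num) x' hxS).hasFDerivWithinAt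
      have hd2 : HasFDerivWithinAt (fun x => G x (U x)) _ S x' :=
        ((hG.differentiableOn (by norm_num) x' hxS).hasFDerivWithinAt.clm_apply hd1)
      have hd : HasFDerivWithinAt (fun x => G x (U x) (U x)) _ S x' := hd2.clm_apply hd1
      rw [hd.fderivWithin (hS x' hxS)]
      simp
      ring
    obtain ⟨C, hC, hbd⟩ := eventually_norm_fderivWithin_form_le (fun f a b => f a b)
      (fun f a b => ContinuousLinearMap.le_opNorm₂ f a b) hS hG hU hN' hx
    refine ⟨C / r, ?_⟩
    filter_upwards [hev, hbd] with x' h1 h2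
    refine h2.trans ?_
    have := h1 (U x')
    rw [div_mul_eq_mul_div, le_div_iff₀ hr]
    calc C * ‖U x'‖ ^ 2 * r = C * (r * ‖U x'‖ ^ 2) := by ring
      _ ≤ _ := by gcongr

end Power

/-! ### The vorticity equation -/

section VorticityCalculus

variable {E : Type*} [NormedAddCommGroup E] [NormedSpace ℝ E] {T lam : ℝ} {Ω : Set E}

theorem dForm_neg_sub_smul {α₁ α₂ α₃ : E → E →L[ℝ] ℝ} {y : E} (h₁ : DifferentiableAt ℝ α₁ y)
    (h₂ : DifferentiableAt ℝ α₂ y) (h₃ : DifferentiableAt ℝ α₃ y) (lam : ℝ) :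
    DifferentiableAt ℝ (fun y => -α₁ y - lam • (α₂ y + α₃ y)) y ∧
      ∀ a b, dForm (fun y => -α₁ y - lam • (α₂ y + α₃ y)) y a b =
        -dForm α₁ y a b - lam * (dForm α₂ y a b + dForm α₃ y a b) := by
  have h : HasFDerivAt (fun y => -α₁ y - lam • (α₂ y + α₃ y))
      (-fderiv ℝ α₁ y - lam • (fderiv ℝ α₂ y + fderiv ℝ α₃ y)) y :=
    h₁.hasFDerivAt.neg.sub ((h₂.hasFDerivAt.add h₃.hasFDerivAt).const_smul lam)
  refine ⟨h.differentiableAt, fun a b => ?_⟩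
  rw [dForm_apply, h.fderiv]
  simp only [dForm_apply, sub_apply, neg_apply, smul_apply, add_apply, smul_eq_mul]
  ring

/-- If `β = -∂ₜα - lam (α + δ)` with `δ` closed, then `∂ₜ dα = -dβ - lam dα`. -/
theorem hasDerivWithinAt_dForm_of_eq {α : ℝ × E → E →L[ℝ] ℝ} {β δ : E → E →L[ℝ] ℝ} (hT : 0 < T)
    (hΩ : IsOpen Ω) (hα : ContDiffOn ℝ 2 α (Icc 0 T ×ˢ Ω)) {t : ℝ} {y : E} (ht : t ∈ Icc 0 T)
    (hy : y ∈ Ω) (hδ : DifferentiableAt ℝ δ y) (hδ0 : ∀ a b, dForm δ y a b = 0)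
    (hβ : ∀ y ∈ Ω, β y = -derivWithin (fun s => α (s, y)) (Icc 0 T) t - lam • (α (t, y) + δ y)) :
    DifferentiableAt ℝ β y ∧ ∀ a b,
      HasDerivWithinAt (fun s => dForm (fun y => α (s, y)) y a b)
        (-dForm β y a b - lam * dForm (fun y => α (t, y)) y a b) (Icc 0 T) t := by
  have hev : β =ᶠ[𝓝 y] fun y => -derivWithin (fun s => α (s, y)) (Icc 0 T) t
      - lam • (α (t, y) + δ y) := by
    filter_upwards [hΩ.mem_nhds hy] with y hy using hβ y hy
  have h1 : DifferentiableAt ℝ (fun y => derivWithin (fun s => α (s, y)) (Icc 0 T) t) y :=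
    (hasFDerivAt_slab hΩ ht hy (((contDiffOn_derivWithin_slab (k := 1) hT hΩ hα
      (by norm_num)).differentiableOn (by norm_num)) (t, y) ⟨ht, hy⟩)).differentiableAt
  have h2 : DifferentiableAt ℝ (fun y => α (t, y)) y :=
    (hasFDerivAt_slab hΩ ht hy ((hα.differentiableOn (by norm_num)) (t, y)
      ⟨ht, hy⟩)).differentiableAt
  obtain ⟨h3, h4⟩ := dForm_neg_sub_smul h1 h2 hδ lam
  refine ⟨h3.congr_of_eventuallyEq hev, fun a b => ?_⟩
  have h5 : dForm β y a b = dForm (fun y => -derivWithin (fun s => α (s, y)) (Icc 0 T) t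
      - lam • (α (t, y) + δ y)) y a b := by
    rw [dForm_apply, dForm_apply, hev.fderiv_eq]
  rw [h5, h4, hδ0]
  convert hasDerivWithinAt_dForm_slab hT hΩ hα ht hy a b using 1
  ring

/-- The vorticity equation in Lie form: if moreover `β = ι_v dα + dψ`, then
`∂ₜ dα + L_v dα = -lam dα`. -/
theorem hasDerivWithinAt_dForm_transport {α : ℝ × E → E →L[ℝ] ℝ} {β δ : E → E →L[ℝ] ℝ}
    {v : E → E} {ψ : E → ℝ} {D : E → E →L[ℝ] ℝ} (hT : 0 < T)
    (hΩ : IsOpen Ω) (hα : ContDiffOn ℝ 2 α (Icc 0 T ×ˢ Ω)) {t : ℝ} {y : E} (ht : t ∈ Icc 0 T)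
    (hy : y ∈ Ω) (hδ : DifferentiableAt ℝ δ y) (hδ0 : ∀ a b, dForm δ y a b = 0)
    (hβ : ∀ y ∈ Ω, β y = -derivWithin (fun s => α (s, y)) (Icc 0 T) t - lam • (α (t, y) + δ y))
    (hv : DifferentiableAt ℝ v y) (hψ : ∀ y ∈ Ω, HasFDerivAt ψ (D y) y)
    (hβv : ∀ y ∈ Ω, β y = dForm (fun y => α (t, y)) y (v y) + D y) (a b : E) :
      HasDerivWithinAt (fun s => dForm (fun y => α (s, y)) y a b)
        (-lam * dForm (fun y => α (t, y)) y a b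
          - fderiv ℝ (dForm fun y => α (t, y)) y (v y) a b
          - dForm (fun y => α (t, y)) y (fderiv ℝ v y a) b
          - dForm (fun y => α (t, y)) y a (fderiv ℝ v y b)) (Icc 0 T) t := by
  obtain ⟨hβd, h⟩ := hasDerivWithinAt_dForm_of_eq hT hΩ hα ht hy hδ hδ0 hβ
  have hαt : ContDiffAt ℝ 2 (fun y => α (t, y)) y := by
    have : ContDiffOn ℝ 2 (fun y => α (t, y)) Ω :=
      hα.comp (contDiff_prodMk_right t).contDiffOn fun y hy => ⟨ht, hy⟩
    exact this.contDiffAt (hΩ.mem_nhds hy)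
  obtain ⟨-, hc, hc'⟩ := dForm_contract hαt hv
  have hev : D =ᶠ[𝓝 y] fun y => β y - dForm (fun y => α (t, y)) y (v y) := by
    filter_upwards [hΩ.mem_nhds hy] with y hy
    rw [hβv y hy, add_sub_cancel_left]
  have hd : HasFDerivAt D (fderiv ℝ β y -
      fderiv ℝ (fun y => dForm (fun y => α (t, y)) y (v y)) y) y :=
    HasFDerivAt.congr_of_eventuallyEq (hβd.hasFDerivAt.sub hc.hasFDerivAt) hev
  have h0 := fderiv_fderiv_symm_of_eventually
    (by filter_upwards [hΩ.mem_nhds hy] with y hy using hψ y hy) hd.differentiableAt a b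
  rw [dForm_apply, hd.fderiv] at h0
  have h1 := hc' a b
  convert h a b using 1
  rw [dForm_apply] at h1
  simp only [sub_apply] at h0
  rw [dForm_apply β]
  linarith

/-- Lowering an index preserves regularity on a slab. -/
theorem contDiffOn_lower_slab {G : E → E →L[ℝ] E →L[ℝ] ℝ} {U : ℝ × E → E} {I : Set ℝ}
    {k : ℕ∞ω} (hG : ContDiffOn ℝ k G Ω) (hU : ContDiffOn ℝ k U (I ×ˢ Ω)) :
    ContDiffOn ℝ k (fun z : ℝ × E => G z.2 (U z)) (I ×ˢ Ω) := by
  have h : ContDiffOn ℝ k (fun z : ℝ × E => G z.2) (I ×ˢ Ω) :=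
    hG.comp contDiff_snd.contDiffOn fun z hz => hz.2
  exact h.clm_apply hU

/-- The field `|U|^{2q} U` on a slab, for a positive definite family of forms. -/
theorem contDiffOn_rpow_form_smul_slab [FiniteDimensional ℝ E] {G : E → E →L[ℝ] E →L[ℝ] ℝ}
    {U : ℝ × E → E} {q : ℝ} (hT : 0 < T) (hΩ : IsOpen Ω) (hq : 0 ≤ q) (hG : ContDiffOn ℝ 1 G Ω)
    (hU : ContDiffOn ℝ 1 U (Icc 0 T ×ˢ Ω)) (hpos : ∀ y ∈ Ω, ∀ a, a ≠ 0 → 0 < G y a a) :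
    ContDiffOn ℝ 1 (fun z : ℝ × E => (G z.2 (U z) (U z)) ^ q • U z) (Icc 0 T ×ˢ Ω) := by
  have h : ContDiffOn ℝ 1 (fun z : ℝ × E => G z.2) (Icc 0 T ×ˢ Ω) :=
    hG.comp contDiff_snd.contDiffOn fun z hz => hz.2
  exact contDiffOn_rpow_form_smul (uniqueDiffOn_slab hT hΩ) hq h hU fun z hz => hpos z.2 hz.2

theorem hasDerivAt_slices {F : Type*} [NormedAddCommGroup F] [NormedSpace ℝ F] {w : ℝ × E → F}
    {t : ℝ} {y : E} (hw : DifferentiableAt ℝ w (t, y)) :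
    HasDerivAt (fun s => w (s, y)) (fderiv ℝ w (t, y) (1, 0)) t ∧
      HasFDerivAt (fun y => w (t, y))
        ((fderiv ℝ w (t, y)).comp (ContinuousLinearMap.inr ℝ ℝ E)) y :=
  ⟨HasFDerivAt.comp_hasDerivAt (f := fun s => (s, y)) t hw.hasFDerivAt
    ((hasDerivAt_id t).prodMk (hasDerivAt_const t y)),
    hw.hasFDerivAt.comp y (hasFDerivAt_prodMk_right t y)⟩

/-- Splitting of a derivative in space-time into its time and space parts. -/
theorem fderiv_one_right_of_hasDerivAt {w : ℝ × E → E →L[ℝ] E →L[ℝ] ℝ} {t r r' : ℝ} {y v a b : E}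
    (hw : DifferentiableAt ℝ w (t, y)) (h : HasDerivAt (fun s => w (s, y) a b) r t)
    (hr : r + fderiv ℝ (fun y => w (t, y)) y v a b = r') :
    fderiv ℝ w (t, y) (1, v) a b = r' := by
  obtain ⟨h1, h2⟩ := hasDerivAt_slices (F := E →L[ℝ] E →L[ℝ] ℝ) (w := w) hw
  have h3 : HasDerivAt (fun s => w (s, y) a b) (fderiv ℝ w (t, y) (1, 0) a b) t := by
    have h4 : HasDerivAt (fun s => w (s, y) a) (fderiv ℝ w (t, y) (1, 0) a) t :=
      (h1.clm_apply (hasDerivAt_const t a)).congr_deriv (by simp)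
    exact (h4.clm_apply (hasDerivAt_const t b)).congr_deriv (by simp)
  have hsplit : ((1 : ℝ), v) = (1, 0) + (0, v) := by simp
  rw [← hr, h2.fderiv, h.unique h3, hsplit, map_add]
  simp

end VorticityCalculus

/-! Shortcuts for the instance search on the space of bilinear forms. -/

instance (n : ℕ) : NormedAddCommGroup (Eucl n →L[ℝ] Eucl n →L[ℝ] ℝ) := inferInstance

instance (n : ℕ) : NormedSpace ℝ (Eucl n →L[ℝ] Eucl n →L[ℝ] ℝ) := inferInstance

section ChartVorticity

open scoped Bundle

variable {n : ℕ} {M : Type*} [TopologicalSpace M] [ChartedSpace (Eucl n) M]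

/-- The expression of an exact form, in a chart, is the derivative of the expression of the
function. -/
theorem formInChart_dFun [IsManifold (𝓡 n) ∞ M] {f : M → ℝ} (hf : ContMDiff (𝓡 n) 𝓘(ℝ, ℝ) 2 f)
    {x : M} {y : Eucl n} (hy : y ∈ (extChartAt (𝓡 n) x).target) :
    HasFDerivAt (fun y => f ((extChartAt (𝓡 n) x).symm y)) (formInChart (dFun f) x y) y ∧
    DifferentiableAt ℝ (formInChart (dFun f) x) y ∧
      ∀ a b, dForm (formInChart (dFun f) x) y a b = 0 := by
  have h : ∀ y ∈ (extChartAt (𝓡 n) x).target,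
      HasFDerivAt (fun y => f ((extChartAt (𝓡 n) x).symm y)) (formInChart (dFun f) x y) y := by
    intro y hy
    have := hasFDerivAt_chart_of_mdifferentiableAt (f := f)
      ((extChartAt (𝓡 n) x).map_target hy) (hf.mdifferentiableAt (by norm_num))
    rwa [(extChartAt (𝓡 n) x).right_inv hy] at this
  have hop := isOpen_extChartAt_target (I := 𝓡 n) x
  have hC : ContDiffOn ℝ 2 (fun y => f ((extChartAt (𝓡 n) x).symm y))
      (extChartAt (𝓡 n) x).target :=
    contMDiffOn_iff_contDiffOn.1
      (hf.comp_contMDiffOn (contMDiffOn_extChartAt_symm' (k := 2) x))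
  have hev : formInChart (dFun f) x =ᶠ[𝓝 y]
      fderiv ℝ (fun y => f ((extChartAt (𝓡 n) x).symm y)) := by
    filter_upwards [hop.mem_nhds hy] with y hy using (h y hy).fderiv.symm
  have hd : DifferentiableAt ℝ (formInChart (dFun f) x) y :=
    (((hC.contDiffAt (hop.mem_nhds hy)).fderiv_right (m := 1)
      (by norm_num)).differentiableAt (by norm_num)).congr_of_eventuallyEq hev
  exact ⟨h y hy, hd, fderiv_fderiv_symm_of_eventually
    (f := fun y => f ((extChartAt (𝓡 n) x).symm y))
    (by filter_upwards [hop.mem_nhds hy] with y hy using h y hy) hd⟩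

variable [Bundle.RiemannianBundle (fun x : M => TangentSpace (𝓡 n) x)]

/-- The one-form `u^*` in the chart around `x`, as a function of time and space. -/
def velForm (u : ℝ → (x : M) → TangentSpace (𝓡 n) x) (x : M) (z : ℝ × Eucl n) : Eucl n →L[ℝ] ℝ :=
  formInChart (fun q => flat q (u z.1 q)) x z.2

/-- The two-form `du^*` in the chart around `x`, as a function of time and space. -/
def vortForm (u : ℝ → (x : M) → TangentSpace (𝓡 n) x) (x : M) (z : ℝ × Eucl n) :
    Eucl n →L[ℝ] Eucl n →L[ℝ] ℝ :=
  dForm (fun y => velForm u x (z.1, y)) z.2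

/-- The transporting field `|u|^{p-2} u` in the chart around `x`, as a function of time and
space. -/
def transportVel (p : ℝ) (u : ℝ → (x : M) → TangentSpace (𝓡 n) x) (x : M) (z : ℝ × Eucl n) :
    Eucl n :=
  vecInChart (fun q => ‖u z.1 q‖ ^ (p - 2) • u z.1 q) x z.2

theorem velForm_eq (u : ℝ → (x : M) → TangentSpace (𝓡 n) x) (x : M) (t : ℝ) :
    (fun y => velForm u x (t, y)) = formInChart (fun q => flat q (u t q)) x := rfl

theorem covDerivForm_smul (α : (y : M) → TangentSpace (𝓡 n) y →L[ℝ] ℝ) (x : M) (r : ℝ)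
    (a : TangentSpace (𝓡 n) x) : covDerivForm α x (r • a) = r • covDerivForm α x a := by
  ext b
  simp only [covDerivForm, christoffel, map_smul, ContinuousLinearMap.comp_apply, sub_apply,
    smul_apply, ContinuousLinearMap.flip_apply, koszul_apply, smul_eq_mul]
  ring

variable [IsManifold (𝓡 n) ∞ M] {m : ℕ∞} {c p T : ℝ} {V : ℝ → ℝ}
  {ρ : ℝ → M → ℝ} {u : ℝ → (x : M) → TangentSpace (𝓡 n) x}

theorem vecInChart_transport (t : ℝ) {x : M} {y : Eucl n}
    (hy : y ∈ (extChartAt (𝓡 n) x).target) (p : ℝ) :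
    transportVel p u x (t, y) =
      (metricInChart x y (vecInChart (u t) x y) (vecInChart (u t) x y)) ^ ((p - 2) / 2) •
        vecInChart (u t) x y := by
  rw [← normSq_eq_metricInChart _ hy, ← Real.rpow_natCast, ← Real.rpow_mul (norm_nonneg _)]
  simp only [transportVel, vecInChart, map_smul]
  congr 2
  push_cast
  ring

variable [SmoothMetric n M]

theorem contDiffOn_velForm
    (hu : ContMDiffOn (𝓘(ℝ, ℝ).prod (𝓡 n)) (𝓡 n).tangent (m : ℕ∞ω)
      (fun z : ℝ × M => (⟨z.2, u z.1 z.2⟩ : TangentBundle (𝓡 n) M)) (Icc 0 T ×ˢ univ)) (x : M) :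
    ContDiffOn ℝ (m : ℕ∞ω) (velForm u x) (Icc 0 T ×ˢ (extChartAt (𝓡 n) x).target) := by
  have hg : ContDiffOn ℝ (m : ℕ∞ω) (metricInChart (n := n) x) (extChartAt (𝓡 n) x).target :=
    (contDiffOn_metricInChart x).of_le (by exact_mod_cast le_top)
  exact (contDiffOn_lower_slab hg (contDiffOn_vecInChart hu x)).congr
    fun z hz => formInChart_flat _ hz.2

theorem contDiffOn_transportVel (hT : 0 < T) (hp : 2 ≤ p) (hm : 2 ≤ m)
    (hu : ContMDiffOn (𝓘(ℝ, ℝ).prod (𝓡 n)) (𝓡 n).tangent (m : ℕ∞ω)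
      (fun z : ℝ × M => (⟨z.2, u z.1 z.2⟩ : TangentBundle (𝓡 n) M)) (Icc 0 T ×ˢ univ)) (x : M) :
    ContDiffOn ℝ 1 (transportVel p u x) (Icc 0 T ×ˢ (extChartAt (𝓡 n) x).target) := by
  have hop := isOpen_extChartAt_target (I := 𝓡 n) x
  have h1m : (1 : ℕ∞ω) ≤ (m : ℕ∞ω) := by
    have : (1 : ℕ∞) ≤ m := le_trans (by norm_num) hm
    exact_mod_cast this
  have hg : ContDiffOn ℝ 1 (metricInChart (n := n) x) (extChartAt (𝓡 n) x).target :=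
    (contDiffOn_metricInChart x).of_le (by exact_mod_cast le_top)
  exact (contDiffOn_rpow_form_smul_slab (q := (p - 2) / 2) hT hop (by linarith) hg
    ((contDiffOn_vecInChart hu x).of_le h1m) (fun y hy a ha => metricInChart_pos hy ha)).congr
      fun z hz => vecInChart_transport z.1 hz.2 p

/-- The momentum equation, for one-forms on the manifold. -/
theorem IsSolution.convection_eq (h : IsSolution m c p T V ρ u) (hc : 0 < c)
    {t : ℝ} (ht : t ∈ Icc 0 T) (hm : 2 ≤ m) (q : M) :
    convection p u t q = -flat q (derivWithin (fun s => u s q) (Icc 0 T) t)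
      - c ^ (-p) • (flat q (u t q) + dFun (fun y => deriv V (ρ t y)) q) := by
  have hop := isOpen_extChartAt_target (I := 𝓡 n) q
  have hqt : extChartAt (𝓡 n) q q ∈ (extChartAt (𝓡 n) q).target := mem_extChartAt_target q
  have hd : DifferentiableAt ℝ (vecInChart (u t) q) (extChartAt (𝓡 n) q q) := by
    have h0 : (m : ℕ∞ω) ≠ 0 := by
      have : m ≠ 0 := by rintro rfl; simp at hm
      exact_mod_cast this
    exact (hasFDerivAt_slab hop ht hqt (((contDiffOn_vecInChart h.contMDiffOn_u q).differentiableOn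
      h0) (t, _) ⟨ht, hqt⟩)).differentiableAt
  have h1 := congrArg (flat q) (h.momentum t ht q)
  have hl : ∀ (r : ℝ) (a b : TangentSpace (𝓡 n) q),
      flat q (r • (a + b)) = r • (flat q a + flat q b) := fun r a b => by simp [flat]
  have hl' : ∀ (a b : TangentSpace (𝓡 n) q),
      flat q (-a - b) = -flat q a - flat q b := fun a b => by simp [flat]
  rw [hl, hl', flat_covDeriv hd, covDerivForm_smul, flat_grad] at h1
  have hcp : c ^ (-p) * c ^ p = 1 := by
    rw [← Real.rpow_add hc]; simp
  have h2 := congrArg (fun β => c ^ (-p) • β) h1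
  simp only [smul_smul, hcp, one_smul] at h2
  ext b
  have h3 := DFunLike.congr_fun h2 b
  simp only [convection, add_apply, sub_apply, neg_apply, smul_apply, smul_eq_mul] at h3 ⊢
  linarith

end ChartVorticity

section VorticityEquation

open scoped Bundle

variable {n : ℕ} {M : Type*} [TopologicalSpace M] [ChartedSpace (Eucl n) M]
  [IsManifold (𝓡 n) ∞ M] {m : ℕ∞} {c p T : ℝ} {V : ℝ → ℝ}
  {ρ : ℝ → M → ℝ} {u : ℝ → (x : M) → TangentSpace (𝓡 n) x}

theorem two_le_coe (hm : 2 ≤ m) : (2 : ℕ∞ω) ≤ (m : ℕ∞ω) := WithTop.coe_le_coe.2 hm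

theorem differentiableAt_vecInChart (hm : 2 ≤ m)
    (hu : ContMDiffOn (𝓘(ℝ, ℝ).prod (𝓡 n)) (𝓡 n).tangent (m : ℕ∞ω)
      (fun z : ℝ × M => (⟨z.2, u z.1 z.2⟩ : TangentBundle (𝓡 n) M)) (Icc 0 T ×ˢ univ))
    {t : ℝ} (ht : t ∈ Icc 0 T) {x : M} {y : Eucl n} (hy : y ∈ (extChartAt (𝓡 n) x).target) :
    DifferentiableAt ℝ (vecInChart (u t) x) y :=
  (hasFDerivAt_slab (isOpen_extChartAt_target (I := 𝓡 n) x) ht hy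
    ((((contDiffOn_vecInChart hu x).of_le (two_le_coe hm)).differentiableOn (by norm_num))
      (t, y) ⟨ht, hy⟩)).differentiableAt

variable [Bundle.RiemannianBundle (fun x : M => TangentSpace (𝓡 n) x)]

theorem derivWithin_velForm (hT : 0 < T) (hm : 2 ≤ m)
    (hu : ContMDiffOn (𝓘(ℝ, ℝ).prod (𝓡 n)) (𝓡 n).tangent (m : ℕ∞ω)
      (fun z : ℝ × M => (⟨z.2, u z.1 z.2⟩ : TangentBundle (𝓡 n) M)) (Icc 0 T ×ˢ univ))
    {t : ℝ} (ht : t ∈ Icc 0 T) {x : M} {y : Eucl n} (hy : y ∈ (extChartAt (𝓡 n) x).target) :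
    derivWithin (fun s => velForm u x (s, y)) (Icc 0 T) t =
      formInChart (fun q => flat q (derivWithin (fun s => u s q) (Icc 0 T) t)) x y := by
  have hU := hasDerivWithinAt_slab (t := t) hy
    ((((contDiffOn_vecInChart hu x).of_le (two_le_coe hm)).differentiableOn (by norm_num))
      (t, y) ⟨ht, hy⟩)
  have hud := uniqueDiffOn_Icc hT t ht
  set W := fderivWithin ℝ (fun z : ℝ × Eucl n => vecInChart (u z.1) x z.2)
    (Icc 0 T ×ˢ (extChartAt (𝓡 n) x).target) (t, y) (1, 0) with hW
  have h1 : HasDerivWithinAt (fun s => u s ((extChartAt (𝓡 n) x).symm y)) (fromChart x y W)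
      (Icc 0 T) t := by
    have := (fromChart x y).hasFDerivAt.comp_hasDerivWithinAt t hU
    refine this.congr_of_mem (fun s _ => ?_) ht
    exact (fromChart_toChart hy _).symm
  have h2 : HasDerivWithinAt (fun s => velForm u x (s, y)) (metricInChart x y W) (Icc 0 T) t := by
    have := (metricInChart x y).hasFDerivAt.comp_hasDerivWithinAt t hU
    exact this.congr_of_mem (fun s _ => formInChart_flat _ hy) ht
  rw [h2.derivWithin hud]
  ext b
  simp only [formInChart, h1.derivWithin hud]
  rfl

theorem IsSolution.contMDiff_enthalpy (h : IsSolution m c p T V ρ u)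
    (hV : ContDiffOn ℝ 3 V (Ioi 0)) {t : ℝ} (ht : t ∈ Icc 0 T) :
    ContMDiff (𝓡 n) 𝓘(ℝ, ℝ) 2 (fun y => deriv V (ρ t y)) := by
  have hV' : ContDiffOn ℝ 2 (deriv V) (Ioi 0) :=
    hV.deriv_of_isOpen isOpen_Ioi (by norm_num)
  intro y
  exact ((hV'.contDiffAt (Ioi_mem_nhds (h.rho_pos t ht y))).contMDiffAt).comp y
    (h.contMDiff_rho t ht y)

variable [SmoothMetric n M]

theorem differentiableAt_velForm (hm : 2 ≤ m)
    (hu : ContMDiffOn (𝓘(ℝ, ℝ).prod (𝓡 n)) (𝓡 n).tangent (m : ℕ∞ω)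
      (fun z : ℝ × M => (⟨z.2, u z.1 z.2⟩ : TangentBundle (𝓡 n) M)) (Icc 0 T ×ˢ univ))
    {t : ℝ} (ht : t ∈ Icc 0 T) {x : M} {y : Eucl n} (hy : y ∈ (extChartAt (𝓡 n) x).target) :
    DifferentiableAt ℝ (fun y => velForm u x (t, y)) y :=
  (hasFDerivAt_slab (isOpen_extChartAt_target (I := 𝓡 n) x) ht hy
    ((((contDiffOn_velForm hu x).of_le (two_le_coe hm)).differentiableOn (by norm_num))
      (t, y) ⟨ht, hy⟩)).differentiableAt

/-- The vorticity in an arbitrary chart. -/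
theorem vorticity_eq_vortForm (hm : 2 ≤ m)
    (hu : ContMDiffOn (𝓘(ℝ, ℝ).prod (𝓡 n)) (𝓡 n).tangent (m : ℕ∞ω)
      (fun z : ℝ × M => (⟨z.2, u z.1 z.2⟩ : TangentBundle (𝓡 n) M)) (Icc 0 T ×ˢ univ))
    {t : ℝ} (ht : t ∈ Icc 0 T) {x q : M} (hq : q ∈ (extChartAt (𝓡 n) x).source)
    (a b : TangentSpace (𝓡 n) q) :
    vorticity u t q a b =
      vortForm u x (t, extChartAt (𝓡 n) x q) (toChart x q a) (toChart x q b) :=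
  (extD_eq_of_differentiableAt (α := fun y => flat y (u t y)) hq
    (differentiableAt_velForm hm hu ht ((extChartAt (𝓡 n) x).map_source hq))).2 a b

/-- The momentum equation, for one-forms in a chart. -/
theorem IsSolution.formInChart_convection (h : IsSolution m c p T V ρ u) (hc : 0 < c) (hT : 0 < T)
    {t : ℝ} (ht : t ∈ Icc 0 T) (hm : 2 ≤ m) {x : M} {y : Eucl n}
    (hy : y ∈ (extChartAt (𝓡 n) x).target) :
    formInChart (convection p u t) x y = -derivWithin (fun s => velForm u x (s, y)) (Icc 0 T) t
      - c ^ (-p) • (velForm u x (t, y) + formInChart (dFun (fun y => deriv V (ρ t y))) x y) := by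
  rw [derivWithin_velForm hT hm h.contMDiffOn_u ht hy]
  ext b
  simp only [formInChart, velForm, h.convection_eq hc ht hm, ContinuousLinearMap.comp_apply,
    add_apply, sub_apply, neg_apply, smul_apply]

/-- The convection term is the sum of a contraction of the vorticity and an exact form,
`|u|^{p-2} ∇_u u^* = ω(v, ·) + d(|u|^p / p)`. -/
theorem formInChart_convection_eq (hp : 2 ≤ p) (hm : 2 ≤ m)
    (hu : ContMDiffOn (𝓘(ℝ, ℝ).prod (𝓡 n)) (𝓡 n).tangent (m : ℕ∞ω)
      (fun z : ℝ × M => (⟨z.2, u z.1 z.2⟩ : TangentBundle (𝓡 n) M)) (Icc 0 T ×ˢ univ))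
    {t : ℝ} (ht : t ∈ Icc 0 T) {x : M} {y : Eucl n} (hy : y ∈ (extChartAt (𝓡 n) x).target) :
    HasFDerivAt (fun y => ‖u t ((extChartAt (𝓡 n) x).symm y)‖ ^ p / p)
      (formInChart (convection p u t) x y - vortForm u x (t, y) (transportVel p u x (t, y))) y := by
  set q := (extChartAt (𝓡 n) x).symm y with hq
  have hqs : q ∈ (extChartAt (𝓡 n) x).source := (extChartAt (𝓡 n) x).map_target hy
  have hxq : extChartAt (𝓡 n) x q = y := (extChartAt (𝓡 n) x).right_inv hy
  have hdq : DifferentiableAt ℝ (vecInChart (u t) q) (extChartAt (𝓡 n) q q) :=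
    differentiableAt_vecInChart hm hu ht (mem_extChartAt_target q)
  have hN : HasFDerivAt (fun y => ‖u t ((extChartAt (𝓡 n) x).symm y)‖ ^ 2)
      (formInChart (dFun fun q => ‖u t q‖ ^ 2) x y) y := by
    have h1 := (fderiv_normSq (differentiableAt_metricInChart hy)
      (differentiableAt_vecInChart hm hu ht hy) (metricInChart_symm x)).1
    have h2 := h1.congr_of_eventuallyEq (normSq_eventuallyEq (u t) hy)
    have h3 := hasMFDerivAt_of_chart (f := fun q => ‖u t q‖ ^ 2) hqs
      (by rw [hxq]; exact h2.hasFDerivAt)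
    have h4 := hasFDerivAt_chart_of_mdifferentiableAt hqs h3.mdifferentiableAt
    rwa [hxq] at h4
  have hpow : HasFDerivAt (fun y => (‖u t ((extChartAt (𝓡 n) x).symm y)‖ ^ 2) ^ (p / 2))
      ((p / 2 * (‖u t q‖ ^ 2) ^ (p / 2 - 1)) • formInChart (dFun fun q => ‖u t q‖ ^ 2) x y) y :=
    hN.rpow_const (Or.inr (by linarith))
  have hsq : ∀ r : ℝ, ∀ s : ℝ, 0 ≤ r → (r ^ 2) ^ s = r ^ (2 * s) := fun r s hr => by
    rw [← Real.rpow_natCast, ← Real.rpow_mul hr]; norm_num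
  have hfun : (fun y => ‖u t ((extChartAt (𝓡 n) x).symm y)‖ ^ p / p) = fun y =>
      p⁻¹ • (‖u t ((extChartAt (𝓡 n) x).symm y)‖ ^ 2) ^ (p / 2) := by
    funext y
    rw [hsq _ _ (norm_nonneg _), smul_eq_mul, mul_div_cancel₀ _ (by norm_num : (2 : ℝ) ≠ 0)]
    ring
  rw [hfun]
  refine (hpow.const_smul p⁻¹).congr_fderiv ?_
  ext b
  obtain ⟨a, rfl⟩ := exists_toChart_eq hqs b
  have hcov := covDerivForm_flat_self hdq a
  have hvort := vorticity_eq_vortForm hm hu ht hqs (‖u t q‖ ^ (p - 2) • u t q) a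
  rw [hxq] at hvort
  have hconv : formInChart (convection p u t) x y (toChart x q a) = convection p u t q a := by
    have := formInChart_toChart (convection p u t) hqs a
    rwa [hxq] at this
  have hdN : formInChart (dFun fun q => ‖u t q‖ ^ 2) x y (toChart x q a) =
      dFun (fun q => ‖u t q‖ ^ 2) q a := by
    have := formInChart_toChart (dFun fun q => ‖u t q‖ ^ 2) hqs a
    rwa [hxq] at this
  have htr : transportVel p u x (t, y) = toChart x q (‖u t q‖ ^ (p - 2) • u t q) := rfl
  have hlin : vorticity u t q (‖u t q‖ ^ (p - 2) • u t q) a =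
      ‖u t q‖ ^ (p - 2) * vorticity u t q (u t q) a := by
    simp only [vorticity, extD_eq_dForm, map_smul, smul_apply, smul_eq_mul]
  have hvq : vorticity u t q (u t q) a = extD (fun y => flat y (u t y)) q (u t q) a := rfl
  have hexp : (‖u t q‖ ^ 2) ^ (p / 2 - 1) = ‖u t q‖ ^ (p - 2) := by
    rw [hsq _ _ (norm_nonneg _)]; congr 1; ring
  rw [sub_apply, htr, ← hvort, hlin, hconv, convection, hvq]
  simp only [smul_apply, smul_eq_mul, hdN, hexp, hcov]
  field_simp
  ring

theorem contDiffOn_vortForm (hT : 0 < T) (hm : 2 ≤ m)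
    (hu : ContMDiffOn (𝓘(ℝ, ℝ).prod (𝓡 n)) (𝓡 n).tangent (m : ℕ∞ω)
      (fun z : ℝ × M => (⟨z.2, u z.1 z.2⟩ : TangentBundle (𝓡 n) M)) (Icc 0 T ×ˢ univ)) (x : M) :
    ContDiffOn ℝ 1 (vortForm u x) (Icc 0 T ×ˢ (extChartAt (𝓡 n) x).target) :=
  contDiffOn_dForm_slab hT (isOpen_extChartAt_target (I := 𝓡 n) x)
    ((contDiffOn_velForm hu x).of_le (two_le_coe hm)) (by norm_num)

/-- The vorticity equation `∂ₜω + d(|u|^{p-2} ∇_u u^*) = -c^{-p} ω`. -/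
theorem IsSolution.vorticity_equation (h : IsSolution m c p T V ρ u) (hc : 0 < c) (hT : 0 < T)
    (hm : 2 ≤ m) (hV : ContDiffOn ℝ 3 V (Ioi 0)) {t : ℝ} (ht : t ∈ Icc 0 T) (x : M) :
    FormDifferentiableAt (fun y => flat y (u t y)) x ∧ FormDifferentiableAt (convection p u t) x ∧
      ∀ a b : TangentSpace (𝓡 n) x, ∃ w : ℝ,
        HasDerivWithinAt (fun s => vorticity u s x a b) w (Icc 0 T) t ∧
        w + extD (convection p u t) x a b = - c ^ (-p) * vorticity u t x a b := by
  have hx : extChartAt (𝓡 n) x x ∈ (extChartAt (𝓡 n) x).target := mem_extChartAt_target x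
  obtain ⟨-, hδ, hδ0⟩ := formInChart_dFun (h.contMDiff_enthalpy hV ht) hx
  obtain ⟨h1, h2⟩ := hasDerivWithinAt_dForm_of_eq hT (isOpen_extChartAt_target (I := 𝓡 n) x)
    ((contDiffOn_velForm h.contMDiffOn_u x).of_le (two_le_coe hm)) ht hx hδ hδ0
    (fun y hy => h.formInChart_convection hc hT ht hm hy)
  refine ⟨differentiableAt_velForm hm h.contMDiffOn_u ht hx, h1, fun a b => ⟨_, h2 _ _, ?_⟩⟩
  rw [extD_eq_dForm, vorticity, extD_eq_dForm]
  simp only [velForm_eq]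
  ring

/-- The vorticity equation in transport form, in an arbitrary chart. -/
theorem IsSolution.fderiv_vortForm (h : IsSolution m c p T V ρ u) (hp : 2 ≤ p) (hc : 0 < c)
    (hT : 0 < T) (hm : 2 ≤ m) (hV : ContDiffOn ℝ 3 V (Ioi 0)) {t : ℝ} (ht : t ∈ Ioo 0 T) {x : M}
    {y : Eucl n} (hy : y ∈ (extChartAt (𝓡 n) x).target) (a b : Eucl n) :
    fderiv ℝ (vortForm u x) (t, y) (1, transportVel p u x (t, y)) a b =
      -c ^ (-p) * vortForm u x (t, y) a b
        - vortForm u x (t, y) (fderiv ℝ (fun y => transportVel p u x (t, y)) y a) b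
        - vortForm u x (t, y) a (fderiv ℝ (fun y => transportVel p u x (t, y)) y b) := by
  have hop := isOpen_extChartAt_target (I := 𝓡 n) x
  have ht' := Ioo_subset_Icc_self ht
  obtain ⟨-, hδ, hδ0⟩ := formInChart_dFun (h.contMDiff_enthalpy hV ht') hy
  have hv : DifferentiableAt ℝ (fun y => transportVel p u x (t, y)) y :=
    (hasFDerivAt_slab hop ht' hy (((contDiffOn_transportVel hT hp hm h.contMDiffOn_u
      x).differentiableOn (by norm_num)) (t, y) ⟨ht', hy⟩)).differentiableAt
  have h1 := hasDerivWithinAt_dForm_transport hT hop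
    ((contDiffOn_velForm h.contMDiffOn_u x).of_le (two_le_coe hm)) ht' hy hδ hδ0
    (fun y hy => h.formInChart_convection hc hT ht' hm hy) hv
    (fun y hy => formInChart_convection_eq hp hm h.contMDiffOn_u ht' hy)
    (fun y hy => (add_sub_cancel _ _).symm) a b
  have hnhds : Icc 0 T ×ˢ (extChartAt (𝓡 n) x).target ∈ 𝓝 (t, y) :=
    prod_mem_nhds (Icc_mem_nhds ht.1 ht.2) (hop.mem_nhds hy)
  have hw : DifferentiableAt ℝ (vortForm u x) (t, y) :=
    ((contDiffOn_vortForm hT hm h.contMDiffOn_u x).contDiffAt hnhds).differentiableAt (by norm_num)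
  have hs : (fun y => vortForm u x (t, y)) = dForm fun y => velForm u x (t, y) := rfl
  refine fderiv_one_right_of_hasDerivAt hw (h1.hasDerivAt (Icc_mem_nhds ht.1 ht.2)) ?_
  rw [hs]
  simp only [vortForm]
  ring

end VorticityEquation

/-! ### Bounds for the deformation of the metric -/

section Deformation

/-- The Lie derivative of the metric along `|U|^{2e} U` in terms of the covariant derivative of
`U`. -/
theorem lieMetric_rpow_smul {n : ℕ} {g : Eucl n → Eucl n →L[ℝ] Eucl n →L[ℝ] ℝ}
    {U v : Eucl n → Eucl n} {y : Eucl n} {e : ℝ} (he : 0 ≤ e) (hg : DifferentiableAt ℝ g y)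
    (hU : DifferentiableAt ℝ U y) (hsymm : ∀ y b c, g y b c = g y c b)
    (hpos : ∀ a, a ≠ 0 → 0 < g y a a)
    (hv : v =ᶠ[𝓝 y] fun y => (g y (U y) (U y)) ^ e • U y)
    {P : Eucl n → Eucl n → ℝ}
    (hP : ∀ a b, P a b = g y (fderiv ℝ U y a) b + koszul g y a (U y) b) (a : Eucl n) :
    DifferentiableAt ℝ v y ∧ lieMetric g v y a a = 2 * (g y (U y) (U y)) ^ e * P a a +
      4 * e * (g y (U y) (U y)) ^ (e - 1) * P a (U y) * g y (U y) a := by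
  obtain ⟨hN, hN'⟩ := fderiv_normSq hg hU hsymm
  have hd : HasFDerivAt (fun y => (g y (U y) (U y)) ^ e • U y)
      (powDeriv e univ (fun y => g y (U y) (U y)) U y) y := by
    rcases he.eq_or_lt with rfl | he
    · simpa [powDeriv, fderivWithin_univ] using hU.hasFDerivAt
    · rw [← hasFDerivWithinAt_univ]
      refine hasFDerivWithinAt_rpow_smul he hN.differentiableWithinAt hU.differentiableWithinAt ?_
      intro h
      by_contra hne
      exact (hpos _ hne).ne' h
  have hd' := hd.congr_of_eventuallyEq hv
  refine ⟨hd'.differentiableAt, ?_⟩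
  have hPU : fderiv ℝ (fun y => g y (U y) (U y)) y a = 2 * P a (U y) := by
    rw [hN', hP, koszul_self']; ring
  simp only [lieMetric, hd'.fderiv, hv.self_of_nhds, powDeriv, fderivWithin_univ, hP a a,
    koszul_self hg hsymm, add_apply, smul_apply, ContinuousLinearMap.smulRight_apply, map_add,
    map_smul, smul_eq_mul, hPU, hsymm y a]
  ring

/-- Compactness gives a bound of the Lie derivative of the metric by the metric. -/
theorem exists_lieMetric_bound {E : Type*} [NormedAddCommGroup E] [NormedSpace ℝ E]
    [FiniteDimensional ℝ E] {T : ℝ} {Ω : Set E} (hΩ : IsOpen Ω) (hT : 0 < T)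
    {g : E → E →L[ℝ] E →L[ℝ] ℝ} {v : ℝ × E → E} (hg : ContDiffOn ℝ ∞ g Ω)
    (hsymm : ∀ y b c, g y b c = g y c b) (hpos : ∀ y ∈ Ω, ∀ a, a ≠ 0 → 0 < g y a a)
    (hv : ContDiffOn ℝ 1 v (Icc 0 T ×ˢ Ω)) {S : Set E} (hS : IsCompact S) (hSΩ : S ⊆ Ω) :
    ∃ K : ℝ, ∀ t ∈ Icc 0 T, ∀ y ∈ S, ∀ a,
      |lieMetric g (fun y => v (t, y)) y a a| ≤ 2 * K * g y a a := by
  have : ProperSpace E := FiniteDimensional.proper ℝ E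
  have hSph : IsCompact (Metric.sphere (0 : E) 1) := isCompact_sphere _ _
  -- the positive lower bound of the metric on unit vectors
  have hgc : ContinuousOn (fun z : E × E => g z.1 z.2 z.2) (Ω ×ˢ univ) := by
    have h1 : ContDiffOn ℝ ∞ (fun z : E × E => g z.1) (Ω ×ˢ univ) :=
      hg.comp contDiff_fst.contDiffOn fun z hz => hz.1
    exact ((h1.clm_apply contDiff_snd.contDiffOn).clm_apply contDiff_snd.contDiffOn).continuousOn
  have hgC : ContDiffOn ℝ 1 (fun z : E × E => g z.1 z.2 z.2) (Ω ×ˢ univ) := by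
    have h1 : ContDiffOn ℝ 1 (fun z : E × E => g z.1) (Ω ×ˢ univ) :=
      (hg.of_le (by exact_mod_cast le_top)).comp contDiff_fst.contDiffOn fun z hz => hz.1
    exact (h1.clm_apply contDiff_snd.contDiffOn).clm_apply contDiff_snd.contDiffOn
  obtain ⟨r, hr, hlow⟩ := (hS.prod hSph).exists_forall_le'
    (hgc.mono (prod_mono hSΩ (subset_univ _))) (a := 0) (fun z hz => hpos z.1 (hSΩ hz.1) _
      (by rintro h; have := hz.2; rw [h] at this; simp at this))
  -- the upper bound of the Lie derivative on unit vectors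
  have hop2 : IsOpen (Ω ×ˢ (univ : Set E)) := hΩ.prod isOpen_univ
  have hF : ContinuousOn (fun z : (ℝ × E) × E =>
      fderiv ℝ (fun z : E × E => g z.1 z.2 z.2) (z.1.2, z.2) (v z.1, 0) +
        2 * g z.1.2 (fderiv ℝ (fun y => v (z.1.1, y)) z.1.2 z.2) z.2)
      ((Icc 0 T ×ˢ S) ×ˢ Metric.sphere (0 : E) 1) := by
    have c1 : ContinuousOn (fun z : (ℝ × E) × E =>
        fderiv ℝ (fun z : E × E => g z.1 z.2 z.2) (z.1.2, z.2))
        ((Icc 0 T ×ˢ S) ×ˢ Metric.sphere (0 : E) 1) :=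
      (hgC.continuousOn_fderiv_of_isOpen hop2 (by norm_num)).comp
        (by fun_prop) fun z hz => ⟨hSΩ hz.1.2, mem_univ _⟩
    have c2 : ContinuousOn (fun z : (ℝ × E) × E => v z.1)
        ((Icc 0 T ×ˢ S) ×ˢ Metric.sphere (0 : E) 1) :=
      hv.continuousOn.comp continuous_fst.continuousOn fun z hz => ⟨hz.1.1, hSΩ hz.1.2⟩
    have c3 : ContinuousOn (fun z : (ℝ × E) × E => fderiv ℝ (fun y => v (z.1.1, y)) z.1.2)
        ((Icc 0 T ×ˢ S) ×ˢ Metric.sphere (0 : E) 1) :=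
      (contDiffOn_fderiv_slab (k := 0) hT hΩ hv (by norm_num)).continuousOn.comp
        continuous_fst.continuousOn fun z hz => ⟨hz.1.1, hSΩ hz.1.2⟩
    have c4 : ContinuousOn (fun z : (ℝ × E) × E => g z.1.2)
        ((Icc 0 T ×ˢ S) ×ˢ Metric.sphere (0 : E) 1) :=
      hg.continuousOn.comp (f := fun z : (ℝ × E) × E => z.1.2) (by fun_prop)
        fun z hz => hSΩ hz.1.2
    exact (c1.clm_apply (c2.prodMk continuousOn_const)).add (continuousOn_const.mul
      ((c4.clm_apply (c3.clm_apply continuous_snd.continuousOn)).clm_apply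
        continuous_snd.continuousOn))
  obtain ⟨K, hK⟩ := ((isCompact_Icc.prod hS).prod hSph).exists_bound_of_continuousOn hF
  refine ⟨K / r / 2, fun t ht y hy a => ?_⟩
  by_cases ha : a = 0
  · subst ha; simp [lieMetric]
  have hn : 0 < ‖a‖ := norm_pos_iff.2 ha
  set b := ‖a‖⁻¹ • a with hb
  have hbs : b ∈ Metric.sphere (0 : E) 1 := by simp [hb, norm_smul, hn.ne']
  have hab : a = ‖a‖ • b := by rw [hb, smul_smul, mul_inv_cancel₀ hn.ne', one_smul]
  have hgd : DifferentiableAt ℝ g y :=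
    (hg.contDiffAt (hΩ.mem_nhds (hSΩ hy))).differentiableAt (by simp)
  have e1 : fderiv ℝ (fun z : E × E => g z.1 z.2 z.2) (y, b) (v (t, y), 0) =
      fderiv ℝ g y (v (t, y)) b b := by
    have h1 : HasFDerivAt (fun z : E × E => g z.1 z.2 z.2) _ (y, b) :=
      ((hgC.contDiffAt (hop2.mem_nhds ⟨hSΩ hy, mem_univ _⟩)).differentiableAt
        (by norm_num)).hasFDerivAt
    have h2 : HasFDerivAt (fun y => g y b b)
      ((fderiv ℝ (fun z : E × E => g z.1 z.2 z.2) (y, b)).comp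
        (ContinuousLinearMap.inl ℝ E E)) y :=
      HasFDerivAt.comp (f := fun y => (y, b)) y h1 (hasFDerivAt_prodMk_left y b)
    have h3 := h2.unique (fderiv_bilin_apply hgd b b)
    exact DFunLike.congr_fun h3 (v (t, y))
  have h1 := hK ((t, y), b) ⟨⟨ht, hy⟩, hbs⟩
  have h2 := hlow (y, b) ⟨hy, hbs⟩
  simp only [e1, Real.norm_eq_abs] at h1 h2
  have e2 : lieMetric g (fun y => v (t, y)) y a a = ‖a‖ ^ 2 * (fderiv ℝ g y (v (t, y)) b b +
      2 * g y (fderiv ℝ (fun y => v (t, y)) y b) b) := by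
    conv_lhs => rw [hab]
    simp only [lieMetric, map_smul, smul_apply, smul_eq_mul, hsymm y b]
    ring
  have e3 : g y a a = ‖a‖ ^ 2 * g y b b := by
    conv_lhs => rw [hab]
    simp only [map_smul, smul_apply, smul_eq_mul]
    ring
  have hK0 : 0 ≤ K := (abs_nonneg _).trans h1
  have h3 : K ≤ K / r * g y b b := by
    rw [div_mul_eq_mul_div, le_div_iff₀ hr]
    exact mul_le_mul_of_nonneg_left h2 hK0
  rw [e2, e3, abs_mul, abs_of_nonneg (sq_nonneg ‖a‖)]
  calc ‖a‖ ^ 2 * _ ≤ ‖a‖ ^ 2 * (K / r * g y b b) :=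
        mul_le_mul_of_nonneg_left (h1.trans h3) (sq_nonneg _)
    _ = _ := by ring

/-- The bound `|(L_v g)(a, a)| ≤ 2 (p - 1) C^{p-1} |a|²`, in terms of the numbers `N = |u|`,
`A = |a|`, `i = ⟨∇ₐu, a⟩`, `j = ⟨∇ₐu, u⟩` and `k = ⟨u, a⟩`. -/
theorem lieMetric_bound_aux {p C N A i j k : ℝ} (hp : 2 ≤ p) (hC : 0 ≤ C) (hN : 0 ≤ N)
    (hNC : N ≤ C) (hA : 0 ≤ A) (hi : |i| ≤ C * A * A) (hj : |j| ≤ C * A * N) (hk : |k| ≤ N * A) :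
    |2 * (N ^ 2) ^ ((p - 2) / 2) * i + 4 * ((p - 2) / 2) * (N ^ 2) ^ ((p - 2) / 2 - 1) * j * k| ≤
      2 * ((p - 1) * C ^ (p - 1)) * A ^ 2 := by
  have hsq : ∀ s : ℝ, (N ^ 2) ^ s = N ^ (2 * s) := fun s => by
    rw [← Real.rpow_natCast, ← Real.rpow_mul hN]; norm_num
  have hpow : N ^ (p - 2) * C ≤ C ^ (p - 1) := by
    calc N ^ (p - 2) * C ≤ C ^ (p - 2) * C := by
          gcongr
      _ = C ^ (p - 2) * C ^ (1 : ℝ) := by rw [Real.rpow_one]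
      _ = C ^ (p - 1) := by
        rw [← Real.rpow_add_of_nonneg hC (by linarith) (by norm_num)]; congr 1; ring
  have h1 : |2 * (N ^ 2) ^ ((p - 2) / 2) * i| ≤ 2 * C ^ (p - 1) * A ^ 2 := by
    rw [hsq, mul_div_cancel₀ _ (by norm_num : (2 : ℝ) ≠ 0), abs_mul,
      abs_of_nonneg (mul_nonneg zero_le_two (Real.rpow_nonneg hN _))]
    calc 2 * N ^ (p - 2) * |i| ≤ 2 * N ^ (p - 2) * (C * A * A) := by gcongr
      _ = 2 * (N ^ (p - 2) * C) * A ^ 2 := by ring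
      _ ≤ _ := by gcongr
  have h2 : |4 * ((p - 2) / 2) * (N ^ 2) ^ ((p - 2) / 2 - 1) * j * k| ≤
      2 * (p - 2) * C ^ (p - 1) * A ^ 2 := by
    -- for `p < 4` the exponent is negative, and the zeros of `u` have to be treated apart
    rcases hN.eq_or_lt with h0 | h0
    · have : k = 0 := by
        rw [← h0, zero_mul] at hk; exact abs_nonpos_iff.1 hk
      rw [this, mul_zero, abs_zero]
      have := Real.rpow_nonneg hC (p - 1)
      have : 0 ≤ p - 2 := by linarith
      positivity
    · have hp2 : 0 ≤ p - 2 := by linarith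
      have e1 : (N ^ 2) ^ ((p - 2) / 2 - 1) * (N * N) = N ^ (p - 2) := by
        rw [← sq, ← Real.rpow_add_one (by positivity), sub_add_cancel, hsq,
          mul_div_cancel₀ _ (by norm_num : (2 : ℝ) ≠ 0)]
      rw [abs_mul, abs_mul, abs_of_nonneg (by positivity)]
      calc 4 * ((p - 2) / 2) * (N ^ 2) ^ ((p - 2) / 2 - 1) * |j| * |k|
          ≤ 4 * ((p - 2) / 2) * (N ^ 2) ^ ((p - 2) / 2 - 1) * (C * A * N) * (N * A) := by gcongr
        _ = 2 * (p - 2) * ((N ^ 2) ^ ((p - 2) / 2 - 1) * (N * N) * C) * A ^ 2 := by ring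
        _ ≤ _ := by
          rw [e1]; gcongr
  calc _ ≤ _ := abs_add_le _ _
    _ ≤ _ := add_le_add h1 h2
    _ = _ := by ring

end Deformation

section DeformationBound

open scoped Bundle

variable {n : ℕ} {M : Type*} [TopologicalSpace M] [ChartedSpace (Eucl n) M]
  [IsManifold (𝓡 n) ∞ M] {m : ℕ∞} {p T : ℝ} {u : ℝ → (x : M) → TangentSpace (𝓡 n) x}
  [Bundle.RiemannianBundle (fun x : M => TangentSpace (𝓡 n) x)]

/-- At the point `q`, the metric changes along the transporting field `|u|^{p-2} u` at a rate of
at most `2K`. The condition is expressed in the preferred chart around `q`. -/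
def LieBoundAt (p K : ℝ) (u : ℝ → (x : M) → TangentSpace (𝓡 n) x) (t : ℝ) (q : M) : Prop :=
  ∀ a : TangentSpace (𝓡 n) q, |lieMetric (metricInChart q) (fun y => transportVel p u q (t, y))
    (extChartAt (𝓡 n) q q) (toChart q q a) (toChart q q a)| ≤ 2 * K * ‖a‖ ^ 2

variable [SmoothMetric n M]

theorem differentiableAt_transportVel (hT : 0 < T) (hp : 2 ≤ p) (hm : 2 ≤ m)
    (hu : ContMDiffOn (𝓘(ℝ, ℝ).prod (𝓡 n)) (𝓡 n).tangent (m : ℕ∞ω)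
      (fun z : ℝ × M => (⟨z.2, u z.1 z.2⟩ : TangentBundle (𝓡 n) M)) (Icc 0 T ×ˢ univ))
    {t : ℝ} (ht : t ∈ Icc 0 T) {x : M} {y : Eucl n} (hy : y ∈ (extChartAt (𝓡 n) x).target) :
    DifferentiableAt ℝ (fun y => transportVel p u x (t, y)) y :=
  (hasFDerivAt_slab (isOpen_extChartAt_target (I := 𝓡 n) x) ht hy
    ((contDiffOn_transportVel hT hp hm hu x).differentiableOn (by norm_num)
      (t, y) ⟨ht, hy⟩)).differentiableAt

/-- The bound of the deformation of the metric may be checked in any chart. -/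
theorem lieBoundAt_iff (hT : 0 < T) (hp : 2 ≤ p) (hm : 2 ≤ m)
    (hu : ContMDiffOn (𝓘(ℝ, ℝ).prod (𝓡 n)) (𝓡 n).tangent (m : ℕ∞ω)
      (fun z : ℝ × M => (⟨z.2, u z.1 z.2⟩ : TangentBundle (𝓡 n) M)) (Icc 0 T ×ˢ univ))
    {t : ℝ} (ht : t ∈ Icc 0 T) {x q : M} (hq : q ∈ (extChartAt (𝓡 n) x).source) {K : ℝ} :
    LieBoundAt p K u t q ↔ ∀ a : Eucl n,
      |lieMetric (metricInChart x) (fun y => transportVel p u x (t, y))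
        (extChartAt (𝓡 n) x q) a a| ≤ 2 * K * metricInChart x (extChartAt (𝓡 n) x q) a a := by
  have key : ∀ a : TangentSpace (𝓡 n) q,
      lieMetric (metricInChart q) (fun y => transportVel p u q (t, y))
        (extChartAt (𝓡 n) q q) (toChart q q a) (toChart q q a) =
      lieMetric (metricInChart x) (fun y => transportVel p u x (t, y))
        (extChartAt (𝓡 n) x q) (toChart x q a) (toChart x q a) := fun a =>
    lieMetric_chart (Y := fun q => ‖u t q‖ ^ (p - 2) • u t q) (mem_extChartAt_source q) hq
      (differentiableAt_transportVel hT hp hm hu ht (mem_extChartAt_target q))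
      (differentiableAt_transportVel hT hp hm hu ht ((extChartAt (𝓡 n) x).map_source hq)) a a
  constructor
  · intro h b
    obtain ⟨a, rfl⟩ := exists_toChart_eq hq b
    rw [metricInChart_toChart hq, real_inner_self_eq_norm_sq, ← key]
    exact h a
  · intro h a
    have := h (toChart x q a)
    rwa [metricInChart_toChart hq, real_inner_self_eq_norm_sq, ← key] at this

/-- Bounds for `u` and `∇u` give a bound for the deformation of the metric. -/
theorem BoundedBy.lieBoundAt {C : ℝ} (h : BoundedBy T C u) (hp : 2 ≤ p) (hm : 2 ≤ m)
    (hu : ContMDiffOn (𝓘(ℝ, ℝ).prod (𝓡 n)) (𝓡 n).tangent (m : ℕ∞ω)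
      (fun z : ℝ × M => (⟨z.2, u z.1 z.2⟩ : TangentBundle (𝓡 n) M)) (Icc 0 T ×ˢ univ))
    {t : ℝ} (ht : t ∈ Icc 0 T) (q : M) : LieBoundAt p ((p - 1) * C ^ (p - 1)) u t q := by
  intro a
  have hqs := mem_extChartAt_source (I := 𝓡 n) q
  have hqt := mem_extChartAt_target (I := 𝓡 n) q
  obtain ⟨hC1, hC2⟩ := h t ht q
  have hC : 0 ≤ C := (norm_nonneg _).trans hC1
  have hv : (fun y => transportVel p u q (t, y)) =ᶠ[𝓝 (extChartAt (𝓡 n) q q)] fun y =>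
      (metricInChart q y (vecInChart (u t) q y) (vecInChart (u t) q y)) ^ ((p - 2) / 2) •
        vecInChart (u t) q y := by
    filter_upwards [(isOpen_extChartAt_target (I := 𝓡 n) q).mem_nhds hqt] with y hy
      using vecInChart_transport t hy p
  have hP : ∀ a b : TangentSpace (𝓡 n) q, inner ℝ (covDeriv (u t) q a) b =
      metricInChart q (extChartAt (𝓡 n) q q)
        (fderiv ℝ (vecInChart (u t) q) (extChartAt (𝓡 n) q q) (toChart q q a)) (toChart q q b) +
      koszul (metricInChart q) (extChartAt (𝓡 n) q q) (toChart q q a)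
        (vecInChart (u t) q (extChartAt (𝓡 n) q q)) (toChart q q b) := fun a b => by
    rw [inner_covDeriv, vecInChart_extChartAt _ hqs]
  have key := (lieMetric_rpow_smul (by linarith : 0 ≤ (p - 2) / 2)
    (differentiableAt_metricInChart hqt) (differentiableAt_vecInChart hm hu ht hqt)
    (metricInChart_symm q) (fun a ha => metricInChart_pos hqt ha) hv (fun _ _ => rfl)
    (toChart q q a)).2
  rw [← hP] at key
  rw [vecInChart_extChartAt _ hqs] at key hP
  rw [← hP, metricInChart_toChart hqs, metricInChart_toChart hqs,
    real_inner_self_eq_norm_sq] at key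
  rw [key]
  have i1 : |inner ℝ (covDeriv (u t) q a) a| ≤ C * ‖a‖ * ‖a‖ :=
    (abs_real_inner_le_norm _ _).trans (mul_le_mul_of_nonneg_right (hC2 a) (norm_nonneg _))
  have i2 : |inner ℝ (covDeriv (u t) q a) (u t q)| ≤ C * ‖a‖ * ‖u t q‖ :=
    (abs_real_inner_le_norm _ _).trans (mul_le_mul_of_nonneg_right (hC2 a) (norm_nonneg _))
  exact lieMetric_bound_aux hp hC (norm_nonneg _) hC1 (norm_nonneg _) i1 i2
    (abs_real_inner_le_norm _ _)

/-- On a compact manifold the deformation of the metric is bounded. -/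
theorem exists_lieBoundAt [CompactSpace M] (hT : 0 < T) (hp : 2 ≤ p) (hm : 2 ≤ m)
    (hu : ContMDiffOn (𝓘(ℝ, ℝ).prod (𝓡 n)) (𝓡 n).tangent (m : ℕ∞ω)
      (fun z : ℝ × M => (⟨z.2, u z.1 z.2⟩ : TangentBundle (𝓡 n) M)) (Icc 0 T ×ˢ univ)) :
    ∃ K : ℝ, ∀ t ∈ Icc 0 T, ∀ q : M, LieBoundAt p K u t q := by
  have : ∃ K : ℝ, ∀ q ∈ (univ : Set M), ∀ t ∈ Icc 0 T, LieBoundAt p K u t q := by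
    refine isCompact_univ.induction_on (p := fun S => ∃ K : ℝ, ∀ q ∈ S, ∀ t ∈ Icc 0 T,
      LieBoundAt p K u t q) ⟨0, by simp⟩ (fun S S' hSS' ⟨K, hK⟩ => ⟨K, fun q hq => hK q (hSS' hq)⟩)
      ?_ ?_
    · rintro S S' ⟨K, hK⟩ ⟨K', hK'⟩
      have mono : ∀ {K K' : ℝ} {t q}, K ≤ K' → LieBoundAt p K u t q → LieBoundAt p K' u t q :=
        fun hKK' h a => (h a).trans (by gcongr)
      refine ⟨max K K', fun q hq t ht => ?_⟩
      rcases hq with hq | hq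
      · exact mono (le_max_left _ _) (hK q hq t ht)
      · exact mono (le_max_right _ _) (hK' q hq t ht)
    · intro x _
      have hop := isOpen_extChartAt_target (I := 𝓡 n) x
      obtain ⟨r, hr, hball⟩ := Metric.isOpen_iff.1 hop _ (mem_extChartAt_target (I := 𝓡 n) x)
      have hcb : Metric.closedBall (extChartAt (𝓡 n) x x) (r / 2) ⊆ (extChartAt (𝓡 n) x).target :=
        (Metric.closedBall_subset_ball (half_lt_self hr)).trans hball
      obtain ⟨K, hK⟩ := exists_lieMetric_bound hop hT (contDiffOn_metricInChart x)
        (metricInChart_symm x) (fun y hy a ha => metricInChart_pos hy ha)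
        (contDiffOn_transportVel hT hp hm hu x) (isCompact_closedBall _ _) hcb
      refine ⟨(extChartAt (𝓡 n) x).source ∩
        extChartAt (𝓡 n) x ⁻¹' Metric.closedBall (extChartAt (𝓡 n) x x) (r / 2), ?_, K, ?_⟩
      · rw [nhdsWithin_univ]
        exact inter_mem (extChartAt_source_mem_nhds x)
          ((continuousAt_extChartAt x).preimage_mem_nhds
          (Metric.closedBall_mem_nhds _ (half_pos hr)))
      · rintro q ⟨hq, hq'⟩ t ht
        rw [lieBoundAt_iff hT hp hm hu ht hq]
        exact fun a => hK t ht _ hq' a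
  obtain ⟨K, hK⟩ := this
  exact ⟨K, fun t ht q => hK q (mem_univ q) t ht⟩

end DeformationBound

/-! ### The Riemannian volume in a chart -/

theorem setLIntegral_eq_of_subset {α : Type*} [MeasurableSpace α] {μ : Measure α} {s t : Set α}
    {f : α → ℝ≥0∞} (hs : MeasurableSet s) (ht : MeasurableSet t) (hst : s ⊆ t)
    (hf : ∀ y ∈ t \ s, f y = 0) : ∫⁻ y in t, f y ∂μ = ∫⁻ y in s, f y ∂μ := by
  rw [← lintegral_indicator ht, ← lintegral_indicator hs]
  refine lintegral_congr fun y => ?_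
  by_cases h : y ∈ s
  · rw [indicator_of_mem h, indicator_of_mem (hst h)]
  · rw [indicator_of_notMem h]
    by_cases h' : y ∈ t
    · rw [indicator_of_mem h', hf y ⟨h', h⟩]
    · rw [indicator_of_notMem h']

section Volume

open scoped Bundle

variable {n : ℕ} {M : Type*} [TopologicalSpace M] [ChartedSpace (Eucl n) M]

theorem image_transition_overlap (x x' : M) :
    transition (n := n) x x' '' overlap x x' = overlap x' x := by
  ext z
  constructor
  · rintro ⟨y, hy, rfl⟩
    obtain ⟨q, hq, hq', rfl⟩ := exists_of_mem_overlap hy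
    rw [transition_extChartAt hq]
    exact extChartAt_mem_overlap hq' hq
  · intro hz
    obtain ⟨q, hq', hq, rfl⟩ := exists_of_mem_overlap hz
    exact ⟨_, extChartAt_mem_overlap hq hq', transition_extChartAt hq⟩

theorem injOn_transition (x x' : M) : InjOn (transition (n := n) x x') (overlap x x') := by
  intro y hy z hz h
  obtain ⟨q, hq, hq', rfl⟩ := exists_of_mem_overlap hy
  obtain ⟨q₂, hq₂, hq₂', rfl⟩ := exists_of_mem_overlap hz
  rw [transition_extChartAt hq, transition_extChartAt hq₂] at h
  rw [(extChartAt (𝓡 n) x').injOn hq' hq₂' h]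

theorem symm_transition {x x' : M} {y : Eucl n} (hy : y ∈ overlap x x') :
    (extChartAt (𝓡 n) x').symm (transition x x' y) = (extChartAt (𝓡 n) x).symm y := by
  obtain ⟨q, hq, hq', rfl⟩ := exists_of_mem_overlap hy
  rw [transition_extChartAt hq, (extChartAt (𝓡 n) x').left_inv hq',
    (extChartAt (𝓡 n) x).left_inv hq]

variable [IsManifold (𝓡 n) ∞ M]

variable [Bundle.RiemannianBundle (fun x : M => TangentSpace (𝓡 n) x)]

theorem aemeasurable_volDensity [SmoothMetric n M] (x : M) :
    AEMeasurable (volDensity (n := n) x) (volume.restrict (extChartAt (𝓡 n) x).target) :=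
  (contDiffOn_volDensity x).continuousOn.aemeasurable
    (isOpen_extChartAt_target (I := 𝓡 n) x).measurableSet

/-- The change of variables from the chart around `i` to the chart around `x`. -/
theorem lintegral_chart_change (x i : M) {F : M → ℝ≥0∞} {f : M → ℝ}
    (hF : ∀ q ∉ (extChartAt (𝓡 n) x).source, F q = 0)
    (hf : ∀ q ∉ (extChartAt (𝓡 n) i).source, f q = 0) (hf0 : ∀ q, 0 ≤ f q) :
    ∫⁻ y in (extChartAt (𝓡 n) i).target, ENNReal.ofReal
        (f ((extChartAt (𝓡 n) i).symm y) * volDensity i y) * F ((extChartAt (𝓡 n) i).symm y) =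
      ∫⁻ y in (extChartAt (𝓡 n) x).target, ENNReal.ofReal (f ((extChartAt (𝓡 n) x).symm y)) *
        (ENNReal.ofReal (volDensity x y) * F ((extChartAt (𝓡 n) x).symm y)) := by
  have hsub : ∀ x i : M, overlap (n := n) x i ⊆ (extChartAt (𝓡 n) x).target := fun x i y hy => hy.1
  rw [setLIntegral_eq_of_subset (isOpen_overlap i x).measurableSet
      (isOpen_extChartAt_target (I := 𝓡 n) i).measurableSet (hsub i x),
    setLIntegral_eq_of_subset (isOpen_overlap x i).measurableSet
      (isOpen_extChartAt_target (I := 𝓡 n) x).measurableSet (hsub x i),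
    ← image_transition_overlap x i,
    lintegral_image_eq_lintegral_abs_det_fderiv_mul volume (isOpen_overlap x i).measurableSet
      (fun y hy => ((transition_contDiffAt hy).differentiableAt
        (by norm_num)).hasFDerivAt.hasFDerivWithinAt) (injOn_transition x i)]
  · refine setLIntegral_congr_fun (isOpen_overlap x i).measurableSet fun y hy => ?_
    rw [symm_transition hy, volDensity_transition hy, ← mul_assoc, ← mul_assoc,
      ← ENNReal.ofReal_mul (abs_nonneg _), ← ENNReal.ofReal_mul (hf0 _)]
    congr 2
    ring
  · intro y hy
    rw [hf _ fun h => hy.2 ⟨hy.1, h⟩]; simp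
  · intro y hy
    rw [hF _ fun h => hy.2 ⟨hy.1, h⟩]; simp

variable [MeasurableSpace M] [BorelSpace M]

theorem aemeasurable_extChartAt_symm (x : M) : AEMeasurable (extChartAt (𝓡 n) x).symm
    (volume.restrict (extChartAt (𝓡 n) x).target) :=
  (continuousOn_extChartAt_symm x).aemeasurable
    (isOpen_extChartAt_target (I := 𝓡 n) x).measurableSet

variable [T2Space M] [SigmaCompactSpace M] [SmoothMetric n M]

/-- The Riemannian volume measure in a chart. -/
theorem lintegral_riemVolume (x : M) {F : M → ℝ≥0∞} (hFm : Measurable F)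
    (hF : ∀ q ∉ (extChartAt (𝓡 n) x).source, F q = 0) :
    ∫⁻ q, F q ∂(riemVolume n M) = ∫⁻ y in (extChartAt (𝓡 n) x).target,
      ENNReal.ofReal (volDensity x y) * F ((extChartAt (𝓡 n) x).symm y) := by
  set f := (SmoothPartitionOfUnity.exists_isSubordinate_chartAt_source (𝓡 n) M).choose with hfdef
  have hsub : f.IsSubordinate fun x => (chartAt (Eucl n) x).source :=
    (SmoothPartitionOfUnity.exists_isSubordinate_chartAt_source (𝓡 n) M).choose_spec
  have hfs : ∀ i, ∀ q ∉ (extChartAt (𝓡 n) i).source, f i q = 0 := fun i q hq => by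
    by_contra h
    exact hq (by rw [extChartAt_source]; exact hsub i (subset_tsupport _ h))
  have h1 : ∀ i, ∫⁻ q, F q ∂(((volume.restrict (extChartAt (𝓡 n) i).target).withDensity fun y =>
      ENNReal.ofReal (f i ((extChartAt (𝓡 n) i).symm y) * volDensity i y)).map
        (extChartAt (𝓡 n) i).symm) =
      ∫⁻ y in (extChartAt (𝓡 n) x).target, ENNReal.ofReal (f i ((extChartAt (𝓡 n) x).symm y)) *
        (ENNReal.ofReal (volDensity x y) * F ((extChartAt (𝓡 n) x).symm y)) := by
    intro i
    have hm := aemeasurable_extChartAt_symm (n := n) i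
    have hd : AEMeasurable (fun y => ENNReal.ofReal
        (f i ((extChartAt (𝓡 n) i).symm y) * volDensity i y))
        (volume.restrict (extChartAt (𝓡 n) i).target) :=
      (((f i).contMDiff.continuous.measurable.comp_aemeasurable hm).mul
        (aemeasurable_volDensity i)).ennreal_ofReal
    rw [lintegral_map' hFm.aemeasurable (hm.mono_ac (withDensity_absolutelyContinuous _ _)),
      lintegral_withDensity_eq_lintegral_mul₀ hd
        (g := fun y => F ((extChartAt (𝓡 n) i).symm y)) (hFm.comp_aemeasurable hm),
      ← lintegral_chart_change x i hF (hfs i) (fun q => f.nonneg i q)]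
    rfl
  rw [riemVolume, lintegral_sum_measure]
  simp only [← hfdef, h1]
  -- only countably many functions of the partition of unity do not vanish identically
  set S : Set M := {i | (Function.support (f i)).Nonempty} with hS
  have hcount : Countable S := by
    have hlf : LocallyFinite fun i : S =>
      Function.support (f i.1) := f.locallyFinite.comp_injective Subtype.val_injective
    exact countable_univ_iff.1 (hlf.countable_univ fun i => i.2)
  have hz : ∀ i, ¬ (Function.support (f i)).Nonempty → ∀ q, f i q = 0 := fun i hi q => by
    by_contra h
    exact hi ⟨q, h⟩
  have hone : ∀ q, ∑' i : S,
      ENNReal.ofReal (f i.1 q) = 1 := by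
    intro q
    have hfin : (Function.support fun i => f i q).Finite := f.locallyFinite.point_finite q
    rw [tsum_subtype_eq_of_support_subset (f := fun i => ENNReal.ofReal (f i q))
      (s := S) (by
        intro i hi
        by_contra h
        exact hi (by simp [hz i h q])),
      ← ENNReal.ofReal_tsum_of_nonneg (fun i => f.nonneg i q)
        (summable_of_hasFiniteSupport hfin), tsum_eq_finsum hfin, f.sum_eq_one (mem_univ q),
      ENNReal.ofReal_one]
  rw [← tsum_subtype_eq_of_support_subset
    (s := S) (by
      intro i hi
      by_contra h
      exact hi (by simp [hz i h])), ← lintegral_tsum]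
  · refine lintegral_congr fun y => ?_
    rw [ENNReal.tsum_mul_right, hone, one_mul]
  · intro i
    have hm := aemeasurable_extChartAt_symm (n := n) x
    exact ((f i.1).contMDiff.continuous.measurable.comp_aemeasurable hm).ennreal_ofReal.mul
      ((aemeasurable_volDensity x).ennreal_ofReal.mul (hFm.comp_aemeasurable hm))

/-- Bochner integrals with respect to the Riemannian volume, in a chart. -/
theorem integral_riemVolume (x : M) {F : M → ℝ} (hFm : Measurable F)
    (hF : ∀ q ∉ (extChartAt (𝓡 n) x).source, F q = 0) :
    ∫ q, F q ∂(riemVolume n M) = ∫ y in (extChartAt (𝓡 n) x).target,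
      volDensity x y * F ((extChartAt (𝓡 n) x).symm y) := by
  have hsm : MeasurableSet (extChartAt (𝓡 n) x).source :=
    (isOpen_extChartAt_source (I := 𝓡 n) x).measurableSet
  have hm := aemeasurable_extChartAt_symm (n := n) x
  -- on the chart domain the volume is the push-forward of `J dy`
  have hν : (riemVolume n M).restrict (extChartAt (𝓡 n) x).source =
      ((volume.restrict (extChartAt (𝓡 n) x).target).withDensity fun y =>
        ENNReal.ofReal (volDensity x y)).map (extChartAt (𝓡 n) x).symm := by
    refine Measure.ext_of_lintegral _ fun F hF => ?_
    rw [← lintegral_indicator hsm, lintegral_riemVolume x (hF.indicator hsm)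
      (fun q hq => indicator_of_notMem hq _),
      lintegral_map' hF.aemeasurable (hm.mono_ac (withDensity_absolutelyContinuous _ _)),
      lintegral_withDensity_eq_lintegral_mul₀ (aemeasurable_volDensity x).ennreal_ofReal
        (g := fun y => F ((extChartAt (𝓡 n) x).symm y)) (hF.comp_aemeasurable hm)]
    refine setLIntegral_congr_fun (isOpen_extChartAt_target (I := 𝓡 n) x).measurableSet
      fun y hy => ?_
    simp only [Pi.mul_apply]
    rw [indicator_of_mem ((extChartAt (𝓡 n) x).map_target hy)]
  rw [← setIntegral_eq_integral_of_forall_compl_eq_zero hF, hν,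
    integral_map (hm.mono_ac (withDensity_absolutelyContinuous _ _))
      hFm.stronglyMeasurable.aestronglyMeasurable,
    integral_withDensity_eq_integral_toReal_smul₀ (aemeasurable_volDensity x).ennreal_ofReal
      (by simp)]
  refine setIntegral_congr_fun (isOpen_extChartAt_target (I := 𝓡 n) x).measurableSet
    fun y hy => ?_
  simp [ENNReal.toReal_ofReal (volDensity_pos hy).le]

instance : IsLocallyFiniteMeasure (riemVolume n M) where
  finiteAtNhds x := by
    have hop := isOpen_extChartAt_target (I := 𝓡 n) x
    obtain ⟨r, hr, hball⟩ := Metric.isOpen_iff.1 hop _ (mem_extChartAt_target (I := 𝓡 n) x)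
    have hcb : Metric.closedBall (extChartAt (𝓡 n) x x) (r / 2) ⊆ (extChartAt (𝓡 n) x).target :=
      (Metric.closedBall_subset_ball (half_lt_self hr)).trans hball
    set W := (extChartAt (𝓡 n) x).source ∩
      extChartAt (𝓡 n) x ⁻¹' Metric.ball (extChartAt (𝓡 n) x x) (r / 2) with hW
    have hWo : IsOpen W := (continuousOn_extChartAt x).isOpen_inter_preimage
      (isOpen_extChartAt_source x) Metric.isOpen_ball
    refine ⟨W, hWo.mem_nhds ⟨mem_extChartAt_source x, Metric.mem_ball_self (half_pos hr)⟩, ?_⟩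
    obtain ⟨B, hB⟩ := (isCompact_closedBall (extChartAt (𝓡 n) x x) (r / 2)).exists_bound_of_continuousOn
      ((contDiffOn_volDensity x).continuousOn.mono hcb)
    rw [← lintegral_indicator_one hWo.measurableSet,
      lintegral_riemVolume x (measurable_one.indicator hWo.measurableSet)
      (fun q hq => indicator_of_notMem (fun h => hq h.1) _)]
    calc _ ≤ ∫⁻ y in (extChartAt (𝓡 n) x).target,
          (Metric.closedBall (extChartAt (𝓡 n) x x) (r / 2)).indicator
            (fun _ => ENNReal.ofReal B) y := by
          refine setLIntegral_mono' hop.measurableSet fun y hy => ?_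
          by_cases h : (extChartAt (𝓡 n) x).symm y ∈ W
          · have hyb : y ∈ Metric.closedBall (extChartAt (𝓡 n) x x) (r / 2) := by
              have := h.2
              rw [mem_preimage, (extChartAt (𝓡 n) x).right_inv hy] at this
              exact Metric.ball_subset_closedBall this
            rw [indicator_of_mem h, indicator_of_mem hyb, Pi.one_apply, mul_one]
            exact ENNReal.ofReal_le_ofReal ((le_abs_self _).trans (hB y hyb))
          · rw [indicator_of_notMem h, mul_zero]; exact zero_le
      _ ≤ ∫⁻ y, (Metric.closedBall (extChartAt (𝓡 n) x x) (r / 2)).indicator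
            (fun _ => ENNReal.ofReal B) y := setLIntegral_le_lintegral _ _
      _ < ⊤ := by
          rw [lintegral_indicator_const Metric.isClosed_closedBall.measurableSet]
          exact ENNReal.mul_lt_top ENNReal.ofReal_lt_top
            (isCompact_closedBall _ _).measure_lt_top

instance : (riemVolume n M).IsOpenPosMeasure where
  open_pos W hW hne h0 := by
    obtain ⟨x, hx⟩ := hne
    have hop := isOpen_extChartAt_target (I := 𝓡 n) x
    set W' := (extChartAt (𝓡 n) x).source ∩ W with hW'
    have hWo : IsOpen W' := (isOpen_extChartAt_source x).inter hW
    have h1 : riemVolume n M W' = 0 := measure_mono_null inter_subset_right h0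
    have hm := aemeasurable_extChartAt_symm (n := n) x
    have hmeas : AEMeasurable (fun y => ENNReal.ofReal (volDensity x y) *
        W'.indicator 1 ((extChartAt (𝓡 n) x).symm y))
        (volume.restrict (extChartAt (𝓡 n) x).target) :=
      (aemeasurable_volDensity x).ennreal_ofReal.mul
        ((measurable_one.indicator hWo.measurableSet).comp_aemeasurable hm)
    rw [← lintegral_indicator_one hWo.measurableSet,
      lintegral_riemVolume x (measurable_one.indicator hWo.measurableSet)
      (fun q hq => indicator_of_notMem (fun h => hq h.1) _), lintegral_eq_zero_iff' hmeas,
      Filter.EventuallyEq, ae_restrict_iff' hop.measurableSet] at h1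
    -- the chart maps `W` to an open set on which the density vanishes almost everywhere
    set Z := (extChartAt (𝓡 n) x).target ∩ (extChartAt (𝓡 n) x).symm ⁻¹' W with hZ
    have hZo : IsOpen Z := (continuousOn_extChartAt_symm x).isOpen_inter_preimage hop hW
    have hZne : Z.Nonempty := ⟨extChartAt (𝓡 n) x x, mem_extChartAt_target x, by
      simpa [mem_preimage] using hx⟩
    refine (hZo.measure_pos volume hZne).ne' (measure_mono_null (fun y hy => ?_) (ae_iff.1 h1))
    intro h
    have h2 := h hy.1
    have hyW : (extChartAt (𝓡 n) x).symm y ∈ W' := ⟨(extChartAt (𝓡 n) x).map_target hy.1, hy.2⟩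
    rw [indicator_of_mem hyW] at h2
    simp only [Pi.one_apply, mul_one, Pi.zero_apply, ENNReal.ofReal_eq_zero] at h2
    exact absurd (volDensity_pos hy.1) (not_lt.2 h2)

end Volume

/-! ### The energy inequality in a chart -/

section Divergence

variable {n : ℕ}

theorem contDiff_smul_of_tsupport_subset {E F : Type*} [NormedAddCommGroup E] [NormedSpace ℝ E]
    [NormedAddCommGroup F] [NormedSpace ℝ F] {k : ℕ∞ω} {Ω : Set E} {A : E → ℝ} {f : E → F}
    (hΩ : IsOpen Ω) (hA : ContDiff ℝ k A) (hAΩ : tsupport A ⊆ Ω) (hf : ContDiffOn ℝ k f Ω) :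
    ContDiff ℝ k (fun y => A y • f y) := by
  rw [contDiff_iff_contDiffAt]
  intro y
  by_cases hy : y ∈ tsupport A
  · exact hA.contDiffAt.smul (hf.contDiffAt (hΩ.mem_nhds (hAΩ hy)))
  · refine (contDiffAt_const (c := (0 : F))).congr_of_eventuallyEq ?_
    filter_upwards [(isClosed_tsupport A).isOpen_compl.mem_nhds hy] with z hz
    rw [image_eq_zero_of_notMem_tsupport hz, zero_smul]

theorem integrable_of_continuousOn_of_support {X : Type*} [TopologicalSpace X] [T2Space X]
    [MeasurableSpace X] [OpensMeasurableSpace X] {μ : Measure X} [IsFiniteMeasureOnCompacts μ]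
    {K : Set X} {f : X → ℝ} (hK : IsCompact K)
    (hf : ContinuousOn f K) (h0 : ∀ y ∉ K, f y = 0) : Integrable f μ :=
  (integrableOn_iff_integrable_of_support_subset fun y hy => by
    by_contra h; exact hy (h0 y h)).1 (hf.integrableOn_compact hK)

theorem trace_eq_sum_coord (L : Eucl n →L[ℝ] Eucl n) :
    LinearMap.trace ℝ (Eucl n) L = ∑ i, L (EuclideanSpace.single i 1) i := by
  rw [LinearMap.trace_eq_matrix_trace ℝ (stdB n), Matrix.trace]
  refine Finset.sum_congr rfl fun i _ => ?_
  rw [Matrix.diag_apply, LinearMap.toMatrix_apply]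
  simp [stdB]

theorem trace_smul_add_smulRight (L : Eucl n →L[ℝ] Eucl n) (f f' : Eucl n →L[ℝ] ℝ)
    (x x' : Eucl n) (a c : ℝ) :
    LinearMap.trace ℝ (Eucl n)
        (a • (c • L + f.smulRight x) + f'.smulRight x' : Eucl n →L[ℝ] Eucl n) =
      a * (c * LinearMap.trace ℝ (Eucl n) L + f x) + f' x' := by
  have h : ∀ (f : Eucl n →L[ℝ] ℝ) (x : Eucl n),
      LinearMap.trace ℝ (Eucl n) (f.smulRight x : Eucl n →L[ℝ] Eucl n) = f x :=
    fun f x => LinearMap.trace_smulRight f.toLinearMap x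
  rw [← h f x, ← h f' x']
  simp only [ContinuousLinearMap.toLinearMap_add, ContinuousLinearMap.toLinearMap_smul, map_add,
    map_smul,
    smul_eq_mul]

/-- The integral of the divergence of a compactly supported field vanishes. -/
theorem integral_trace_fderiv_eq_zero {F : Eucl n → Eucl n} (hF : ContDiff ℝ 1 F)
    (hc : HasCompactSupport F) :
    ∫ y, LinearMap.trace ℝ (Eucl n) (fderiv ℝ F y) = 0 := by
  have hFi : ∀ i, ContDiff ℝ 1 fun y => F y i := fun i =>
    (EuclideanSpace.proj (𝕜 := ℝ) i).contDiff.comp hF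
  have hci : ∀ i, HasCompactSupport fun y => F y i := fun i =>
    hc.comp_left (g := fun a : Eucl n => a i) rfl
  have hd : ∀ i y a, fderiv ℝ F y a i = fderiv ℝ (fun y => F y i) y a := fun i y a => by
    have h : HasFDerivAt (fun y => F y i)
        ((EuclideanSpace.proj (𝕜 := ℝ) i).comp (fderiv ℝ F y)) y :=
      (EuclideanSpace.proj (𝕜 := ℝ) i).hasFDerivAt.comp y
        (hF.differentiable (by norm_num) y).hasFDerivAt
    rw [h.fderiv]; rfl
  have hint : ∀ i, Integrable fun y => fderiv ℝ (fun y => F y i) y (EuclideanSpace.single i 1) :=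
    fun i => by
      refine Continuous.integrable_of_hasCompactSupport ?_ ?_
      · exact ((hFi i).continuous_fderiv (by norm_num)).clm_apply continuous_const
      · exact ((hci i).fderiv (𝕜 := ℝ)).comp_left
          (g := fun L : Eucl n →L[ℝ] ℝ => L (EuclideanSpace.single i 1)) rfl
  simp only [trace_eq_sum_coord, hd]
  rw [integral_finsetSum _ fun i _ => hint i]
  refine Finset.sum_eq_zero fun i _ => ?_
  have h := integral_mul_fderiv_eq_neg_fderiv_mul_of_integrable (μ := (volume : Measure (Eucl n)))
    (f := fun y => F y i) (g := fun _ => (1 : ℝ)) (v := EuclideanSpace.single i 1)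
    (by simpa using hint i) (by simp)
    (by simpa using (hFi i).continuous.integrable_of_hasCompactSupport (hci i))
    (fun y _ => (hFi i).differentiable (by norm_num) y) (fun y _ => differentiableAt_const _)
  simpa using h

/-- A pointwise differential inequality `∂ₜ(hJ) + div(hJv) ≤ κ hJ`, integrated against a test
function. -/
theorem integral_transport_le {T t κ : ℝ} {Ω : Set (Eucl n)} (hΩ : IsOpen Ω) (ht : t ∈ Ioo 0 T)
    {h : ℝ × Eucl n → ℝ} {J A : Eucl n → ℝ} {v : Eucl n → Eucl n}
    (hh : ContDiffOn ℝ 1 h (Icc 0 T ×ˢ Ω)) (hJ : ContDiffOn ℝ 1 J Ω) (hv : ContDiffOn ℝ 1 v Ω)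
    (hA : ContDiff ℝ 1 A) (hA0 : ∀ y, 0 ≤ A y) (hAc : HasCompactSupport A) (hAΩ : tsupport A ⊆ Ω)
    (hle : ∀ y ∈ Ω, fderiv ℝ h (t, y) (1, v y) * J y + h (t, y) * (fderiv ℝ J y (v y) +
      J y * LinearMap.trace ℝ (Eucl n) (fderiv ℝ v y)) ≤ κ * (h (t, y) * J y)) :
    ∫ y in Ω, J y * (A y * fderiv ℝ h (t, y) (1, 0)) ≤
      (∫ y in Ω, J y * (fderiv ℝ A y (v y) * h (t, y))) + κ * ∫ y in Ω, J y * (A y * h (t, y)) := by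
  have hnhds : ∀ y ∈ Ω, Icc 0 T ×ˢ Ω ∈ 𝓝 (t, y) := fun y hy =>
    prod_mem_nhds (Icc_mem_nhds ht.1 ht.2) (hΩ.mem_nhds hy)
  have hhd : ∀ y ∈ Ω, DifferentiableAt ℝ h (t, y) := fun y hy =>
    (hh.contDiffAt (hnhds y hy)).differentiableAt (by norm_num)
  have hht : ContDiffOn ℝ 1 (fun y => h (t, y)) Ω :=
    hh.comp (contDiff_prodMk_right t).contDiffOn fun y hy => ⟨Ioo_subset_Icc_self ht, hy⟩
  have hdt : ContinuousOn (fun y => fderiv ℝ h (t, y) (1, 0)) Ω := by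
    have h1 : ContDiffOn ℝ 1 h (Ioo 0 T ×ˢ Ω) := hh.mono (prod_mono Ioo_subset_Icc_self le_rfl)
    have h2 := h1.continuousOn_fderiv_of_isOpen (isOpen_Ioo.prod hΩ) (by norm_num)
    have h3 : ContinuousOn (fun y => fderiv ℝ h (t, y)) Ω :=
      h2.comp (contDiff_prodMk_right (𝕜 := ℝ) (n := 0) t).continuous.continuousOn
        fun y hy => ⟨ht, hy⟩
    exact h3.clm_apply continuousOn_const
  have hA0' : ∀ y ∉ tsupport A, A y = 0 := fun y hy => image_eq_zero_of_notMem_tsupport hy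
  have hdA0 : ∀ y ∉ tsupport A, fderiv ℝ A y = 0 := fun y hy =>
    image_eq_zero_of_notMem_tsupport fun h' => hy (tsupport_fderiv_subset ℝ h')
  -- a compactly supported field, whose divergence integrates to zero
  set F : Eucl n → Eucl n := fun y => A y • ((h (t, y) * J y) • v y) with hF
  have hφ : ContDiffOn ℝ 1 (fun y => (h (t, y) * J y) • v y) Ω := (hht.mul hJ).smul hv
  have hFC : ContDiff ℝ 1 F := contDiff_smul_of_tsupport_subset hΩ hA hAΩ hφ
  have hFc : HasCompactSupport F := hAc.smul_right
  have hdF0 : ∀ y ∉ tsupport A, LinearMap.trace ℝ (Eucl n) (fderiv ℝ F y) = 0 := fun y hy => by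
    have : fderiv ℝ F y = 0 := image_eq_zero_of_notMem_tsupport fun h' =>
      hy (closure_mono (fun z hz => by
        intro h0; exact hz (by simp [hF, h0])) (tsupport_fderiv_subset ℝ h'))
    rw [this]; simp
  have i1 : Integrable fun y => J y * (A y * fderiv ℝ h (t, y) (1, 0)) :=
    integrable_of_continuousOn_of_support hAc
      ((hJ.continuousOn.mono hAΩ).mul (hA.continuous.continuousOn.mul (hdt.mono hAΩ)))
      fun y hy => by simp [hA0' y hy]
  have i2 : Integrable fun y => J y * (fderiv ℝ A y (v y) * h (t, y)) :=
    integrable_of_continuousOn_of_support hAc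
      ((hJ.continuousOn.mono hAΩ).mul
        (((hA.continuous_fderiv (by norm_num)).continuousOn.clm_apply
          (hv.continuousOn.mono hAΩ)).mul (hht.continuousOn.mono hAΩ)))
      fun y hy => by simp [hdA0 y hy]
  have i3 : Integrable fun y => J y * (A y * h (t, y)) :=
    integrable_of_continuousOn_of_support hAc
      ((hJ.continuousOn.mono hAΩ).mul (hA.continuous.continuousOn.mul (hht.continuousOn.mono hAΩ)))
      fun y hy => by simp [hA0' y hy]
  have i4 : Integrable fun y => LinearMap.trace ℝ (Eucl n) (fderiv ℝ F y) := by
    refine integrable_of_continuousOn_of_support hAc ?_ hdF0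
    simp only [trace_eq_sum_coord]
    refine (continuous_finsetSum _ fun i _ => ?_).continuousOn
    exact (EuclideanSpace.proj (𝕜 := ℝ) i).continuous.comp
      ((hFC.continuous_fderiv (by norm_num)).clm_apply continuous_const)
  have hout : ∀ f : Eucl n → ℝ, (∀ y ∉ tsupport A, f y = 0) → ∫ y in Ω, f y = ∫ y, f y :=
    fun f hf => setIntegral_eq_integral_of_forall_compl_eq_zero fun y hy =>
      hf y fun h' => hy (hAΩ h')
  rw [hout _ fun y hy => by simp [hA0' y hy], hout _ fun y hy => by simp [hdA0 y hy],
    hout _ fun y hy => by simp [hA0' y hy]]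
  have h0 := integral_trace_fderiv_eq_zero hFC hFc
  have i5 : Integrable fun y => J y * (fderiv ℝ A y (v y) * h (t, y)) +
      κ * (J y * (A y * h (t, y))) := i2.add (i3.const_mul κ)
  have i6 : Integrable fun y => J y * (fderiv ℝ A y (v y) * h (t, y)) +
      κ * (J y * (A y * h (t, y))) - LinearMap.trace ℝ (Eucl n) (fderiv ℝ F y) := i5.sub i4
  rw [← integral_const_mul, ← integral_add i2 (i3.const_mul κ), ← sub_zero (∫ y, _ + _), ← h0,
    ← integral_sub i5 i4]
  refine integral_mono i1 i6 fun y => ?_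
  by_cases hy : y ∈ tsupport A
  · have hyΩ := hAΩ hy
    have hJd := (hJ.contDiffAt (hΩ.mem_nhds hyΩ)).differentiableAt (by norm_num)
    have hvd := (hv.contDiffAt (hΩ.mem_nhds hyΩ)).differentiableAt (by norm_num)
    have hAd := hA.differentiable (by norm_num) y
    have hhy := (hasDerivAt_slices (hhd y hyΩ)).2
    have hFd : HasFDerivAt F _ y :=
      hAd.hasFDerivAt.smul ((hhy.mul hJd.hasFDerivAt).smul hvd.hasFDerivAt)
    have hsplit : fderiv ℝ h (t, y) (1, v y) =
        fderiv ℝ h (t, y) (1, 0) + fderiv ℝ h (t, y) (0, v y) := by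
      rw [← map_add]; simp
    have htr : LinearMap.trace ℝ (Eucl n) (fderiv ℝ F y) =
        A y * (h (t, y) * J y * LinearMap.trace ℝ (Eucl n) (fderiv ℝ v y) +
          (h (t, y) * fderiv ℝ J y (v y) + J y * fderiv ℝ h (t, y) (0, v y))) +
          fderiv ℝ A y (v y) * (h (t, y) * J y) := by
      rw [hFd.fderiv, trace_smul_add_smulRight]
      simp
      ring
    have := mul_le_mul_of_nonneg_left (hle y hyΩ) (hA0 y)
    rw [hsplit] at this
    simp only [htr]
    linarith
  · simp [hA0' y hy, hdA0 y hy, hdF0 y hy]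

/-- The pointwise inequality `∂ₜ(hJ) + div(hJv) ≤ κ hJ` for `h = |ω|^p`, where `κ` is
`p (2K - lam) + nK`. -/
theorem transport_hsSq_rpow_le {g : Eucl n → Eucl n →L[ℝ] Eucl n →L[ℝ] ℝ} {v : Eucl n → Eucl n}
    {w : ℝ × Eucl n → Eucl n →L[ℝ] Eucl n →L[ℝ] ℝ} {t lam K p : ℝ} {y : Eucl n}
    {b : Module.Basis (Fin n) ℝ (Eucl n)} (hp : 2 ≤ p)
    (hg : DifferentiableAt ℝ g y) (hw : DifferentiableAt ℝ w (t, y))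
    (hH : DifferentiableAt ℝ (fun z : ℝ × Eucl n => hsSq (g z.2) (w z)) (t, y))
    (hJ : DifferentiableAt ℝ (fun y => dens (g y)) y)
    (hb : gram (g y) b = 1) (hL : ∀ a, |lieMetric g v y a a| ≤ 2 * K * g y a a)
    (hskew : ∀ a c, w (t, y) a c = - w (t, y) c a)
    (hev : ∀ a c, fderiv ℝ w (t, y) (1, v y) a c = -lam * w (t, y) a c
      - w (t, y) (fderiv ℝ v y a) c - w (t, y) a (fderiv ℝ v y c)) :
    fderiv ℝ (fun z : ℝ × Eucl n => hsSq (g z.2) (w z) ^ (p / 2)) (t, y) (1, v y) * dens (g y) +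
      hsSq (g y) (w (t, y)) ^ (p / 2) * (fderiv ℝ (fun y => dens (g y)) y (v y) +
        dens (g y) * LinearMap.trace ℝ (Eucl n) (fderiv ℝ v y)) ≤
      (p * (2 * K - lam) + n * K) * (hsSq (g y) (w (t, y)) ^ (p / 2) * dens (g y)) := by
  obtain ⟨H', hH', hHle⟩ := hasDerivAt_hsSq_line hg hw hb hL hskew hev
  obtain ⟨J', hJ', hJle⟩ := hasDerivAt_dens_line hg hb hL
  have hline := hasDerivAt_line t y (v y)
  have e1 : fderiv ℝ (fun z : ℝ × Eucl n => hsSq (g z.2) (w z)) (t, y) (1, v y) = H' := by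
    have h1 : HasFDerivAt (fun z : ℝ × Eucl n => hsSq (g z.2) (w z))
      (fderiv ℝ (fun z : ℝ × Eucl n => hsSq (g z.2) (w z)) (t, y))
      ((fun s : ℝ => (t + s, y + s • v y)) 0) := by simpa using hH.hasFDerivAt
    have h2 := HasFDerivAt.comp_hasDerivAt (f := fun s : ℝ => (t + s, y + s • v y)) 0 h1 hline
    exact h2.unique hH'
  have e2 : fderiv ℝ (fun y => dens (g y)) y (v y) = J' := by
    have h1 : HasFDerivAt (fun y => dens (g y)) (fderiv ℝ (fun y => dens (g y)) y)
      ((fun s : ℝ => y + s • v y) 0) := by simpa using hJ.hasFDerivAt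
    have h2 : HasDerivAt (fun s : ℝ => y + s • v y) (v y) 0 := by
      simpa using ((hasDerivAt_id (0 : ℝ)).smul_const (v y)).const_add y
    have h3 := HasFDerivAt.comp_hasDerivAt (f := fun s : ℝ => y + s • v y) 0 h1 h2
    exact h3.unique hJ'
  have hHd : HasFDerivAt (fun z : ℝ × Eucl n => hsSq (g z.2) (w z) ^ (p / 2)) _ (t, y) :=
    hH.hasFDerivAt.rpow_const (Or.inr (by linarith : 1 ≤ p / 2))
  rw [hHd.fderiv, e2]
  simp only [smul_apply, e1, smul_eq_mul]
  have hH0 : 0 ≤ hsSq (g y) (w (t, y)) := by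
    rw [hsSq_eq_sum _ _ hb]
    exact Finset.sum_nonneg fun i _ => Finset.sum_nonneg fun j _ => sq_nonneg _
  have hJ0 : 0 < dens (g y) := dens_pos hb
  set H := hsSq (g y) (w (t, y)) with hHdef
  have hpow : H ^ (p / 2 - 1) * H = H ^ (p / 2) := by
    rcases hH0.eq_or_lt with h0 | h0
    · rw [← h0, mul_zero, Real.zero_rpow (by linarith)]
    · rw [← Real.rpow_add_one h0.ne', sub_add_cancel]
  have hP0 : 0 ≤ H ^ (p / 2 - 1) := Real.rpow_nonneg hH0 _
  have hQ0 : 0 ≤ H ^ (p / 2) := Real.rpow_nonneg hH0 _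
  have b1 : p / 2 * H ^ (p / 2 - 1) * H' ≤ p * (2 * K - lam) * H ^ (p / 2) := by
    have h1 : H' ≤ (4 * K - 2 * lam) * H := by linarith [(abs_le.1 hHle).2]
    calc p / 2 * H ^ (p / 2 - 1) * H' ≤ p / 2 * H ^ (p / 2 - 1) * ((4 * K - 2 * lam) * H) :=
          mul_le_mul_of_nonneg_left h1 (mul_nonneg (by linarith) hP0)
      _ = p * (2 * K - lam) * (H ^ (p / 2 - 1) * H) := by ring
      _ = _ := by rw [hpow]
  have b2 := mul_le_mul_of_nonneg_right b1 hJ0.le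
  have b3 := mul_le_mul_of_nonneg_left (abs_le.1 hJle).2 hQ0
  linarith

end Divergence

/-! ### The energy inequality on the manifold -/

theorem continuous_slice {X F : Type*} [TopologicalSpace X] [TopologicalSpace F] {f : ℝ → X → F}
    {I : Set ℝ} (h : ContinuousOn (fun z : ℝ × X => f z.1 z.2) (I ×ˢ univ)) {t : ℝ} (ht : t ∈ I) :
    Continuous (f t) :=
  continuousOn_univ.1 (h.comp (f := fun q => (t, q))
    (continuous_const.prodMk continuous_id).continuousOn fun _ hq => ⟨ht, hq⟩)

section ChartLocalisation

variable {n : ℕ} {M : Type*} [TopologicalSpace M] [ChartedSpace (Eucl n) M]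

theorem continuousOn_of_chart {F : Type*} [TopologicalSpace F] {f : ℝ → M → F} {I : Set ℝ}
    (h : ∀ x : M, ContinuousOn (fun z : ℝ × Eucl n => f z.1 ((extChartAt (𝓡 n) x).symm z.2))
      (I ×ˢ (extChartAt (𝓡 n) x).target)) :
    ContinuousOn (fun z : ℝ × M => f z.1 z.2) (I ×ˢ univ) := by
  rintro ⟨t, q⟩ ⟨ht, -⟩
  have h1 : ContinuousOn (fun z : ℝ × M => (z.1, extChartAt (𝓡 n) q z.2))
      (I ×ˢ (extChartAt (𝓡 n) q).source) :=
    continuous_fst.continuousOn.prodMk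
      ((continuousOn_extChartAt q).comp continuous_snd.continuousOn fun z hz => hz.2)
  have h2 : ContinuousOn (fun z : ℝ × M => f z.1 z.2) (I ×ˢ (extChartAt (𝓡 n) q).source) :=
    ((h q).comp h1 fun z hz => ⟨hz.1, (extChartAt (𝓡 n) q).map_source hz.2⟩).congr fun z hz => by
      simp only [Function.comp_apply, (extChartAt (𝓡 n) q).left_inv hz.2]
  refine (h2 (t, q) ⟨ht, mem_extChartAt_source q⟩).mono_of_mem_nhdsWithin ?_
  rw [nhdsWithin_prod_eq, nhdsWithin_univ]
  exact prod_mem_prod self_mem_nhdsWithin (extChartAt_source_mem_nhds q)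

theorem continuous_of_chart {F : Type*} [TopologicalSpace F] {f : M → F}
    (h : ∀ x : M, ContinuousOn (fun y => f ((extChartAt (𝓡 n) x).symm y))
      (extChartAt (𝓡 n) x).target) : Continuous f := by
  have h1 : ContinuousOn (fun z : ℝ × M => f z.2) (univ ×ˢ univ) :=
    continuousOn_of_chart (f := fun _ => f) fun x =>
      (h x).comp continuous_snd.continuousOn fun z hz => hz.2
  rw [univ_prod_univ, continuousOn_univ] at h1
  exact h1.comp ((continuous_const (y := (0 : ℝ))).prodMk continuous_id)

/-- The expression in a chart of a function supported in its domain, extended by zero. -/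
def chartExtension (η : M → ℝ) (x : M) : Eucl n → ℝ :=
  (extChartAt (𝓡 n) x).target.indicator fun y => η ((extChartAt (𝓡 n) x).symm y)

theorem dFun_eq_zero_of_notMem_tsupport {η : M → ℝ} {q : M} (hq : q ∉ tsupport η) :
    dFun (n := n) η q = 0 := by
  have h : η =ᶠ[𝓝 q] fun _ => (0 : ℝ) := by
    filter_upwards [(isClosed_tsupport η).isOpen_compl.mem_nhds hq] with z hz
    exact image_eq_zero_of_notMem_tsupport hz
  rw [dFun, h.mfderiv_eq, mfderiv_const]
  rfl

variable [IsManifold (𝓡 n) ∞ M]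

theorem contDiff_chartExtension {η : M → ℝ} {x : M} (hη : ContMDiff (𝓡 n) 𝓘(ℝ, ℝ) 1 η)
    (hc : HasCompactSupport η) (hx : tsupport η ⊆ (extChartAt (𝓡 n) x).source) :
    ContDiff ℝ 1 (chartExtension (n := n) η x) ∧ HasCompactSupport (chartExtension (n := n) η x) ∧
      tsupport (chartExtension (n := n) η x) ⊆ (extChartAt (𝓡 n) x).target := by
  have hop := isOpen_extChartAt_target (I := 𝓡 n) x
  set K := extChartAt (𝓡 n) x '' tsupport η with hKdef
  have hK : IsCompact K := hc.isCompact.image_of_continuousOn ((continuousOn_extChartAt x).mono hx)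
  have hKt : K ⊆ (extChartAt (𝓡 n) x).target := by
    rintro _ ⟨q, hq, rfl⟩
    exact (extChartAt (𝓡 n) x).map_source (hx hq)
  have h0 : ∀ y ∉ K, chartExtension (n := n) η x y = 0 := by
    intro y hy
    by_cases hyt : y ∈ (extChartAt (𝓡 n) x).target
    · rw [chartExtension, indicator_of_mem hyt]
      by_contra h
      exact hy ⟨_, subset_tsupport _ h, (extChartAt (𝓡 n) x).right_inv hyt⟩
    · exact indicator_of_notMem hyt _
  have hsub : tsupport (chartExtension (n := n) η x) ⊆ K :=
    closure_minimal (fun y hy => by by_contra h; exact hy (h0 y h)) hK.isClosed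
  refine ⟨?_, HasCompactSupport.intro hK h0, hsub.trans hKt⟩
  rw [contDiff_iff_contDiffAt]
  intro y
  by_cases hyt : y ∈ (extChartAt (𝓡 n) x).target
  · have h1 : ContDiffOn ℝ 1 (fun y => η ((extChartAt (𝓡 n) x).symm y))
        (extChartAt (𝓡 n) x).target :=
      contMDiffOn_iff_contDiffOn.1
        (hη.comp_contMDiffOn (contMDiffOn_extChartAt_symm' (k := 1) x))
    refine (h1.contDiffAt (hop.mem_nhds hyt)).congr_of_eventuallyEq ?_
    filter_upwards [hop.mem_nhds hyt] with z hz
    exact indicator_of_mem hz _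
  · refine (contDiffAt_const (c := (0 : ℝ))).congr_of_eventuallyEq ?_
    filter_upwards [hK.isClosed.isOpen_compl.mem_nhds fun h => hyt (hKt h)] with z hz
    exact h0 z hz

/-- The differential of a function along a field, in a chart. -/
theorem dFun_eq_fderiv_chart {η : M → ℝ} (hη : ContMDiff (𝓡 n) 𝓘(ℝ, ℝ) 1 η) {x q : M}
    (hq : q ∈ (extChartAt (𝓡 n) x).source) (a : TangentSpace (𝓡 n) q) :
    DifferentiableAt ℝ (fun y => η ((extChartAt (𝓡 n) x).symm y)) (extChartAt (𝓡 n) x q) ∧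
    dFun η q a = fderiv ℝ (fun y => η ((extChartAt (𝓡 n) x).symm y)) (extChartAt (𝓡 n) x q)
      (toChart x q a) := by
  have h := hasFDerivAt_chart_of_mdifferentiableAt (f := η) hq (hη.mdifferentiableAt (by norm_num))
  exact ⟨h.differentiableAt, by rw [h.fderiv, formInChart_toChart _ hq]⟩

theorem dFun_sum {ι : Type*} {s : Finset ι} {η : ι → M → ℝ}
    (hη : ∀ i ∈ s, ContMDiff (𝓡 n) 𝓘(ℝ, ℝ) 1 (η i)) (q : M) (a : TangentSpace (𝓡 n) q) :
    dFun (fun q => ∑ i ∈ s, η i q) q a = ∑ i ∈ s, dFun (η i) q a := by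
  have hq := mem_extChartAt_source (I := 𝓡 n) q
  have h : HasFDerivAt (fun y => ∑ i ∈ s, η i ((extChartAt (𝓡 n) q).symm y)) _
      (extChartAt (𝓡 n) q q) :=
    HasFDerivAt.fun_sum fun i hi => (dFun_eq_fderiv_chart (hη i hi) hq a).1.hasFDerivAt
  have hs : ContMDiff (𝓡 n) 𝓘(ℝ, ℝ) 1 fun q => ∑ i ∈ s, η i q := contMDiff_finsetSum hη
  rw [(dFun_eq_fderiv_chart hs hq a).2, h.fderiv, sum_apply]
  exact Finset.sum_congr rfl fun i hi => (dFun_eq_fderiv_chart (hη i hi) hq a).2.symm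

end ChartLocalisation

section Density

open scoped Bundle

variable {n : ℕ} {M : Type*} [TopologicalSpace M] [ChartedSpace (Eucl n) M]
  [Bundle.RiemannianBundle (fun x : M => TangentSpace (𝓡 n) x)]

/-- The density `|ω|^p` of the enstrophy. -/
def density (p : ℝ) (u : ℝ → (x : M) → TangentSpace (𝓡 n) x) (t : ℝ) (q : M) : ℝ :=
  hsNorm q (vorticity u t q) ^ p

/-- The time derivative of the density `|ω|^p`. -/
def densityDeriv (p T : ℝ) (u : ℝ → (x : M) → TangentSpace (𝓡 n) x) (t : ℝ) (q : M) : ℝ :=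
  derivWithin (fun s => density p u s q) (Icc 0 T) t

/-- The density `|ω|^p` in the chart around `x`. -/
def chartDensity (p : ℝ) (u : ℝ → (x : M) → TangentSpace (𝓡 n) x) (x : M) (z : ℝ × Eucl n) : ℝ :=
  hsSq (metricInChart x z.2) (vortForm u x z) ^ (p / 2)

theorem density_nonneg (p : ℝ) (u : ℝ → (x : M) → TangentSpace (𝓡 n) x) (t : ℝ) (q : M) :
    0 ≤ density p u t q := Real.rpow_nonneg (Real.sqrt_nonneg _) _

variable [IsManifold (𝓡 n) ∞ M] {m : ℕ∞} {c p T : ℝ} {V : ℝ → ℝ}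
  {ρ : ℝ → M → ℝ} {u : ℝ → (x : M) → TangentSpace (𝓡 n) x}

theorem hsSq_nonneg {x : M} {y : Eucl n} (hy : y ∈ (extChartAt (𝓡 n) x).target)
    (w : Eucl n →L[ℝ] Eucl n →L[ℝ] ℝ) : 0 ≤ hsSq (metricInChart x y) w := by
  obtain ⟨b, hb⟩ := exists_gram_eq_one hy
  rw [hsSq_eq_sum _ _ hb]
  exact Finset.sum_nonneg fun i _ => Finset.sum_nonneg fun j _ => sq_nonneg _

variable [SmoothMetric n M]

theorem density_eq_chartDensity (hm : 2 ≤ m)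
    (hu : ContMDiffOn (𝓘(ℝ, ℝ).prod (𝓡 n)) (𝓡 n).tangent (m : ℕ∞ω)
      (fun z : ℝ × M => (⟨z.2, u z.1 z.2⟩ : TangentBundle (𝓡 n) M)) (Icc 0 T ×ˢ univ))
    {t : ℝ} (ht : t ∈ Icc 0 T) {x : M} {y : Eucl n} (hy : y ∈ (extChartAt (𝓡 n) x).target)
    (p : ℝ) : density p u t ((extChartAt (𝓡 n) x).symm y) = chartDensity p u x (t, y) := by
  have hq : (extChartAt (𝓡 n) x).symm y ∈ (extChartAt (𝓡 n) x).source :=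
    (extChartAt (𝓡 n) x).map_target hy
  have hv : vorticity u t ((extChartAt (𝓡 n) x).symm y) = fun a c =>
      vortForm u x (t, y) (toChart x _ a) (toChart x _ c) := by
    funext a c
    rw [vorticity_eq_vortForm hm hu ht hq, (extChartAt (𝓡 n) x).right_inv hy]
  rw [density, hv, hsNorm_eq_sqrt_hsSq hq, (extChartAt (𝓡 n) x).right_inv hy, chartDensity,
    Real.sqrt_eq_rpow, ← Real.rpow_mul (hsSq_nonneg hy _)]
  congr 1
  ring

theorem contDiffOn_hsSq_vortForm (hT : 0 < T) (hm : 2 ≤ m)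
    (hu : ContMDiffOn (𝓘(ℝ, ℝ).prod (𝓡 n)) (𝓡 n).tangent (m : ℕ∞ω)
      (fun z : ℝ × M => (⟨z.2, u z.1 z.2⟩ : TangentBundle (𝓡 n) M)) (Icc 0 T ×ˢ univ)) (x : M) :
    ContDiffOn ℝ 1 (fun z : ℝ × Eucl n => hsSq (metricInChart x z.2) (vortForm u x z))
      (Icc 0 T ×ˢ (extChartAt (𝓡 n) x).target) := by
  intro z hz
  obtain ⟨b, hb⟩ := exists_gram_eq_one hz.2
  have hg : ContDiffOn ℝ 1 (metricInChart (n := n) x) (extChartAt (𝓡 n) x).target :=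
    (contDiffOn_metricInChart x).of_le (by exact_mod_cast le_top)
  exact contDiffWithinAt_hsSq ((hg z.2 hz.2).comp z contDiff_snd.contDiffWithinAt
    fun z hz => hz.2) (contDiffOn_vortForm hT hm hu x z hz) (det_gram_pos hb).ne'

theorem contDiffOn_chartDensity (hT : 0 < T) (hp : 2 ≤ p) (hm : 2 ≤ m)
    (hu : ContMDiffOn (𝓘(ℝ, ℝ).prod (𝓡 n)) (𝓡 n).tangent (m : ℕ∞ω)
      (fun z : ℝ × M => (⟨z.2, u z.1 z.2⟩ : TangentBundle (𝓡 n) M)) (Icc 0 T ×ˢ univ)) (x : M) :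
    ContDiffOn ℝ 1 (chartDensity p u x) (Icc 0 T ×ˢ (extChartAt (𝓡 n) x).target) :=
  ContDiffOn.rpow_const_of_le (m := 1) (contDiffOn_hsSq_vortForm hT hm hu x)
    (by push_cast; linarith)

theorem densityDeriv_eq (hm : 2 ≤ m)
    (hu : ContMDiffOn (𝓘(ℝ, ℝ).prod (𝓡 n)) (𝓡 n).tangent (m : ℕ∞ω)
      (fun z : ℝ × M => (⟨z.2, u z.1 z.2⟩ : TangentBundle (𝓡 n) M)) (Icc 0 T ×ˢ univ))
    {t : ℝ} (ht : t ∈ Icc 0 T) {x : M} {y : Eucl n} (hy : y ∈ (extChartAt (𝓡 n) x).target)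
    (p : ℝ) : densityDeriv p T u t ((extChartAt (𝓡 n) x).symm y) =
      derivWithin (fun s => chartDensity p u x (s, y)) (Icc 0 T) t :=
  derivWithin_congr (fun s hs => density_eq_chartDensity hm hu hs hy p)
    (density_eq_chartDensity hm hu ht hy p)

theorem continuousOn_density (hT : 0 < T) (hp : 2 ≤ p) (hm : 2 ≤ m)
    (hu : ContMDiffOn (𝓘(ℝ, ℝ).prod (𝓡 n)) (𝓡 n).tangent (m : ℕ∞ω)
      (fun z : ℝ × M => (⟨z.2, u z.1 z.2⟩ : TangentBundle (𝓡 n) M)) (Icc 0 T ×ˢ univ)) :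
    ContinuousOn (fun z : ℝ × M => density p u z.1 z.2) (Icc 0 T ×ˢ univ) :=
  continuousOn_of_chart fun x => (contDiffOn_chartDensity hT hp hm hu x).continuousOn.congr
    fun _ hz => density_eq_chartDensity hm hu hz.1 hz.2 p

theorem continuousOn_densityDeriv (hT : 0 < T) (hp : 2 ≤ p) (hm : 2 ≤ m)
    (hu : ContMDiffOn (𝓘(ℝ, ℝ).prod (𝓡 n)) (𝓡 n).tangent (m : ℕ∞ω)
      (fun z : ℝ × M => (⟨z.2, u z.1 z.2⟩ : TangentBundle (𝓡 n) M)) (Icc 0 T ×ˢ univ)) :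
    ContinuousOn (fun z : ℝ × M => densityDeriv p T u z.1 z.2) (Icc 0 T ×ˢ univ) :=
  continuousOn_of_chart fun x => (contDiffOn_derivWithin_slab (k := 0) hT
    (isOpen_extChartAt_target (I := 𝓡 n) x) (contDiffOn_chartDensity hT hp hm hu x)
    (by norm_num)).continuousOn.congr fun _ hz => densityDeriv_eq hm hu hz.1 hz.2 p

theorem hasDerivWithinAt_density (hT : 0 < T) (hp : 2 ≤ p) (hm : 2 ≤ m)
    (hu : ContMDiffOn (𝓘(ℝ, ℝ).prod (𝓡 n)) (𝓡 n).tangent (m : ℕ∞ω)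
      (fun z : ℝ × M => (⟨z.2, u z.1 z.2⟩ : TangentBundle (𝓡 n) M)) (Icc 0 T ×ˢ univ))
    {t : ℝ} (ht : t ∈ Icc 0 T) (q : M) :
    HasDerivWithinAt (fun s => density p u s q) (densityDeriv p T u t q) (Icc 0 T) t := by
  have hy := mem_extChartAt_target (I := 𝓡 n) q
  have h := hasDerivWithinAt_slab (t := t) hy
    (((contDiffOn_chartDensity hT hp hm hu q).differentiableOn (by norm_num)) _ ⟨ht, hy⟩)
  refine DifferentiableWithinAt.hasDerivWithinAt ?_
  refine (h.congr_of_mem (fun _ hs => ?_) ht).differentiableWithinAt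
  have := density_eq_chartDensity hm hu hs hy p
  rwa [extChartAt_to_inv] at this

/-- The pointwise energy inequality in a chart. -/
theorem IsSolution.chartDensity_le (h : IsSolution m c p T V ρ u) (hp : 2 ≤ p) (hc : 0 < c)
    (hT : 0 < T) (hm : 2 ≤ m) (hV : ContDiffOn ℝ 3 V (Ioi 0)) {t K : ℝ} (ht : t ∈ Ioo 0 T)
    (hK : ∀ q : M, LieBoundAt p K u t q) {x : M}
    {y : Eucl n} (hy : y ∈ (extChartAt (𝓡 n) x).target) :
    fderiv ℝ (chartDensity p u x) (t, y) (1, transportVel p u x (t, y)) * volDensity x y +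
      chartDensity p u x (t, y) * (fderiv ℝ (volDensity x) y (transportVel p u x (t, y)) +
        volDensity x y * LinearMap.trace ℝ (Eucl n)
          (fderiv ℝ (fun y => transportVel p u x (t, y)) y)) ≤
      (p * (2 * K - c ^ (-p)) + n * K) * (chartDensity p u x (t, y) * volDensity x y) := by
  have hop := isOpen_extChartAt_target (I := 𝓡 n) x
  have ht' := Ioo_subset_Icc_self ht
  have hu := h.contMDiffOn_u
  have hnhds : Icc 0 T ×ˢ (extChartAt (𝓡 n) x).target ∈ 𝓝 (t, y) :=
    prod_mem_nhds (Icc_mem_nhds ht.1 ht.2) (hop.mem_nhds hy)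
  obtain ⟨b, hb⟩ := exists_gram_eq_one hy
  have hvol : (volDensity x : Eucl n → ℝ) = fun y => dens (metricInChart x y) :=
    funext fun y => volDensity_eq_dens x y
  have hJ : DifferentiableAt ℝ (fun y => dens (metricInChart x y)) y := by
    rw [← hvol]
    exact ((contDiffOn_volDensity x).contDiffAt (hop.mem_nhds hy)).differentiableAt (by simp)
  have hL : ∀ a, |lieMetric (metricInChart x) (fun y => transportVel p u x (t, y)) y a a| ≤
      2 * K * metricInChart x y a a := by
    have := (lieBoundAt_iff hT hp hm hu ht' ((extChartAt (𝓡 n) x).map_target hy)).1 (hK _)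
    rwa [(extChartAt (𝓡 n) x).right_inv hy] at this
  have key := transport_hsSq_rpow_le (v := fun y => transportVel p u x (t, y)) hp
    (differentiableAt_metricInChart hy)
    (((contDiffOn_vortForm hT hm hu x).contDiffAt hnhds).differentiableAt (by norm_num))
    (((contDiffOn_hsSq_vortForm hT hm hu x).contDiffAt hnhds).differentiableAt (by norm_num))
    hJ hb hL (fun a c => by simp only [vortForm, dForm_apply]; ring)
    (fun a c => h.fderiv_vortForm hp hc hT hm hV ht hy a c)
  rw [hvol]
  exact key

/-- The transport of a function by the field `|u|^{p-2} u`, in a chart. -/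
theorem dFun_transport {η : M → ℝ} (hη : ContMDiff (𝓡 n) 𝓘(ℝ, ℝ) 1 η) (p t : ℝ) {x : M}
    {y : Eucl n} (hy : y ∈ (extChartAt (𝓡 n) x).target) :
    dFun η ((extChartAt (𝓡 n) x).symm y) (‖u t ((extChartAt (𝓡 n) x).symm y)‖ ^ (p - 2) •
      u t ((extChartAt (𝓡 n) x).symm y)) =
      fderiv ℝ (fun y => η ((extChartAt (𝓡 n) x).symm y)) y (transportVel p u x (t, y)) := by
  rw [(dFun_eq_fderiv_chart hη ((extChartAt (𝓡 n) x).map_target hy) _).2,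
    (extChartAt (𝓡 n) x).right_inv hy]
  rfl

theorem continuous_dFun_transport (hT : 0 < T) (hp : 2 ≤ p) (hm : 2 ≤ m)
    (hu : ContMDiffOn (𝓘(ℝ, ℝ).prod (𝓡 n)) (𝓡 n).tangent (m : ℕ∞ω)
      (fun z : ℝ × M => (⟨z.2, u z.1 z.2⟩ : TangentBundle (𝓡 n) M)) (Icc 0 T ×ˢ univ))
    {t : ℝ} (ht : t ∈ Icc 0 T) {η : M → ℝ} (hη : ContMDiff (𝓡 n) 𝓘(ℝ, ℝ) 1 η) :
    Continuous fun q => dFun η q (‖u t q‖ ^ (p - 2) • u t q) := by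
  refine continuous_of_chart (n := n) fun x => ?_
  have h1 : ContDiffOn ℝ 1 (fun y => η ((extChartAt (𝓡 n) x).symm y))
      (extChartAt (𝓡 n) x).target :=
    contMDiffOn_iff_contDiffOn.1
      (hη.comp_contMDiffOn (contMDiffOn_extChartAt_symm' (k := 1) x))
  have h2 : ContinuousOn (fun y => transportVel p u x (t, y)) (extChartAt (𝓡 n) x).target :=
    (contDiffOn_transportVel hT hp hm hu x).continuousOn.comp
      (continuous_const.prodMk continuous_id).continuousOn fun y hy => ⟨ht, hy⟩
  exact ((h1.continuousOn_fderiv_of_isOpen (isOpen_extChartAt_target (I := 𝓡 n) x)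
    (by norm_num)).clm_apply h2).congr fun y hy => dFun_transport hη p t hy

theorem continuous_density (hT : 0 < T) (hp : 2 ≤ p) (hm : 2 ≤ m)
    (hu : ContMDiffOn (𝓘(ℝ, ℝ).prod (𝓡 n)) (𝓡 n).tangent (m : ℕ∞ω)
      (fun z : ℝ × M => (⟨z.2, u z.1 z.2⟩ : TangentBundle (𝓡 n) M)) (Icc 0 T ×ˢ univ))
    {t : ℝ} (ht : t ∈ Icc 0 T) : Continuous (density p u t) :=
  continuous_slice (continuousOn_density hT hp hm hu) ht

theorem continuous_densityDeriv (hT : 0 < T) (hp : 2 ≤ p) (hm : 2 ≤ m)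
    (hu : ContMDiffOn (𝓘(ℝ, ℝ).prod (𝓡 n)) (𝓡 n).tangent (m : ℕ∞ω)
      (fun z : ℝ × M => (⟨z.2, u z.1 z.2⟩ : TangentBundle (𝓡 n) M)) (Icc 0 T ×ˢ univ))
    {t : ℝ} (ht : t ∈ Icc 0 T) : Continuous (densityDeriv p T u t) :=
  continuous_slice (continuousOn_densityDeriv hT hp hm hu) ht

variable [MeasurableSpace M] [BorelSpace M] [T2Space M] [SigmaCompactSpace M]

/-- The energy inequality for a test function supported in a chart. -/
theorem IsSolution.integral_density_le_chart (h : IsSolution m c p T V ρ u) (hp : 2 ≤ p)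
    (hc : 0 < c) (hT : 0 < T) (hm : 2 ≤ m) (hV : ContDiffOn ℝ 3 V (Ioi 0)) {t K : ℝ}
    (ht : t ∈ Ioo 0 T) (hK : ∀ q : M, LieBoundAt p K u t q) {η : M → ℝ} {x : M}
    (hη : ContMDiff (𝓡 n) 𝓘(ℝ, ℝ) 1 η) (hη0 : ∀ q, 0 ≤ η q) (hηc : HasCompactSupport η)
    (hηx : tsupport η ⊆ (extChartAt (𝓡 n) x).source) :
    ∫ q, η q * densityDeriv p T u t q ∂(riemVolume n M) ≤
      (∫ q, dFun η q (‖u t q‖ ^ (p - 2) • u t q) * density p u t q ∂(riemVolume n M)) +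
        (p * (2 * K - c ^ (-p)) + n * K) * ∫ q, η q * density p u t q ∂(riemVolume n M) := by
  have hop := isOpen_extChartAt_target (I := 𝓡 n) x
  have ht' := Ioo_subset_Icc_self ht
  have hu := h.contMDiffOn_u
  have hηout : ∀ q ∉ (extChartAt (𝓡 n) x).source, η q = 0 := fun q hq =>
    image_eq_zero_of_notMem_tsupport fun h' => hq (hηx h')
  have hdout : ∀ q ∉ (extChartAt (𝓡 n) x).source, dFun (n := n) η q = 0 := fun q hq =>
    dFun_eq_zero_of_notMem_tsupport fun h' => hq (hηx h')
  have hηcont := hη.continuous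
  have hd := continuous_density hT hp hm hu ht'
  have hdd := continuous_densityDeriv hT hp hm hu ht'
  have htr := continuous_dFun_transport hT hp hm hu ht' hη
  rw [integral_riemVolume x (F := fun q => η q * densityDeriv p T u t q) (hηcont.mul hdd).measurable
      fun q hq => by rw [hηout q hq, zero_mul],
    integral_riemVolume x (F := fun q => dFun η q (‖u t q‖ ^ (p - 2) • u t q) * density p u t q)
      (htr.mul hd).measurable fun q hq => by
      rw [hdout q hq, zero_apply, zero_mul],
    integral_riemVolume x (F := fun q => η q * density p u t q) (hηcont.mul hd).measurable
      fun q hq => by rw [hηout q hq, zero_mul]]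
  obtain ⟨hA1, hA2, hA3⟩ := contDiff_chartExtension hη hηc hηx
  have hA : ∀ y ∈ (extChartAt (𝓡 n) x).target,
      chartExtension η x y = η ((extChartAt (𝓡 n) x).symm y) :=
    fun y hy => indicator_of_mem hy _
  have key := integral_transport_le hop ht (contDiffOn_chartDensity hT hp hm hu x)
    ((contDiffOn_volDensity x).of_le (by exact_mod_cast le_top))
    ((contDiffOn_transportVel hT hp hm hu x).comp (contDiff_prodMk_right t).contDiffOn
      fun y hy => ⟨ht', hy⟩) hA1
    (fun y => indicator_nonneg (fun y _ => hη0 _) y) hA2 hA3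
    (fun y hy => h.chartDensity_le hp hc hT hm hV ht hK hy)
  have hnhds : ∀ y ∈ (extChartAt (𝓡 n) x).target,
      Icc 0 T ×ˢ (extChartAt (𝓡 n) x).target ∈ 𝓝 (t, y) := fun y hy =>
    prod_mem_nhds (Icc_mem_nhds ht.1 ht.2) (hop.mem_nhds hy)
  have e1 : ∀ y ∈ (extChartAt (𝓡 n) x).target,
      densityDeriv p T u t ((extChartAt (𝓡 n) x).symm y) =
        fderiv ℝ (chartDensity p u x) (t, y) (1, 0) := fun y hy => by
    rw [densityDeriv_eq hm hu ht' hy, derivWithin_of_mem_nhds (Icc_mem_nhds ht.1 ht.2)]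
    exact (hasDerivAt_slices (((contDiffOn_chartDensity hT hp hm hu x).contDiffAt
      (hnhds y hy)).differentiableAt (by norm_num))).1.deriv
  have e2 : ∀ y ∈ (extChartAt (𝓡 n) x).target,
      fderiv ℝ (fun y => η ((extChartAt (𝓡 n) x).symm y)) y =
        fderiv ℝ (chartExtension η x) y := fun y hy =>
    Filter.EventuallyEq.fderiv_eq (by
      filter_upwards [hop.mem_nhds hy] with z hz using (hA z hz).symm)
  have c1 : EqOn (fun y => volDensity x y * (η ((extChartAt (𝓡 n) x).symm y) *
        densityDeriv p T u t ((extChartAt (𝓡 n) x).symm y)))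
      (fun y => volDensity x y * (chartExtension η x y *
        fderiv ℝ (chartDensity p u x) (t, y) (1, 0))) (extChartAt (𝓡 n) x).target :=
    fun y hy => by simp only [e1 y hy, hA y hy]
  have c2 : EqOn (fun y => volDensity x y * (dFun η ((extChartAt (𝓡 n) x).symm y)
        (‖u t ((extChartAt (𝓡 n) x).symm y)‖ ^ (p - 2) • u t ((extChartAt (𝓡 n) x).symm y)) *
        density p u t ((extChartAt (𝓡 n) x).symm y)))
      (fun y => volDensity x y * (fderiv ℝ (chartExtension η x) y (transportVel p u x (t, y)) *
        chartDensity p u x (t, y))) (extChartAt (𝓡 n) x).target := fun y hy => by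
    simp only [dFun_transport hη p t hy, e2 y hy, density_eq_chartDensity hm hu ht' hy]
  have c3 : EqOn (fun y => volDensity x y * (η ((extChartAt (𝓡 n) x).symm y) *
        density p u t ((extChartAt (𝓡 n) x).symm y)))
      (fun y => volDensity x y * (chartExtension η x y * chartDensity p u x (t, y)))
      (extChartAt (𝓡 n) x).target :=
    fun y hy => by simp only [hA y hy, density_eq_chartDensity hm hu ht' hy]
  rw [setIntegral_congr_fun hop.measurableSet c1, setIntegral_congr_fun hop.measurableSet c2,
    setIntegral_congr_fun hop.measurableSet c3]
  exact key

/-- The energy inequality for a compactly supported test function, obtained by means of a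
partition of unity. -/
theorem IsSolution.integral_density_le (h : IsSolution m c p T V ρ u) (hp : 2 ≤ p)
    (hc : 0 < c) (hT : 0 < T) (hm : 2 ≤ m) (hV : ContDiffOn ℝ 3 V (Ioi 0)) {t K : ℝ}
    (ht : t ∈ Ioo 0 T) (hK : ∀ q : M, LieBoundAt p K u t q) {η : M → ℝ}
    (hη : ContMDiff (𝓡 n) 𝓘(ℝ, ℝ) 1 η) (hη0 : ∀ q, 0 ≤ η q) (hηc : HasCompactSupport η) :
    ∫ q, η q * densityDeriv p T u t q ∂(riemVolume n M) ≤
      (∫ q, dFun η q (‖u t q‖ ^ (p - 2) • u t q) * density p u t q ∂(riemVolume n M)) +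
        (p * (2 * K - c ^ (-p)) + n * K) * ∫ q, η q * density p u t q ∂(riemVolume n M) := by
  obtain ⟨f, hf⟩ := SmoothPartitionOfUnity.exists_isSubordinate_chartAt_source (𝓡 n) M
  have ht' := Ioo_subset_Icc_self ht
  have hu := h.contMDiffOn_u
  have hfin : {i | (Function.support (f i) ∩ tsupport η).Nonempty}.Finite :=
    f.locallyFinite.finite_nonempty_inter_compact hηc
  set s := hfin.toFinset with hs
  have hfC : ∀ i, ContMDiff (𝓡 n) 𝓘(ℝ, ℝ) 1 fun q => f i q * η q := fun i =>
    ((f i).contMDiff.of_le (by exact_mod_cast le_top)).mul hη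
  have hsum : η = fun q => ∑ i ∈ s, f i q * η q := by
    funext q
    by_cases hq : q ∈ tsupport η
    · rw [← Finset.sum_mul]
      have h1 : ∑ i ∈ s, f i q = 1 := by
        rw [← f.sum_eq_one (mem_univ q)]
        refine (finsum_eq_sum_of_support_subset _ fun i hi => ?_).symm
        rw [hs, Finset.mem_coe, Set.Finite.mem_toFinset]
        exact ⟨q, hi, hq⟩
      rw [h1, one_mul]
    · simp [image_eq_zero_of_notMem_tsupport hq]
  have hηi : ∀ i, HasCompactSupport fun q => f i q * η q := fun i => hηc.mul_left
  have hηis : ∀ i, tsupport (fun q => f i q * η q) ⊆ (extChartAt (𝓡 n) i).source := fun i => by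
    rw [extChartAt_source]
    exact (closure_mono fun q hq => left_ne_zero_of_mul (a := f i q) (b := η q) hq).trans (hf i)
  have hi := fun i => h.integral_density_le_chart hp hc hT hm hV ht hK (hfC i)
    (fun q => mul_nonneg (f.nonneg i q) (hη0 q)) (hηi i) (hηis i)
  have hd := continuous_density hT hp hm hu ht'
  have hdd := continuous_densityDeriv hT hp hm hu ht'
  have i1 : ∀ i, Integrable (fun q => f i q * η q * densityDeriv p T u t q) (riemVolume n M) :=
    fun i => ((hfC i).continuous.mul hdd).integrable_of_hasCompactSupport (hηi i).mul_right
  have i2 : ∀ i, Integrable (fun q => f i q * η q * density p u t q) (riemVolume n M) :=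
    fun i => ((hfC i).continuous.mul hd).integrable_of_hasCompactSupport (hηi i).mul_right
  have i3 : ∀ i, Integrable (fun q => dFun (fun q => f i q * η q) q
      (‖u t q‖ ^ (p - 2) • u t q) * density p u t q) (riemVolume n M) := fun i =>
    ((continuous_dFun_transport hT hp hm hu ht' (hfC i)).mul hd).integrable_of_hasCompactSupport
      (HasCompactSupport.intro (hηi i) fun q hq => by
        simp only [Pi.mul_apply]
        rw [dFun_eq_zero_of_notMem_tsupport hq, zero_apply, zero_mul])
  have e1 : ∀ q, η q * densityDeriv p T u t q =
      ∑ i ∈ s, f i q * η q * densityDeriv p T u t q := fun q => by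
    rw [← Finset.sum_mul, ← congrFun hsum q]
  have e2 : ∀ q, η q * density p u t q = ∑ i ∈ s, f i q * η q * density p u t q := fun q => by
    rw [← Finset.sum_mul, ← congrFun hsum q]
  have e3 : ∀ q, dFun η q (‖u t q‖ ^ (p - 2) • u t q) * density p u t q = ∑ i ∈ s,
      dFun (fun q => f i q * η q) q (‖u t q‖ ^ (p - 2) • u t q) * density p u t q := fun q => by
    rw [← Finset.sum_mul, ← dFun_sum fun i _ => hfC i, ← hsum]
  simp only [e1, e2, e3]
  rw [integral_finsetSum _ fun i _ => i1 i, integral_finsetSum _ fun i _ => i2 i,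
    integral_finsetSum _ fun i _ => i3 i, Finset.mul_sum, ← Finset.sum_add_distrib]
  exact Finset.sum_le_sum fun i _ => hi i

end Density

/-! ### Propagation of the energy inequality -/

/-- Grönwall's inequality for the integrals of a family of functions with a common compact
support. -/
theorem integral_le_exp_mul_integral {X : Type*} [TopologicalSpace X] [T2Space X]
    [MeasurableSpace X] [BorelSpace X] {μ : Measure X} [IsFiniteMeasureOnCompacts μ] {T κ : ℝ}
    {F F' : ℝ → X → ℝ} {K : Set X}
    (hK : IsCompact K) (hF : ContinuousOn (fun z : ℝ × X => F z.1 z.2) (Icc 0 T ×ˢ univ))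
    (hF' : ContinuousOn (fun z : ℝ × X => F' z.1 z.2) (Icc 0 T ×ˢ univ))
    (h0 : ∀ t ∈ Icc 0 T, ∀ q ∉ K, F t q = 0) (h0' : ∀ t ∈ Icc 0 T, ∀ q ∉ K, F' t q = 0)
    (hd : ∀ t ∈ Ioo 0 T, ∀ q, HasDerivAt (fun s => F s q) (F' t q) t)
    (hE : ∀ t ∈ Ioo 0 T, ∫ q, F' t q ∂μ ≤ κ * ∫ q, F t q ∂μ) {t : ℝ} (ht : t ∈ Icc 0 T) :
    ∫ q, F t q ∂μ ≤ Real.exp (κ * t) * ∫ q, F 0 q ∂μ := by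
  obtain ⟨A, hA⟩ := (isCompact_Icc.prod hK).exists_bound_of_continuousOn
    (hF.mono (prod_mono_right (subset_univ K)))
  obtain ⟨A', hA'⟩ := (isCompact_Icc.prod hK).exists_bound_of_continuousOn
    (hF'.mono (prod_mono_right (subset_univ K)))
  have hKm := hK.measurableSet
  have hint : ∀ a : ℝ, Integrable (K.indicator fun _ => a) μ := fun a =>
    (integrable_indicator_iff hKm).2 (integrableOn_const hK.measure_lt_top.ne)
  have hb : ∀ s ∈ Icc 0 T, ∀ q, ‖F s q‖ ≤ K.indicator (fun _ => A) q := fun s hs q => by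
    by_cases hq : q ∈ K
    · rw [indicator_of_mem hq]; exact hA (s, q) ⟨hs, hq⟩
    · rw [indicator_of_notMem hq, h0 s hs q hq, norm_zero]
  have hb' : ∀ s ∈ Icc 0 T, ∀ q, ‖F' s q‖ ≤ K.indicator (fun _ => A') q := fun s hs q => by
    by_cases hq : q ∈ K
    · rw [indicator_of_mem hq]; exact hA' (s, q) ⟨hs, hq⟩
    · rw [indicator_of_notMem hq, h0' s hs q hq, norm_zero]
  have hc := fun s (hs : s ∈ Icc 0 T) => continuous_slice hF hs
  have hc' := fun s (hs : s ∈ Icc 0 T) => continuous_slice hF' hs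
  have hm : ∀ s ∈ Icc 0 T, AEStronglyMeasurable (F s) μ := fun s hs =>
    ((hc s hs).integrable_of_hasCompactSupport
      (HasCompactSupport.intro hK (h0 s hs))).aestronglyMeasurable
  have hm' : ∀ s ∈ Icc 0 T, AEStronglyMeasurable (F' s) μ := fun s hs =>
    ((hc' s hs).integrable_of_hasCompactSupport
      (HasCompactSupport.intro hK (h0' s hs))).aestronglyMeasurable
  have hcont : ContinuousOn (fun s => ∫ q, F s q ∂μ) (Icc 0 T) :=
    continuousOn_of_dominated hm (fun s hs => ae_of_all _ (hb s hs)) (hint A)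
      (ae_of_all _ fun q => hF.comp (f := fun s => (s, q))
        (continuous_id.prodMk continuous_const).continuousOn fun s hs => ⟨hs, mem_univ _⟩)
  have hderiv : ∀ s ∈ Ioo 0 T, HasDerivAt (fun s => ∫ q, F s q ∂μ) (∫ q, F' s q ∂μ) s := by
    intro s hs
    have hs' := Ioo_subset_Icc_self hs
    have hnh : Ioo 0 T ∈ 𝓝 s := Ioo_mem_nhds hs.1 hs.2
    exact (hasDerivAt_integral_of_dominated_loc_of_deriv_le hnh
      (by filter_upwards [hnh] with r hr using hm r (Ioo_subset_Icc_self hr))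
      ((hc s hs').integrable_of_hasCompactSupport (HasCompactSupport.intro hK (h0 s hs')))
      (hm' s hs') (ae_of_all _ fun q r hr => hb' r (Ioo_subset_Icc_self hr) q) (hint A')
      (ae_of_all _ fun q r hr => hd r hr q)).2
  have hexp : ∀ s, HasDerivAt (fun s => Real.exp (-κ * s)) (Real.exp (-κ * s) * -κ) s := fun s => by
    have := ((hasDerivAt_id s).const_mul (-κ)).exp
    simpa using this
  have hanti : AntitoneOn (fun s => Real.exp (-κ * s) * ∫ q, F s q ∂μ) (Icc 0 T) := by
    refine antitoneOn_of_deriv_nonpos (convex_Icc 0 T)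
      ((by fun_prop : Continuous fun s => Real.exp (-κ * s)).continuousOn.mul hcont) ?_ ?_
    · intro s hs
      rw [interior_Icc] at hs
      exact ((hexp s).mul (hderiv s hs)).differentiableAt.differentiableWithinAt
    · intro s hs
      rw [interior_Icc] at hs
      have hds : HasDerivAt (fun s => Real.exp (-κ * s) * ∫ q, F s q ∂μ) _ s :=
        (hexp s).mul (hderiv s hs)
      rw [hds.deriv]
      have := mul_le_mul_of_nonneg_left (hE s hs) (Real.exp_pos (-κ * s)).le
      linarith
  have h := hanti (left_mem_Icc.2 (ht.1.trans ht.2)) ht ht.1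
  simp only [mul_zero, Real.exp_zero, one_mul] at h
  have h2 := mul_le_mul_of_nonneg_left h (Real.exp_pos (κ * t)).le
  rwa [← mul_assoc, ← Real.exp_add, show κ * t + -κ * t = 0 by ring, Real.exp_zero, one_mul] at h2

/-- A smooth step function, equal to `1` on `(-∞, 0]` and to `0` on `[1, ∞)`. -/
def cutoff (s : ℝ) : ℝ := Real.smoothTransition (1 - s)

theorem contDiff_cutoff {k : ℕ∞} : ContDiff ℝ k cutoff :=
  Real.smoothTransition.contDiff.comp (contDiff_const.sub contDiff_id)

theorem cutoff_nonneg (s : ℝ) : 0 ≤ cutoff s := Real.smoothTransition.nonneg _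

theorem cutoff_le_one (s : ℝ) : cutoff s ≤ 1 := Real.smoothTransition.le_one _

theorem cutoff_of_nonpos {s : ℝ} (hs : s ≤ 0) : cutoff s = 1 :=
  Real.smoothTransition.one_of_one_le (by linarith)

theorem cutoff_of_one_le {s : ℝ} (hs : 1 ≤ s) : cutoff s = 0 :=
  Real.smoothTransition.zero_of_nonpos (by linarith)

theorem deriv_cutoff_nonpos (s : ℝ) : deriv cutoff s ≤ 0 :=
  Antitone.deriv_nonpos fun _ _ h => Real.smoothTransition.monotone (by linarith)

theorem hasDerivAt_cutoff (s : ℝ) : HasDerivAt cutoff (deriv cutoff s) s :=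
  ((contDiff_cutoff (k := 1)).differentiable (by norm_num) s).hasDerivAt

theorem deriv_cutoff_of_one_lt {s : ℝ} (hs : 1 < s) : deriv cutoff s = 0 := by
  have h : cutoff =ᶠ[𝓝 s] fun _ => 0 := by
    filter_upwards [lt_mem_nhds hs] with r hr using cutoff_of_one_le hr.le
  rw [h.deriv_eq, deriv_const]

/-! ### Barriers and the bound for the vorticity -/

section Energy

open scoped Bundle

variable {n : ℕ} {M : Type*} [TopologicalSpace M] [ChartedSpace (Eucl n) M]
  [Bundle.RiemannianBundle (fun x : M => TangentSpace (𝓡 n) x)]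

/-- `r` is a function on `M` with compact sublevel sets, whose rate of change along the
transport field `|u|^{p-2} u` is at most `B`. -/
structure IsBarrier (p T : ℝ) (u : ℝ → (x : M) → TangentSpace (𝓡 n) x) (r : M → ℝ) (B : ℝ) :
    Prop where
  contMDiff : ContMDiff (𝓡 n) 𝓘(ℝ, ℝ) 1 r
  isCompact : ∀ R : ℝ, IsCompact {q | r q ≤ R}
  nonneg : 0 ≤ B
  le : ∀ t ∈ Icc 0 T, ∀ q, |dFun r q (‖u t q‖ ^ (p - 2) • u t q)| ≤ B

/-- On a compact manifold a constant is a barrier: there is nothing to cut off. -/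
theorem isBarrier_of_compactSpace [CompactSpace M] (p T : ℝ)
    (u : ℝ → (x : M) → TangentSpace (𝓡 n) x) : IsBarrier p T u (fun _ => 0) 0 where
  contMDiff := contMDiff_const
  isCompact R := by
    by_cases h : (0 : ℝ) ≤ R
    · simpa [h] using isCompact_univ
    · simp [h]
  nonneg := le_rfl
  le t ht q := by
    have : dFun (n := n) (fun _ : M => (0 : ℝ)) q = 0 := mfderiv_const
    rw [this, zero_apply, abs_zero]

theorem norm_rpow_smul_self {E : Type*} [NormedAddCommGroup E] [NormedSpace ℝ E] {p : ℝ}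
    (hp : 2 ≤ p) (x : E) : ‖‖x‖ ^ (p - 2) • x‖ = ‖x‖ ^ (p - 1) := by
  rw [norm_smul, Real.norm_of_nonneg (Real.rpow_nonneg (norm_nonneg _) _)]
  rcases eq_or_ne ‖x‖ 0 with h | h
  · rw [h, mul_zero, Real.zero_rpow (by linarith)]
  · rw [← Real.rpow_add_one h]
    congr 1
    ring

/-- On the Euclidean space `√(1 + |x|²)` is a barrier for a bounded field. -/
theorem IsEuclidean.exists_isBarrier (h : IsEuclidean n M) {p T C : ℝ} (hp : 2 ≤ p)
    {u : ℝ → (x : M) → TangentSpace (𝓡 n) x}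
    (hC : 0 ≤ C) (hu : ∀ t ∈ Icc 0 T, ∀ q, ‖u t q‖ ≤ C) : ∃ r B, IsBarrier p T u r B := by
  obtain ⟨Φ, hΦ⟩ := h
  have hf : ContDiff ℝ 1 fun z : Eucl n => √(1 + ‖z‖ ^ 2) :=
    (contDiff_const.add (contDiff_norm_sq ℝ)).sqrt fun z => by positivity
  have hdf : ∀ z a : Eucl n, |fderiv ℝ (fun z : Eucl n => √(1 + ‖z‖ ^ 2)) z a| ≤ ‖a‖ := by
    intro z a
    have h1 : HasFDerivAt (fun z : Eucl n => 1 + ‖z‖ ^ 2) (2 • innerSL ℝ z) z :=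
      ((hasStrictFDerivAt_norm_sq z).hasFDerivAt).const_add 1
    have hpos : 0 < √(1 + ‖z‖ ^ 2) := Real.sqrt_pos.2 (by positivity)
    rw [(h1.sqrt (by positivity)).fderiv]
    have h2 : ‖z‖ ≤ √(1 + ‖z‖ ^ 2) := Real.le_sqrt_of_sq_le (by linarith)
    have h3 : |inner ℝ z a| ≤ √(1 + ‖z‖ ^ 2) * ‖a‖ :=
      (abs_real_inner_le_norm z a).trans (by gcongr)
    have h4 : ((1 / (2 * √(1 + ‖z‖ ^ 2))) • (2 • innerSL ℝ z)) a =
        inner ℝ z a / √(1 + ‖z‖ ^ 2) := by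
      simp only [smul_apply, innerSL_apply_apply, smul_eq_mul, nsmul_eq_mul]
      field_simp
      norm_num
    rw [h4, abs_div, abs_of_pos hpos, div_le_iff₀ hpos, mul_comm ‖a‖]
    exact h3
  have hnorm : ∀ (q : M) (a : TangentSpace (𝓡 n) q),
      @norm (Eucl n) _ (mfderiv (𝓡 n) 𝓘(ℝ, Eucl n) Φ q a) = ‖a‖ := by
    intro q a
    let b : Eucl n := mfderiv (𝓡 n) 𝓘(ℝ, Eucl n) Φ q a
    have h1 : inner ℝ b b = inner ℝ a a := hΦ q a a
    rw [real_inner_self_eq_norm_sq, real_inner_self_eq_norm_sq] at h1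
    exact (sq_eq_sq₀ (norm_nonneg b) (norm_nonneg a)).1 h1
  have hΦs : ContMDiff (𝓡 n) 𝓘(ℝ, Eucl n) 1 Φ := Φ.contMDiff.of_le (by exact_mod_cast le_top)
  refine ⟨fun q => √(1 + ‖Φ q‖ ^ 2), C ^ (p - 1), ?_, ?_, by positivity, ?_⟩
  · exact hf.contMDiff.comp hΦs
  · intro R
    have hcl : IsClosed {q : M | √(1 + ‖Φ q‖ ^ 2) ≤ R} :=
      isClosed_le (hf.continuous.comp Φ.continuous) continuous_const
    have hsub : {q : M | √(1 + ‖Φ q‖ ^ 2) ≤ R} ⊆ Φ.symm '' Metric.closedBall 0 R := by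
      intro q hq
      refine ⟨Φ q, ?_, Φ.symm_apply_apply q⟩
      rw [mem_closedBall_zero_iff]
      exact (Real.le_sqrt_of_sq_le (by linarith)).trans hq
    exact ((isCompact_closedBall (0 : Eucl n) R).image Φ.symm.continuous).of_isClosed_subset
      hcl hsub
  · intro t ht q
    have h1 : HasMFDerivAt (𝓡 n) 𝓘(ℝ, ℝ) (fun q : M => √(1 + ‖Φ q‖ ^ 2)) q
        ((fderiv ℝ (fun z : Eucl n => √(1 + ‖z‖ ^ 2)) (Φ q)).comp
          (mfderiv (𝓡 n) 𝓘(ℝ, Eucl n) Φ q)) :=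
      ((hf.differentiable (by norm_num) (Φ q)).hasFDerivAt.hasMFDerivAt).comp q
        ((hΦs q).mdifferentiableAt (by norm_num)).hasMFDerivAt
    have h2 : dFun (fun q : M => √(1 + ‖Φ q‖ ^ 2)) q (‖u t q‖ ^ (p - 2) • u t q) =
        fderiv ℝ (fun z : Eucl n => √(1 + ‖z‖ ^ 2)) (Φ q)
          (mfderiv (𝓡 n) 𝓘(ℝ, Eucl n) Φ q (‖u t q‖ ^ (p - 2) • u t q)) := by
      rw [dFun, h1.mfderiv]; rfl
    rw [h2]
    refine (hdf _ _).trans ?_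
    refine (hnorm q _).trans_le ?_
    rw [norm_rpow_smul_self hp]
    exact Real.rpow_le_rpow (norm_nonneg _) (hu t ht q) (by linarith)

variable [IsManifold (𝓡 n) ∞ M]

theorem dFun_comp {r : M → ℝ} (hr : ContMDiff (𝓡 n) 𝓘(ℝ, ℝ) 1 r) {θ : ℝ → ℝ} (hθ : ContDiff ℝ 1 θ)
    (q : M) (a : TangentSpace (𝓡 n) q) :
    dFun (fun q => θ (r q)) q a = deriv θ (r q) * dFun r q a := by
  have hq := mem_extChartAt_source (I := 𝓡 n) q
  have hs : ContMDiff (𝓡 n) 𝓘(ℝ, ℝ) 1 fun q => θ (r q) := hθ.contMDiff.comp hr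
  have h1 := (dFun_eq_fderiv_chart hr hq a).1.hasFDerivAt
  have h2 : HasDerivAt θ (deriv θ (r q))
      (r ((extChartAt (𝓡 n) q).symm (extChartAt (𝓡 n) q q))) := by
    rw [extChartAt_to_inv]
    exact (hθ.differentiable (by norm_num) _).hasDerivAt
  have h3 : HasFDerivAt (fun y => θ (r ((extChartAt (𝓡 n) q).symm y))) _ (extChartAt (𝓡 n) q q) :=
    h2.comp_hasFDerivAt (extChartAt (𝓡 n) q q)
      (f := fun y => r ((extChartAt (𝓡 n) q).symm y)) h1
  rw [(dFun_eq_fderiv_chart hs hq a).2, (dFun_eq_fderiv_chart hr hq a).2, h3.fderiv]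
  rfl

variable {m : ℕ∞} {c p T : ℝ} {V : ℝ → ℝ}
  {ρ : ℝ → M → ℝ} {u : ℝ → (x : M) → TangentSpace (𝓡 n) x}
variable [SmoothMetric n M] [MeasurableSpace M] [BorelSpace M] [T2Space M] [SigmaCompactSpace M]

/-- The energy inequality in the space-time region `{r + B t ≤ R}`, up to smoothing its
boundary. This region is left by the transport, so the boundary term has a sign. -/
theorem IsSolution.integral_cutoff_le (h : IsSolution m c p T V ρ u) (hp : 2 ≤ p)
    (hc : 0 < c) (hT : 0 < T) (hm : 2 ≤ m) (hV : ContDiffOn ℝ 3 V (Ioi 0)) {K : ℝ}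
    (hK : ∀ t ∈ Icc 0 T, ∀ q : M, LieBoundAt p K u t q) {r : M → ℝ} {B : ℝ}
    (hr : IsBarrier p T u r B) (R : ℝ) {t : ℝ} (ht : t ∈ Icc 0 T) :
    ∫ q, cutoff (r q + (B * t - R)) * density p u t q ∂(riemVolume n M) ≤
      Real.exp ((p * (2 * K - c ^ (-p)) + n * K) * t) *
        ∫ q, cutoff (r q + (B * 0 - R)) * density p u 0 q ∂(riemVolume n M) := by
  have hu := h.contMDiffOn_u
  have hrc := hr.contMDiff.continuous
  have hd := continuousOn_density hT hp hm hu
  have hdd := continuousOn_densityDeriv hT hp hm hu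
  have hcc : Continuous cutoff := (contDiff_cutoff (k := 0)).continuous
  have hcd : Continuous (deriv cutoff) :=
    (contDiff_cutoff (k := 1)).continuous_deriv (by norm_num)
  have hlarge : ∀ t ∈ Icc 0 T, ∀ q ∉ {q | r q ≤ R + 1}, 1 < r q + (B * t - R) := by
    intro t ht q hq
    rw [mem_ofPred_eq, not_le] at hq
    have := mul_nonneg hr.nonneg ht.1
    linarith
  refine integral_le_exp_mul_integral (F := fun t q => cutoff (r q + (B * t - R)) * density p u t q)
    (F' := fun t q => deriv cutoff (r q + (B * t - R)) * B * density p u t q +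
      cutoff (r q + (B * t - R)) * densityDeriv p T u t q)
    (hr.isCompact (R + 1)) ?_ ?_ ?_ ?_ ?_ ?_ ht
  · exact (by fun_prop : Continuous fun z : ℝ × M =>
      cutoff (r z.2 + (B * z.1 - R))).continuousOn.mul hd
  · exact ((by fun_prop : Continuous fun z : ℝ × M =>
      deriv cutoff (r z.2 + (B * z.1 - R)) * B).continuousOn.mul hd).add
      ((by fun_prop : Continuous fun z : ℝ × M =>
      cutoff (r z.2 + (B * z.1 - R))).continuousOn.mul hdd)
  · intro t ht q hq
    rw [cutoff_of_one_le (hlarge t ht q hq).le, zero_mul]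
  · intro t ht q hq
    rw [cutoff_of_one_le (hlarge t ht q hq).le, deriv_cutoff_of_one_lt (hlarge t ht q hq)]
    ring
  · intro t ht q
    have h1 : HasDerivAt (fun s => r q + (B * s - R)) B t := by
      have := (((hasDerivAt_id t).const_mul B).sub_const R).const_add (r q)
      simpa using this
    have h2 : HasDerivAt (fun s => cutoff (r q + (B * s - R))) _ t :=
      HasDerivAt.comp (h₂ := cutoff) t (hasDerivAt_cutoff (r q + (B * t - R))) h1
    exact h2.mul ((hasDerivWithinAt_density hT hp hm hu (Ioo_subset_Icc_self ht) q).hasDerivAt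
      (Icc_mem_nhds ht.1 ht.2))
  · intro t ht
    have ht' := Ioo_subset_Icc_self ht
    have hd' := continuous_density hT hp hm hu ht'
    have hdd' := continuous_densityDeriv hT hp hm hu ht'
    set θ : ℝ → ℝ := fun s => cutoff (s + (B * t - R)) with hθ
    have hθ1 : ContDiff ℝ 1 θ :=
      (contDiff_cutoff (k := 1)).comp (contDiff_id.add contDiff_const)
    have hθ' : ∀ s, deriv θ s = deriv cutoff (s + (B * t - R)) := fun s =>
      deriv_comp_add_const _ _ _
    have hη : ContMDiff (𝓡 n) 𝓘(ℝ, ℝ) 1 fun q => θ (r q) := hθ1.contMDiff.comp hr.contMDiff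
    have hηc : HasCompactSupport fun q => θ (r q) :=
      HasCompactSupport.intro (hr.isCompact (R + 1)) fun q hq =>
        cutoff_of_one_le (hlarge t ht' q hq).le
    have key := h.integral_density_le hp hc hT hm hV ht (hK t ht') hη
      (fun q => cutoff_nonneg _) hηc
    have i1 : Integrable (fun q => deriv cutoff (r q + (B * t - R)) * B * density p u t q)
        (riemVolume n M) := Continuous.integrable_of_hasCompactSupport (by fun_prop)
      (HasCompactSupport.intro (hr.isCompact (R + 1)) fun q hq => by
        rw [deriv_cutoff_of_one_lt (hlarge t ht' q hq)]; ring)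
    have i2 : Integrable (fun q => cutoff (r q + (B * t - R)) * densityDeriv p T u t q)
        (riemVolume n M) := Continuous.integrable_of_hasCompactSupport (by fun_prop)
      (HasCompactSupport.intro (hr.isCompact (R + 1)) fun q hq => by
        rw [cutoff_of_one_le (hlarge t ht' q hq).le, zero_mul])
    have i3 : Integrable (fun q => dFun (fun q => θ (r q)) q (‖u t q‖ ^ (p - 2) • u t q) *
        density p u t q) (riemVolume n M) :=
      ((continuous_dFun_transport hT hp hm hu ht' hη).mul hd').integrable_of_hasCompactSupport
        (HasCompactSupport.intro (hr.isCompact (R + 1)) fun q hq => by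
          simp only [Pi.mul_apply]
          rw [dFun_comp hr.contMDiff hθ1, hθ', deriv_cutoff_of_one_lt (hlarge t ht' q hq)]
          ring)
    have hsign : (∫ q, deriv cutoff (r q + (B * t - R)) * B * density p u t q ∂(riemVolume n M)) +
        ∫ q, dFun (fun q => θ (r q)) q (‖u t q‖ ^ (p - 2) • u t q) * density p u t q
          ∂(riemVolume n M) ≤ 0 := by
      rw [← integral_add i1 i3]
      refine integral_nonpos fun q => ?_
      simp only [Pi.zero_apply]
      rw [dFun_comp hr.contMDiff hθ1, hθ', ← add_mul, ← mul_add]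
      have hB := neg_le_of_abs_le (hr.le t ht' q)
      exact mul_nonpos_of_nonpos_of_nonneg
        (mul_nonpos_of_nonpos_of_nonneg (deriv_cutoff_nonpos _) (by linarith))
        (density_nonneg p u t q)
    rw [integral_add i1 i2]
    simp only [hθ] at key hsign
    linarith

/-- The growth of the integral of `|ω|^p`. -/
theorem IsSolution.lintegral_density_le (h : IsSolution m c p T V ρ u) (hp : 2 ≤ p)
    (hc : 0 < c) (hT : 0 < T) (hm : 2 ≤ m) (hV : ContDiffOn ℝ 3 V (Ioi 0)) {K : ℝ}
    (hK : ∀ t ∈ Icc 0 T, ∀ q : M, LieBoundAt p K u t q) {r : M → ℝ} {B : ℝ}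
    (hr : IsBarrier p T u r B) {t : ℝ} (ht : t ∈ Icc 0 T) :
    ∫⁻ q, ENNReal.ofReal (density p u t q) ∂(riemVolume n M) ≤
      ENNReal.ofReal (Real.exp ((p * (2 * K - c ^ (-p)) + n * K) * t)) *
        ∫⁻ q, ENNReal.ofReal (density p u 0 q) ∂(riemVolume n M) := by
  have hu := h.contMDiffOn_u
  have h0 : (0 : ℝ) ∈ Icc 0 T := left_mem_Icc.2 hT.le
  have hrc := hr.contMDiff.continuous
  have hcc : Continuous cutoff := (contDiff_cutoff (k := 0)).continuous
  have hdc := fun s (hs : s ∈ Icc 0 T) => continuous_density hT hp hm hu hs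
  have hint : ∀ s ∈ Icc 0 T, ∀ R : ℝ, Integrable
      (fun q => cutoff (r q + (B * s - R)) * density p u s q) (riemVolume n M) := by
    intro s hs R
    have := hdc s hs
    refine Continuous.integrable_of_hasCompactSupport (by fun_prop)
      (HasCompactSupport.intro (hr.isCompact (R + 1)) fun q hq => ?_)
    rw [mem_ofPred_eq, not_le] at hq
    have := mul_nonneg hr.nonneg hs.1
    rw [cutoff_of_one_le (by linarith), zero_mul]
  have hnn : ∀ s R q, 0 ≤ cutoff (r q + (B * s - R)) * density p u s q := fun s R q =>
    mul_nonneg (cutoff_nonneg _) (density_nonneg p u s q)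
  have hN : ∀ N : ℕ, ∫⁻ q, ENNReal.ofReal (cutoff (r q + (B * t - N)) * density p u t q)
      ∂(riemVolume n M) ≤ ENNReal.ofReal (Real.exp ((p * (2 * K - c ^ (-p)) + n * K) * t)) *
        ∫⁻ q, ENNReal.ofReal (density p u 0 q) ∂(riemVolume n M) := by
    intro N
    rw [← ofReal_integral_eq_lintegral_ofReal (hint t ht N) (ae_of_all _ (hnn t N))]
    refine (ENNReal.ofReal_le_ofReal (h.integral_cutoff_le hp hc hT hm hV hK hr N ht)).trans ?_
    rw [ENNReal.ofReal_mul (Real.exp_pos _).le,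
      ofReal_integral_eq_lintegral_ofReal (hint 0 h0 N) (ae_of_all _ (hnn 0 N))]
    gcongr with q
    exact mul_le_of_le_one_left (density_nonneg p u 0 q) (cutoff_le_one _)
  have hlim : ∀ q, Tendsto (fun N : ℕ => ENNReal.ofReal
      (cutoff (r q + (B * t - N)) * density p u t q)) atTop
      (𝓝 (ENNReal.ofReal (density p u t q))) := by
    intro q
    refine tendsto_const_nhds.congr' ?_
    filter_upwards [eventually_ge_atTop ⌈r q + B * t⌉₊] with N hN
    have := (Nat.le_ceil (r q + B * t)).trans (Nat.cast_le.2 hN)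
    rw [cutoff_of_nonpos (by linarith), one_mul]
  calc ∫⁻ q, ENNReal.ofReal (density p u t q) ∂(riemVolume n M)
      = ∫⁻ q, liminf (fun N : ℕ => ENNReal.ofReal
          (cutoff (r q + (B * t - N)) * density p u t q)) atTop ∂(riemVolume n M) := by
        simp only [(hlim _).liminf_eq]
    _ ≤ liminf (fun N : ℕ => ∫⁻ q, ENNReal.ofReal
          (cutoff (r q + (B * t - N)) * density p u t q) ∂(riemVolume n M)) atTop := by
        refine lintegral_liminf_le fun N => ?_
        have := hdc t ht
        exact (by fun_prop : Continuous fun q =>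
          cutoff (r q + (B * t - N)) * density p u t q).measurable.ennreal_ofReal
    _ ≤ _ := liminf_le_of_le (by isBoundedDefault) fun b hb =>
        (hb.exists.choose_spec).trans (hN _)

theorem lintegral_density_rpow (hp : 2 ≤ p) (t : ℝ) :
    (∫⁻ q, ENNReal.ofReal (density p u t q) ∂(riemVolume n M)) ^ (1 / p) =
      eLpNorm (fun q => hsNorm q (vorticity u t q)) (ENNReal.ofReal p) (riemVolume n M) := by
  have hp0 : 0 < p := by linarith
  rw [eLpNorm_eq_lintegral_rpow_enorm_toReal (by simpa using hp0) ENNReal.ofReal_ne_top,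
    ENNReal.toReal_ofReal hp0.le]
  congr 1
  refine lintegral_congr fun q => ?_
  have h0 : 0 ≤ hsNorm q (vorticity u t q) := Real.sqrt_nonneg _
  rw [density, Real.enorm_of_nonneg h0, ENNReal.ofReal_rpow_of_nonneg h0 hp0.le]

/-- The growth of the `L^p` norm of the vorticity. -/
theorem IsSolution.eLpNorm_vorticity_le (h : IsSolution m c p T V ρ u) (hp : 2 ≤ p)
    (hc : 0 < c) (hT : 0 < T) (hm : 2 ≤ m) (hV : ContDiffOn ℝ 3 V (Ioi 0)) {K : ℝ}
    (hK : ∀ t ∈ Icc 0 T, ∀ q : M, LieBoundAt p K u t q) {r : M → ℝ} {B : ℝ}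
    (hr : IsBarrier p T u r B) {t : ℝ} (ht : t ∈ Icc 0 T) :
    eLpNorm (fun q => hsNorm q (vorticity u t q)) (ENNReal.ofReal p) (riemVolume n M) ≤
      ENNReal.ofReal (Real.exp (((2 + n / p) * K - c ^ (-p)) * t)) *
        eLpNorm (fun q => hsNorm q (vorticity u 0 q)) (ENNReal.ofReal p) (riemVolume n M) := by
  have hp0 : 0 < p := by linarith
  rw [← lintegral_density_rpow hp, ← lintegral_density_rpow hp]
  refine (ENNReal.rpow_le_rpow (h.lintegral_density_le hp hc hT hm hV hK hr ht)
    (by positivity)).trans_eq ?_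
  rw [ENNReal.mul_rpow_of_nonneg _ _ (by positivity), ENNReal.ofReal_rpow_of_pos (Real.exp_pos _),
    ← Real.exp_mul]
  congr 3
  field_simp
  ring

/-- A vanishing vorticity remains so. -/
theorem IsSolution.vorticity_eq_zero (h : IsSolution m c p T V ρ u) (hp : 2 ≤ p)
    (hc : 0 < c) (hT : 0 < T) (hm : 2 ≤ m) (hV : ContDiffOn ℝ 3 V (Ioi 0)) {K : ℝ}
    (hK : ∀ t ∈ Icc 0 T, ∀ q : M, LieBoundAt p K u t q) {r : M → ℝ} {B : ℝ}
    (hr : IsBarrier p T u r B)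
    (h0 : ∀ (x : M) (a b : TangentSpace (𝓡 n) x), vorticity u 0 x a b = 0) {t : ℝ}
    (ht : t ∈ Icc 0 T) (q : M) (a b : TangentSpace (𝓡 n) q) : vorticity u t q a b = 0 := by
  have hp0 : p ≠ 0 := by linarith
  have hu := h.contMDiffOn_u
  have hcont := continuous_density hT hp hm hu ht
  have hz : ∀ q : M, density p u 0 q = 0 := fun q => by
    simp [density, hsNorm, h0, Real.zero_rpow hp0]
  have h1 : ∫⁻ q, ENNReal.ofReal (density p u t q) ∂(riemVolume n M) = 0 := by
    refine le_antisymm ((h.lintegral_density_le hp hc hT hm hV hK hr ht).trans ?_) bot_le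
    simp [hz]
  rw [lintegral_eq_zero_iff hcont.measurable.ennreal_ofReal] at h1
  have h2 : (fun q => ENNReal.ofReal (density p u t q)) = fun _ => 0 :=
    Continuous.ae_eq_iff_eq (riemVolume n M) (ENNReal.continuous_ofReal.comp hcont)
      continuous_const |>.1 h1
  have h3 : hsNorm q (vorticity u t q) ^ p = 0 :=
    le_antisymm (ENNReal.ofReal_eq_zero.1 (congrFun h2 q)) (density_nonneg p u t q)
  have h4 : hsNorm q (vorticity u t q) = 0 := (Real.rpow_eq_zero (Real.sqrt_nonneg _) hp0).1 h3
  have hq := mem_extChartAt_source (I := 𝓡 n) q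
  have hy := (extChartAt (𝓡 n) q).map_source hq
  have hv : vorticity u t q = fun a c =>
      vortForm u q (t, extChartAt (𝓡 n) q q) (toChart q q a) (toChart q q c) := by
    funext a c
    rw [vorticity_eq_vortForm hm hu ht hq]
  rw [hv, hsNorm_eq_sqrt_hsSq hq, Real.sqrt_eq_zero (hsSq_nonneg hy _)] at h4
  obtain ⟨e, he⟩ := exists_gram_eq_one hy
  rw [hsSq_eq_sum _ _ he, Finset.sum_eq_zero_iff_of_nonneg fun i _ =>
    Finset.sum_nonneg fun j _ => sq_nonneg _] at h4
  have h5 : vortForm u q (t, extChartAt (𝓡 n) q q) = 0 := by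
    refine ContinuousLinearMap.coe_injective (e.ext fun i => ?_)
    refine ContinuousLinearMap.coe_injective (e.ext fun j => ?_)
    have := (Finset.sum_eq_zero_iff_of_nonneg fun j _ => sq_nonneg _).1
      (h4 i (Finset.mem_univ i)) j (Finset.mem_univ j)
    exact pow_eq_zero_iff (two_ne_zero) |>.1 this
  rw [hv]
  simp only [h5, zero_apply]

end Energy

/-! ### Integrals depending on a parameter in a convex set -/

section ParametricIntegral

variable {X F : Type} [NormedAddCommGroup X] [NormedSpace ℝ X] [NormedAddCommGroup F]
  [NormedSpace ℝ F] {S : Set X} {a b : ℝ}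

/-- Continuity in the parameter, uniformly over the compact interval of integration. -/
theorem eventually_norm_sub_lt_of_continuousOn {f : X → ℝ → F}
    (hf : ContinuousOn (fun z : X × ℝ => f z.1 z.2) (S ×ˢ Icc a b)) {z : X} (hz : z ∈ S) {ε : ℝ}
    (hε : 0 < ε) : ∀ᶠ z' in 𝓝[S] z, ∀ s ∈ Icc a b, ‖f z' s - f z s‖ < ε := by
  obtain ⟨v, hv, hv'⟩ := IsCompact.mem_uniformity_of_prod (f := f) isCompact_Icc hf hz
    (Metric.dist_mem_uniformity hε)
  filter_upwards [hv] with z' hz' s hs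
  exact (dist_eq_norm (f z' s) (f z s)).symm.trans_lt (hv' z' hz' s hs)

theorem intervalIntegrable_slice {f : X → ℝ → F} (hab : a ≤ b)
    (hf : ContinuousOn (fun z : X × ℝ => f z.1 z.2) (S ×ˢ Icc a b)) {z : X} (hz : z ∈ S) :
    IntervalIntegrable (f z) volume a b :=
  ContinuousOn.intervalIntegrable_of_Icc hab (hf.comp (f := fun s => (z, s))
    (continuous_const.prodMk continuous_id).continuousOn fun _ hs => ⟨hz, hs⟩)

theorem continuousOn_parametric_integral {f : X → ℝ → F} (hab : a ≤ b)
    (hf : ContinuousOn (fun z : X × ℝ => f z.1 z.2) (S ×ˢ Icc a b)) :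
    ContinuousOn (fun z => ∫ s in a..b, f z s) S := by
  intro z hz
  rw [Metric.continuousWithinAt_iff']
  intro ε hε
  have hc : 0 < ε / (b - a + 1) := div_pos hε (by linarith)
  filter_upwards [eventually_norm_sub_lt_of_continuousOn hf hz hc, self_mem_nhdsWithin]
    with z' hz' hz'S
  rw [dist_eq_norm, ← intervalIntegral.integral_sub (intervalIntegrable_slice hab hf hz'S)
    (intervalIntegrable_slice hab hf hz)]
  refine (intervalIntegral.norm_integral_le_of_norm_le_const fun s hs => (hz' s ?_).le).trans_lt ?_
  · rw [uIoc_of_le hab] at hs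
    exact Ioc_subset_Icc_self hs
  · rw [abs_of_nonneg (by linarith), div_mul_eq_mul_div, div_lt_iff₀ (by linarith)]
    nlinarith

/-- Differentiation under the integral, relative to a convex set of parameters. -/
theorem hasFDerivWithinAt_parametric_integral (hS : Convex ℝ S) (hab : a ≤ b) {f : X → ℝ → F}
    {f' : X → ℝ → X →L[ℝ] F} (hf : ContinuousOn (fun z : X × ℝ => f z.1 z.2) (S ×ˢ Icc a b))
    (hf' : ContinuousOn (fun z : X × ℝ => f' z.1 z.2) (S ×ˢ Icc a b))
    (hd : ∀ z ∈ S, ∀ s ∈ Icc a b, HasFDerivWithinAt (fun z => f z s) (f' z s) S z) {z : X}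
    (hz : z ∈ S) [CompleteSpace F] :
    HasFDerivWithinAt (fun z => ∫ s in a..b, f z s) (∫ s in a..b, f' z s) S z := by
  refine HasFDerivWithinAt.of_isLittleO (Asymptotics.isLittleO_iff.2 fun ε hε => ?_)
  have hc : 0 < ε / (b - a + 1) := div_pos hε (by linarith)
  obtain ⟨δ, hδ, hball⟩ := Metric.mem_nhdsWithin_iff.1
    (eventually_norm_sub_lt_of_continuousOn hf' hz hc)
  filter_upwards [inter_mem_nhdsWithin S (Metric.ball_mem_nhds z hδ)] with z' hz'
  have hint := (intervalIntegrable_slice hab hf hz'.1).sub (intervalIntegrable_slice hab hf hz)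
  have hint' := intervalIntegrable_slice hab hf' hz
  have happ : IntervalIntegrable (fun s => f' z s (z' - z)) volume a b :=
    ⟨hint'.1.apply_continuousLinearMap _, hint'.2.apply_continuousLinearMap _⟩
  rw [← intervalIntegral.integral_sub (intervalIntegrable_slice hab hf hz'.1)
    (intervalIntegrable_slice hab hf hz), ContinuousLinearMap.intervalIntegral_apply hint',
    ← intervalIntegral.integral_sub hint happ]
  refine (intervalIntegral.norm_integral_le_of_norm_le_const (C := ε / (b - a + 1) * ‖z' - z‖)
    fun s hs => ?_).trans ?_
  · have hs' : s ∈ Icc a b := by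
      rw [uIoc_of_le hab] at hs
      exact Ioc_subset_Icc_self hs
    refine ((convex_ball z δ).inter hS).norm_image_sub_le_of_norm_hasFDerivWithin_le'
      (f := fun z => f z s) (f' := fun z => f' z s)
      (fun w hw => (hd w hw.2 s hs').mono inter_subset_right)
      (fun w hw => (hball hw s hs').le) ⟨Metric.mem_ball_self hδ, hz⟩ ⟨hz'.2, hz'.1⟩
  · rw [abs_of_nonneg (by linarith), mul_right_comm]
    gcongr
    rw [div_mul_eq_mul_div, div_le_iff₀ (by linarith)]
    nlinarith

/-- Integrals of `C^k` functions depending on a parameter in a convex set are of class `C^k`. -/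
theorem contDiffOn_parametric_integral_nat (hS : Convex ℝ S) (hSu : UniqueDiffOn ℝ S) (hab : a < b)
    (k : ℕ) : ∀ (F : Type) [NormedAddCommGroup F] [NormedSpace ℝ F] [CompleteSpace F]
    (f : X × ℝ → F), ContDiffOn ℝ k f (S ×ˢ Icc a b) →
    ContDiffOn ℝ k (fun z => ∫ s in a..b, f (z, s)) S := by
  have hu : UniqueDiffOn ℝ (S ×ˢ Icc a b) := hSu.prod (uniqueDiffOn_Icc hab)
  induction k with
  | zero =>
    intro F _ _ _ f hf
    exact contDiffOn_zero.2 (continuousOn_parametric_integral (f := fun z s => f (z, s)) hab.le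
      hf.continuousOn)
  | succ k ih =>
    intro F _ _ _ f hf
    have hf' : ContDiffOn ℝ k (fun z : X × ℝ => (fderivWithin ℝ f (S ×ˢ Icc a b) z).comp
        (ContinuousLinearMap.inl ℝ X ℝ)) (S ×ˢ Icc a b) :=
      (hf.fderivWithin hu (by norm_cast)).clm_comp contDiffOn_const
    push_cast
    refine (contDiffOn_succ_iff_hasFDerivWithinAt_of_uniqueDiffOn hSu).2
      ⟨fun h => absurd h (WithTop.coe_ne_top), _, ih _ _ hf', fun z hz => ?_⟩
    refine hasFDerivWithinAt_parametric_integral (f := fun z s => f (z, s))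
      (f' := fun z s => (fderivWithin ℝ f (S ×ˢ Icc a b) (z, s)).comp
        (ContinuousLinearMap.inl ℝ X ℝ)) hS hab.le hf.continuousOn hf'.continuousOn ?_ hz
    intro z hz s hs
    have h1 := (hf.differentiableOn (by simp) (z, s) ⟨hz, hs⟩).hasFDerivWithinAt
    exact h1.comp z (hasFDerivAt_prodMk_left z s).hasFDerivWithinAt
      (show MapsTo (fun w => (w, s)) S (S ×ˢ Icc a b) from fun w hw => ⟨hw, hs⟩)

theorem contDiffOn_parametric_integral (hS : Convex ℝ S) (hSu : UniqueDiffOn ℝ S) (hab : a < b)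
    [CompleteSpace F] {m : ℕ∞} {f : X × ℝ → F} (hf : ContDiffOn ℝ m f (S ×ˢ Icc a b)) :
    ContDiffOn ℝ m (fun z => ∫ s in a..b, f (z, s)) S :=
  contDiffOn_iff_forall_nat_le.2 fun k hk =>
    contDiffOn_parametric_integral_nat hS hSu hab k F f (hf.of_le (by exact_mod_cast hk))

end ParametricIntegral

section Potential

variable {E : Type} [NormedAddCommGroup E] [NormedSpace ℝ E] {T : ℝ} {Ω : Set E}

/-- The Poincaré lemma for a family of closed one-forms on a convex set. -/
theorem exists_potential_slab (hT : 0 < T) (hΩ : IsOpen Ω) (hconv : Convex ℝ Ω) {m : ℕ∞}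
    (hm : 1 ≤ m) {α : ℝ × E → E →L[ℝ] ℝ} (hα : ContDiffOn ℝ m α (Icc 0 T ×ˢ Ω))
    (hcl : ∀ t ∈ Icc 0 T, ∀ y ∈ Ω, ∀ a b, dForm (fun y => α (t, y)) y a b = 0) :
    ∃ φ : ℝ × E → ℝ, ContDiffOn ℝ m φ (Icc 0 T ×ˢ Ω) ∧
      ∀ t ∈ Icc 0 T, ∀ y ∈ Ω, HasFDerivAt (fun y => φ (t, y)) (α (t, y)) y := by
  rcases Ω.eq_empty_or_nonempty with rfl | ⟨y₀, hy₀⟩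
  · exact ⟨fun _ => 0, by simp [ContDiffOn], by simp⟩
  have hm0 : (m : ℕ∞ω) ≠ 0 := by
    have : m ≠ 0 := fun h => by simp [h] at hm
    exact_mod_cast this
  have hdiff : ∀ t ∈ Icc 0 T, DifferentiableOn ℝ (fun y => α (t, y)) Ω := fun t ht y hy =>
    (hasFDerivAt_slab hΩ ht hy
      (hα.differentiableOn hm0 (t, y) ⟨ht, hy⟩)).differentiableAt.differentiableWithinAt
  have hseg : ∀ y ∈ Ω, ∀ s ∈ Icc (0 : ℝ) 1, y₀ + s • (y - y₀) ∈ Ω := fun y hy s hs =>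
    hconv.add_smul_sub_mem hy₀ hy hs
  refine ⟨fun z => ∫ s in (0 : ℝ)..1, α (z.1, y₀ + s • (z.2 - y₀)) (z.2 - y₀), ?_, ?_⟩
  · refine contDiffOn_parametric_integral
      (f := fun w : (ℝ × E) × ℝ => α (w.1.1, y₀ + w.2 • (w.1.2 - y₀)) (w.1.2 - y₀))
      ((convex_Icc 0 T).prod hconv) (uniqueDiffOn_slab hT hΩ) one_pos ?_
    have h2 : ContDiff ℝ m fun w : (ℝ × E) × ℝ => w.1.2 - y₀ := by fun_prop
    have h1 : ContDiff ℝ m fun w : (ℝ × E) × ℝ => (w.1.1, y₀ + w.2 • (w.1.2 - y₀)) := by fun_prop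
    exact (hα.comp h1.contDiffOn fun w hw => ⟨hw.1.1, hseg _ hw.1.2 _ hw.2⟩).clm_apply
      h2.contDiffOn
  · intro t ht y hy
    obtain ⟨f, hf⟩ := hconv.exists_forall_hasFDerivAt_of_fderiv_symmetric hΩ (hdiff t ht)
      fun y hy a b => sub_eq_zero.1 (hcl t ht y hy a b)
    have key : ∀ z ∈ Ω, ∫ s in (0 : ℝ)..1, α (t, y₀ + s • (z - y₀)) (z - y₀) = f z - f y₀ := by
      intro z hz
      have h1 : ∀ s ∈ uIcc (0 : ℝ) 1, HasDerivAt (fun s => f (y₀ + s • (z - y₀)))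
          (α (t, y₀ + s • (z - y₀)) (z - y₀)) s := by
        intro s hs
        rw [uIcc_of_le zero_le_one] at hs
        have hl : HasDerivAt (fun s : ℝ => y₀ + s • (z - y₀)) (z - y₀) s := by
          simpa using ((hasDerivAt_id s).smul_const (z - y₀)).const_add y₀
        exact (hf _ (hseg z hz s hs)).comp_hasDerivAt s hl
      rw [intervalIntegral.integral_eq_sub_of_hasDerivAt h1]
      · simp
      · refine ContinuousOn.intervalIntegrable_of_Icc zero_le_one ?_
        refine ContinuousOn.clm_apply (((hdiff t ht).continuousOn).comp
          (f := fun s : ℝ => y₀ + s • (z - y₀)) (by fun_prop) fun s hs => hseg z hz s hs)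
          continuousOn_const
    refine ((hf y hy).sub_const (f y₀)).congr_of_eventuallyEq ?_
    filter_upwards [hΩ.mem_nhds hy] with z hz using key z hz

/-- If `∂ₜα + λα = -dh` then `e^{-λt} (φ₀ - ∫₀ᵗ e^{λs} h(s) ds)` is a potential of `α(t)` whenever
`φ₀` is a potential of `α(0)`. -/
theorem hasFDerivAt_duhamel (hT : 0 < T) (hΩ : IsOpen Ω) (lam : ℝ)
    {α : ℝ × E → E →L[ℝ] ℝ} (hα : ContDiffOn ℝ 1 α (Icc 0 T ×ˢ Ω)) {h : ℝ × E → ℝ}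
    (hh : ContinuousOn h (Icc 0 T ×ˢ Ω))
    (hd : ∀ t ∈ Icc 0 T, ∀ y ∈ Ω, HasFDerivAt (fun y => h (t, y))
      (-(derivWithin (fun s => α (s, y)) (Icc 0 T) t + lam • α (t, y))) y)
    {φ₀ : E → ℝ} {y : E} (hy : y ∈ Ω) (hφ : HasFDerivAt φ₀ (α (0, y)) y) {t : ℝ}
    (ht : t ∈ Icc 0 T) :
    HasFDerivAt (fun y => Real.exp (-lam * t) *
      (φ₀ y - ∫ s in (0 : ℝ)..t, Real.exp (lam * s) * h (s, y))) (α (t, y)) y := by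
  obtain ⟨r, hr, hball⟩ := Metric.isOpen_iff.1 hΩ y hy
  have hst : Icc 0 t ⊆ Icc 0 T := Icc_subset_Icc_right ht.2
  have hmaps : MapsTo (fun z : E × ℝ => (z.2, z.1)) (Metric.ball y r ×ˢ Icc 0 t)
      (Icc 0 T ×ˢ Ω) := fun z hz => ⟨hst hz.2, hball hz.1⟩
  have hαt := contDiffOn_derivWithin_slab (k := 0) hT hΩ hα (by norm_num)
  set D : ℝ → E → E →L[ℝ] ℝ := fun s y =>
    Real.exp (lam * s) • (derivWithin (fun s => α (s, y)) (Icc 0 T) s + lam • α (s, y)) with hD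
  have hDc : ContinuousOn (fun z : E × ℝ => -D z.2 z.1) (Metric.ball y r ×ˢ Icc 0 t) := by
    have hsw : ContinuousOn (fun z : E × ℝ => (z.2, z.1)) (Metric.ball y r ×ˢ Icc 0 t) :=
      continuous_swap.continuousOn
    refine ContinuousOn.neg (ContinuousOn.smul (f := fun z : E × ℝ => Real.exp (lam * z.2))
      (by fun_prop) ?_)
    exact (hαt.continuousOn.comp hsw hmaps).add
      ((hα.continuousOn.comp hsw hmaps).const_smul lam)
  have h1 := hasFDerivWithinAt_parametric_integral (S := Metric.ball y r)
    (f := fun y s => Real.exp (lam * s) * h (s, y)) (f' := fun y s => -D s y)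
    (convex_ball y r) ht.1 ((by fun_prop : Continuous fun z : E × ℝ =>
      Real.exp (lam * z.2)).continuousOn.mul (hh.comp continuous_swap.continuousOn hmaps)) hDc
    (fun z hz s hs => by
      have := (hd s (hst hs) z (hball hz)).const_mul (Real.exp (lam * s))
      rw [smul_neg] at this
      exact this.hasFDerivWithinAt) (Metric.mem_ball_self hr)
  have h2 := h1.hasFDerivAt (Metric.ball_mem_nhds y hr)
  have hint : ∫ s in (0 : ℝ)..t, D s y = Real.exp (lam * t) • α (t, y) - α (0, y) := by
    have hda : ∀ s ∈ Icc 0 t, HasDerivWithinAt (fun s => Real.exp (lam * s) • α (s, y)) (D s y)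
        (Icc 0 t) s := by
      intro s hs
      have he : HasDerivAt (fun s => Real.exp (lam * s)) (Real.exp (lam * s) * lam) s := by
        simpa using ((hasDerivAt_id s).const_mul lam).exp
      have ha : HasDerivWithinAt (fun s => α (s, y))
          (derivWithin (fun s => α (s, y)) (Icc 0 T) s) (Icc 0 T) s :=
        (hasDerivWithinAt_slab hy (hα.differentiableOn one_ne_zero (s, y)
          ⟨hst hs, hy⟩)).differentiableWithinAt.hasDerivWithinAt
      have h3 := he.hasDerivWithinAt.smul (ha.mono hst)
      have e : D s y = Real.exp (lam * s) • derivWithin (fun s => α (s, y)) (Icc 0 T) s +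
          (Real.exp (lam * s) * lam) • α (s, y) := by
        simp only [hD]
        module
      rw [e]
      exact h3
    have h4 := intervalIntegral.integral_eq_sub_of_hasDeriv_right_of_le ht.1
      (fun s hs => (hda s hs).continuousWithinAt)
      (fun s hs => ((hda s (Ioo_subset_Icc_self hs)).mono_of_mem_nhdsWithin
        (mem_nhdsWithin_of_mem_nhds (Icc_mem_nhds hs.1 hs.2))))
      (ContinuousOn.intervalIntegrable_of_Icc ht.1 (by
        have := hDc.neg.comp (f := fun s => (y, s)) (s := Icc 0 t)
          (continuous_const.prodMk continuous_id).continuousOn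
          fun s hs => ⟨Metric.mem_ball_self hr, hs⟩
        simpa [Function.comp_def] using this))
    rw [h4]
    simp
  have h5 := (hφ.sub h2).const_mul (Real.exp (-lam * t))
  have e : Real.exp (-lam * t) * Real.exp (lam * t) = 1 := by
    rw [← Real.exp_add]; simp
  rw [intervalIntegral.integral_neg, hint, sub_neg_eq_add, add_sub_cancel, smul_smul, e,
    one_smul] at h5
  exact h5

end Potential

/-! ### Potentials -/

section ChartDerivative

variable {n : ℕ} {M : Type*} [TopologicalSpace M] [ChartedSpace (Eucl n) M]
  [IsManifold (𝓡 n) ∞ M]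

theorem hasMFDerivAt_iff_chart {f : M → ℝ} {α : (y : M) → TangentSpace (𝓡 n) y →L[ℝ] ℝ} {x q : M}
    (hq : q ∈ (extChartAt (𝓡 n) x).source) :
    HasMFDerivAt (𝓡 n) 𝓘(ℝ, ℝ) f q (α q) ↔
      HasFDerivAt (fun y => f ((extChartAt (𝓡 n) x).symm y))
        (formInChart α x (extChartAt (𝓡 n) x q)) (extChartAt (𝓡 n) x q) := by
  constructor
  · intro h
    have h1 := hasFDerivAt_chart_of_mdifferentiableAt hq h.mdifferentiableAt
    convert h1 using 1
    refine ContinuousLinearMap.ext fun b => ?_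
    obtain ⟨a, rfl⟩ := exists_toChart_eq hq b
    rw [formInChart_toChart _ hq, formInChart_toChart _ hq, dFun, h.mfderiv]
  · intro h
    have h1 := hasMFDerivAt_of_chart hq h
    have e : (formInChart α x (extChartAt (𝓡 n) x q)).comp (toChart x q) = α q :=
      ContinuousLinearMap.ext (formInChart_toChart α hq)
    rwa [e] at h1

theorem hasMFDerivAt_add_const {f : M → ℝ} {q : M} {D : TangentSpace (𝓡 n) q →L[ℝ] ℝ}
    (h : HasMFDerivAt (𝓡 n) 𝓘(ℝ, ℝ) f q D) (r : ℝ) :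
    HasMFDerivAt (𝓡 n) 𝓘(ℝ, ℝ) (fun q => f q + r) q D := by
  have hq := mem_extChartAt_source (I := 𝓡 n) q
  have h1 := hasFDerivAt_chart_of_mdifferentiableAt hq h.mdifferentiableAt
  have h2 := hasMFDerivAt_of_chart (f := fun q => f q + r) hq (h1.add_const r)
  have e : (formInChart (dFun f) q (extChartAt (𝓡 n) q q)).comp (toChart q q) = D := by
    rw [← h.mfderiv]
    exact ContinuousLinearMap.ext (formInChart_toChart (dFun f) hq)
  rwa [e] at h2

end ChartDerivative

section Potentials

open scoped Bundle

variable {n : ℕ} {M : Type*} [TopologicalSpace M] [ChartedSpace (Eucl n) M]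
  [Bundle.RiemannianBundle (fun x : M => TangentSpace (𝓡 n) x)]

theorem eq_grad_of_hasMFDerivAt {f : M → ℝ} {q : M} {a : TangentSpace (𝓡 n) q}
    (h : HasMFDerivAt (𝓡 n) 𝓘(ℝ, ℝ) f q (flat q a)) : a = grad f q := by
  rw [grad, h.mfderiv]
  exact (sharp_flat q a).symm

variable [IsManifold (𝓡 n) ∞ M] {m : ℕ∞} {c p T : ℝ} {V : ℝ → ℝ}
  {ρ : ℝ → M → ℝ} {u : ℝ → (x : M) → TangentSpace (𝓡 n) x}
variable [SmoothMetric n M]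

theorem vortForm_eq_zero (hm : 2 ≤ m)
    (hu : ContMDiffOn (𝓘(ℝ, ℝ).prod (𝓡 n)) (𝓡 n).tangent (m : ℕ∞ω)
      (fun z : ℝ × M => (⟨z.2, u z.1 z.2⟩ : TangentBundle (𝓡 n) M)) (Icc 0 T ×ˢ univ))
    {t : ℝ} (ht : t ∈ Icc 0 T)
    (hω : ∀ (q : M) (a b : TangentSpace (𝓡 n) q), vorticity u t q a b = 0) {x : M} {y : Eucl n}
    (hy : y ∈ (extChartAt (𝓡 n) x).target) : vortForm u x (t, y) = 0 := by
  have hq := (extChartAt (𝓡 n) x).map_target hy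
  refine ContinuousLinearMap.ext fun a => ContinuousLinearMap.ext fun b => ?_
  obtain ⟨a, rfl⟩ := exists_toChart_eq hq a
  obtain ⟨b, rfl⟩ := exists_toChart_eq hq b
  have h := vorticity_eq_vortForm hm hu ht hq a b
  rw [hω, (extChartAt (𝓡 n) x).right_inv hy] at h
  exact h.symm

/-- A field with closed dual form has a potential on a neighbourhood of each point; any potential
at a given time differs from it there by a constant. -/
theorem exists_local_potential (hT : 0 < T) (hm : 2 ≤ m)
    (hu : ContMDiffOn (𝓘(ℝ, ℝ).prod (𝓡 n)) (𝓡 n).tangent (m : ℕ∞ω)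
      (fun z : ℝ × M => (⟨z.2, u z.1 z.2⟩ : TangentBundle (𝓡 n) M)) (Icc 0 T ×ˢ univ))
    (hω : ∀ t ∈ Icc 0 T, ∀ (q : M) (a b : TangentSpace (𝓡 n) q), vorticity u t q a b = 0) (x : M) :
    ∃ U : Set M, IsOpen U ∧ x ∈ U ∧ IsPreconnected U ∧ ∃ φ : ℝ → M → ℝ, IsPotentialOn m T U u φ ∧
      ∀ t ∈ Icc 0 T, ∀ f : M → ℝ, (∀ q ∈ U, HasMFDerivAt (𝓡 n) 𝓘(ℝ, ℝ) f q (flat q (u t q))) →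
        ∀ q ∈ U, f q = f x + (φ t q - φ t x) := by
  have hop := isOpen_extChartAt_target (I := 𝓡 n) x
  obtain ⟨r, hr, hball⟩ := Metric.isOpen_iff.1 hop _ (mem_extChartAt_target (I := 𝓡 n) x)
  set Ω := Metric.ball (extChartAt (𝓡 n) x x) r with hΩ
  have hΩo : IsOpen Ω := Metric.isOpen_ball
  have hα := (contDiffOn_velForm hu x).mono (prod_mono_right (s := Icc (0 : ℝ) T) hball)
  obtain ⟨φ, hφ, hφd⟩ := exists_potential_slab hT hΩo (convex_ball _ r)
    (le_trans (by norm_num) hm) hα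
    fun t ht y hy a b => DFunLike.congr_fun (DFunLike.congr_fun
      (vortForm_eq_zero hm hu ht (hω t ht) (hball hy)) a) b
  set U : Set M := (extChartAt (𝓡 n) x).source ∩ extChartAt (𝓡 n) x ⁻¹' Ω with hU
  have hUim : U = (extChartAt (𝓡 n) x).symm '' Ω := by
    ext q
    constructor
    · intro hq
      exact ⟨_, hq.2, (extChartAt (𝓡 n) x).left_inv hq.1⟩
    · rintro ⟨y, hy, rfl⟩
      exact ⟨(extChartAt (𝓡 n) x).map_target (hball hy), by
        rw [mem_preimage, (extChartAt (𝓡 n) x).right_inv (hball hy)]; exact hy⟩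
  have hUo : IsOpen U :=
    (continuousOn_extChartAt x).isOpen_inter_preimage (isOpen_extChartAt_source x) hΩo
  have hext : ContMDiffOn (𝓡 n) 𝓘(ℝ, Eucl n) ∞ (extChartAt (𝓡 n) x) U :=
    contMDiffOn_extChartAt.mono fun q hq => by
      have := hq.1
      rwa [extChartAt_source] at this
  have hΦd : ∀ t ∈ Icc 0 T, ∀ q ∈ U, HasMFDerivAt (𝓡 n) 𝓘(ℝ, ℝ)
      (fun q => φ (t, extChartAt (𝓡 n) x q)) q (flat q (u t q)) := by
    intro t ht q hq
    refine (hasMFDerivAt_iff_chart (α := fun q => flat q (u t q)) hq.1).2 ?_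
    refine (hφd t ht _ hq.2).congr_of_eventuallyEq ?_
    filter_upwards [hΩo.mem_nhds hq.2] with y hy
    rw [(extChartAt (𝓡 n) x).right_inv (hball hy)]
  refine ⟨U, hUo, ⟨mem_extChartAt_source x, Metric.mem_ball_self hr⟩, ?_,
    fun t q => φ (t, extChartAt (𝓡 n) x q), ⟨?_, fun t ht => ⟨?_, fun q hq => ?_⟩⟩, ?_⟩
  · rw [hUim]
    exact (convex_ball _ r).isPreconnected.image _ ((continuousOn_extChartAt_symm x).mono hball)
  · have h1 : ContMDiffOn (𝓘(ℝ, ℝ).prod (𝓡 n)) 𝓘(ℝ, ℝ × Eucl n) (m : ℕ∞ω)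
        (fun z : ℝ × M => (z.1, extChartAt (𝓡 n) x z.2)) (Icc 0 T ×ˢ U) :=
      contMDiffOn_fst.prodMk_space ((hext.of_le (by exact_mod_cast le_top)).comp contMDiffOn_snd
        fun z hz => hz.2)
    exact hφ.contMDiffOn.comp h1 fun z hz => ⟨hz.1, hz.2.2⟩
  · have h2 : ContDiffOn ℝ ((m : ℕ∞ω) + 1) (fun y => φ (t, y)) Ω :=
      (contDiffOn_succ_iff_hasFDerivWithinAt_of_uniqueDiffOn hΩo.uniqueDiffOn).2
        ⟨fun h => absurd h (WithTop.coe_ne_top), _,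
          hα.comp (contDiff_prodMk_right t).contDiffOn fun y hy => ⟨ht, hy⟩,
          fun y hy => (hφd t ht y hy).hasFDerivWithinAt⟩
    have h3 : ContDiffOn ℝ ((m + 1 : ℕ∞) : ℕ∞ω) (fun y => φ (t, y)) Ω := by exact_mod_cast h2
    exact h3.contMDiffOn.comp (hext.of_le (by exact_mod_cast le_top)) fun q hq => hq.2
  · exact eq_grad_of_hasMFDerivAt (hΦd t ht q hq)
  · intro t ht f hf q hq
    have hd : ∀ y ∈ Ω, HasFDerivAt (fun y => f ((extChartAt (𝓡 n) x).symm y) - φ (t, y))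
        (0 : Eucl n →L[ℝ] ℝ) y := by
      intro y hy
      have hyU : (extChartAt (𝓡 n) x).symm y ∈ U := by rw [hUim]; exact ⟨y, hy, rfl⟩
      have h1 := (hasMFDerivAt_iff_chart (α := fun q => flat q (u t q)) hyU.1).1 (hf _ hyU)
      rw [(extChartAt (𝓡 n) x).right_inv (hball hy)] at h1
      have h2 : HasFDerivAt (fun y => f ((extChartAt (𝓡 n) x).symm y) - φ (t, y))
          (velForm u x (t, y) - velForm u x (t, y)) y := h1.sub (hφd t ht y hy)
      rwa [sub_self] at h2
    have h := hΩo.is_const_of_fderiv_eq_zero (𝕜 := ℝ) (convex_ball _ r).isPreconnected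
      (fun y hy => (hd y hy).differentiableAt.differentiableWithinAt) (fun y hy => (hd y hy).fderiv)
      hq.2 (Metric.mem_ball_self hr)
    simp only [(extChartAt (𝓡 n) x).left_inv hq.1, extChartAt_to_inv] at h
    linarith

/-- Potentials at all times, without any regularity in time, can be normalised into a regular
potential: subtract the value at a base point of each connected component. -/
theorem exists_potential_of_forall_hasMFDerivAt (hT : 0 < T) (hm : 2 ≤ m)
    (hu : ContMDiffOn (𝓘(ℝ, ℝ).prod (𝓡 n)) (𝓡 n).tangent (m : ℕ∞ω)
      (fun z : ℝ × M => (⟨z.2, u z.1 z.2⟩ : TangentBundle (𝓡 n) M)) (Icc 0 T ×ˢ univ))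
    (hω : ∀ t ∈ Icc 0 T, ∀ (q : M) (a b : TangentSpace (𝓡 n) q), vorticity u t q a b = 0)
    {f : ℝ → M → ℝ}
    (hf : ∀ t ∈ Icc 0 T, ∀ q, HasMFDerivAt (𝓡 n) 𝓘(ℝ, ℝ) (f t) q (flat q (u t q))) :
    ∃ φ : ℝ → M → ℝ, IsPotentialOn m T univ u φ := by
  choose U hUo hxU hUc ψ hψ huniq using exists_local_potential (M := M) hT hm hu hω
  set b : M → M := fun q => Quotient.out (q : ConnectedComponents M) with hb
  have hbb : ∀ q, connectedComponent (b q) = connectedComponent q := fun q =>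
    ConnectedComponents.coe_eq_coe.1 (Quotient.out_eq (q : ConnectedComponents M))
  have hbU : ∀ x, ∀ q ∈ U x, b q = b x := by
    intro x q hq
    have h1 : connectedComponent q = connectedComponent x :=
      (connectedComponent_eq ((hUc x).subset_connectedComponent (hxU x) hq)).symm
    exact congrArg Quotient.out (ConnectedComponents.coe_eq_coe.2 h1)
  set φ : ℝ → M → ℝ := fun t q => f t q - f t (b q) with hφ
  have hloc : ∀ x, ∀ t ∈ Icc 0 T, ∀ q ∈ U x, φ t q = ψ x t q + (φ t x - ψ x t x) := by
    intro x t ht q hq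
    have := huniq x t ht (f t) (fun q _ => hf t ht q) q hq
    simp only [hφ, hbU x q hq, this]
    ring
  have hslice : ∀ x, ∀ q ∈ U x, ContDiffOn ℝ (m : ℕ∞ω) (fun t => ψ x t q) (Icc 0 T) :=
    fun x q hq => contMDiffOn_iff_contDiffOn.1 ((hψ x).1.comp (t := Icc 0 T ×ˢ U x)
      (contMDiff_id.prodMk contMDiff_const).contMDiffOn fun t ht => ⟨ht, hq⟩)
  set A : Set M := {q | ContDiffOn ℝ (m : ℕ∞ω) (fun t => φ t q) (Icc 0 T)} with hA
  have hUA : ∀ x, ∀ q ∈ U x, (q ∈ A ↔ x ∈ A) := by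
    intro x q hq
    have hs := (hslice x q hq).sub (hslice x x (hxU x))
    constructor
    · intro h
      refine (ContDiffOn.sub h hs).congr fun t ht => ?_
      rw [hloc x t ht q hq]
      ring
    · intro h
      refine (ContDiffOn.add h hs).congr fun t ht => ?_
      rw [hloc x t ht q hq]
      ring
  have hAclopen : IsClopen A := by
    refine ⟨⟨isOpen_iff_mem_nhds.2 fun x hx => ?_⟩, isOpen_iff_mem_nhds.2 fun x hx => ?_⟩
    · filter_upwards [(hUo x).mem_nhds (hxU x)] with q hq h using hx ((hUA x q hq).1 h)
    · filter_upwards [(hUo x).mem_nhds (hxU x)] with q hq using (hUA x q hq).2 hx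
  have hAuniv : ∀ q, q ∈ A := by
    intro q
    have h1 : b q ∈ A := by
      have : b (b q) = b q :=
        congrArg Quotient.out (Quotient.out_eq (q : ConnectedComponents M))
      have h2 : (fun t => φ t (b q)) = fun _ => 0 := by
        funext t
        simp only [hφ, this, sub_self]
      change ContDiffOn ℝ (m : ℕ∞ω) (fun t => φ t (b q)) (Icc 0 T)
      rw [h2]
      exact contDiffOn_const
    exact hAclopen.connectedComponent_subset h1 (by rw [hbb]; exact mem_connectedComponent)
  refine ⟨φ, ?_, fun t ht => ⟨?_, fun x _ => ?_⟩⟩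
  · rintro ⟨t, x⟩ ⟨ht, -⟩
    have h1 : ContMDiffOn (𝓘(ℝ, ℝ).prod (𝓡 n)) 𝓘(ℝ, ℝ) (m : ℕ∞ω)
        (fun z : ℝ × M => ψ x z.1 z.2 + (φ z.1 x - ψ x z.1 x)) (Icc 0 T ×ˢ U x) :=
      (hψ x).1.add ((ContDiffOn.sub (hAuniv x) (hslice x x (hxU x))).contMDiffOn.comp
        contMDiffOn_fst fun z hz => hz.1)
    have h2 := (h1.congr fun z hz => hloc x z.1 hz.1 z.2 hz.2) (t, x) ⟨ht, hxU x⟩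
    refine h2.mono_of_mem_nhdsWithin ?_
    rw [nhdsWithin_prod_eq, nhdsWithin_univ]
    exact prod_mem_prod self_mem_nhdsWithin ((hUo x).mem_nhds (hxU x))
  · intro x _
    have h1 : ContMDiffOn (𝓡 n) 𝓘(ℝ, ℝ) ((m + 1 : ℕ∞) : ℕ∞ω)
        (fun q => ψ x t q + (φ t x - ψ x t x)) (U x) :=
      ((hψ x).2 t ht).1.add contMDiffOn_const
    exact ((h1.congr fun q hq => hloc x t ht q hq) x (hxU x)).mono_of_mem_nhdsWithin
      (mem_nhdsWithin_of_mem_nhds ((hUo x).mem_nhds (hxU x)))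
  · refine eq_grad_of_hasMFDerivAt ?_
    refine (hasMFDerivAt_add_const (hf t ht x) (-f t (b x))).congr_of_eventuallyEq ?_
    filter_upwards [(hUo x).mem_nhds (hxU x)] with q hq
    simp only [hφ]
    rw [← hbU x q hq, sub_eq_add_neg]

/-- The Bernoulli function `|u|^p / p + c^{-p} V'(ρ)`. -/
def bernoulli (c p : ℝ) (V : ℝ → ℝ) (ρ : ℝ → M → ℝ) (u : ℝ → (x : M) → TangentSpace (𝓡 n) x)
    (t : ℝ) (q : M) : ℝ :=
  ‖u t q‖ ^ p / p + c ^ (-p) * deriv V (ρ t q)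

theorem IsSolution.continuousOn_bernoulli (h : IsSolution m c p T V ρ u) (hp : 2 ≤ p)
    (hV : ContDiffOn ℝ 3 V (Ioi 0)) (x : M) :
    ContinuousOn (fun z : ℝ × Eucl n => bernoulli c p V ρ u z.1 ((extChartAt (𝓡 n) x).symm z.2))
      (Icc 0 T ×ˢ (extChartAt (𝓡 n) x).target) := by
  have hp0 : 0 < p := by linarith
  have h1 : ContinuousOn (fun z : ℝ × Eucl n => metricInChart x z.2 (vecInChart (u z.1) x z.2)
      (vecInChart (u z.1) x z.2)) (Icc 0 T ×ˢ (extChartAt (𝓡 n) x).target) := by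
    have hv := (contDiffOn_vecInChart h.contMDiffOn_u x).continuousOn
    exact (((contDiffOn_metricInChart x).continuousOn.comp continuousOn_snd
      fun z hz => hz.2).clm_apply hv).clm_apply hv
  have h2 : ContinuousOn (fun z : ℝ × Eucl n => ‖u z.1 ((extChartAt (𝓡 n) x).symm z.2)‖ ^ p)
      (Icc 0 T ×ˢ (extChartAt (𝓡 n) x).target) := by
    refine (h1.rpow_const (p := p / 2) fun z hz => Or.inr (by positivity)).congr fun z hz => ?_
    simp only
    rw [← normSq_eq_metricInChart (u z.1) hz.2, ← Real.rpow_natCast, ← Real.rpow_mul (norm_nonneg _)]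
    congr 1
    push_cast
    ring
  have h3 : ContinuousOn (fun z : ℝ × Eucl n => ρ z.1 ((extChartAt (𝓡 n) x).symm z.2))
      (Icc 0 T ×ˢ (extChartAt (𝓡 n) x).target) :=
    (contDiffOn_comp_extChartAt_symm (f := ρ) (k := 1) h.contMDiffOn_rho x).continuousOn.mono
      fun z hz => ⟨hz.1, hz.2, mem_univ _⟩
  have h4 : ContinuousOn (deriv V) (Ioi 0) :=
    hV.continuousOn_deriv_of_isOpen isOpen_Ioi (by norm_num)
  exact (h2.div_const p).add
    ((h4.comp h3 fun z hz => h.rho_pos z.1 hz.1 _).const_smul (c ^ (-p)))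

/-- For an irrotational solution, `∂ₜu^* + c^{-p} u^* = -d(|u|^p / p + c^{-p} V'(ρ))`. -/
theorem IsSolution.hasFDerivAt_bernoulli (h : IsSolution m c p T V ρ u) (hp : 2 ≤ p) (hc : 0 < c)
    (hT : 0 < T) (hm : 2 ≤ m) (hV : ContDiffOn ℝ 3 V (Ioi 0)) {t : ℝ} (ht : t ∈ Icc 0 T)
    (hω : ∀ (q : M) (a b : TangentSpace (𝓡 n) q), vorticity u t q a b = 0) {x : M} {y : Eucl n}
    (hy : y ∈ (extChartAt (𝓡 n) x).target) :
    HasFDerivAt (fun y => bernoulli c p V ρ u t ((extChartAt (𝓡 n) x).symm y))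
      (-(derivWithin (fun s => velForm u x (s, y)) (Icc 0 T) t + c ^ (-p) • velForm u x (t, y)))
      y := by
  have h1 := formInChart_convection_eq hp hm h.contMDiffOn_u ht hy
  rw [vortForm_eq_zero hm h.contMDiffOn_u ht hω hy, zero_apply, sub_zero,
    h.formInChart_convection hc hT ht hm hy] at h1
  have h2 := (formInChart_dFun (h.contMDiff_enthalpy hV ht) hy).1
  have h3 := h1.add (h2.const_mul (c ^ (-p)))
  have e : -derivWithin (fun s => velForm u x (s, y)) (Icc 0 T) t
      - c ^ (-p) • (velForm u x (t, y) + formInChart (dFun (fun y => deriv V (ρ t y))) x y) +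
      c ^ (-p) • formInChart (dFun (fun y => deriv V (ρ t y))) x y =
      -(derivWithin (fun s => velForm u x (s, y)) (Icc 0 T) t + c ^ (-p) • velForm u x (t, y)) := by
    rw [smul_add]
    abel
  rw [e] at h3
  exact h3

/-- The gradient structure is preserved by irrotational solutions. -/
theorem IsSolution.exists_potential (h : IsSolution m c p T V ρ u) (hp : 2 ≤ p) (hc : 0 < c)
    (hT : 0 < T) (hm : 2 ≤ m) (hV : ContDiffOn ℝ 3 V (Ioi 0))
    (hω : ∀ t ∈ Icc 0 T, ∀ (q : M) (a b : TangentSpace (𝓡 n) q), vorticity u t q a b = 0)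
    {φ₀ : M → ℝ} (hφ : ∀ q, HasMFDerivAt (𝓡 n) 𝓘(ℝ, ℝ) φ₀ q (flat q (u 0 q))) :
    ∃ φ : ℝ → M → ℝ, IsPotentialOn m T univ u φ := by
  have hu := h.contMDiffOn_u
  refine exists_potential_of_forall_hasMFDerivAt hT hm hu hω
    (f := fun t q => Real.exp (-c ^ (-p) * t) *
      (φ₀ q - ∫ s in (0 : ℝ)..t, Real.exp (c ^ (-p) * s) * bernoulli c p V ρ u s q))
    fun t ht q => ?_
  have hq := mem_extChartAt_source (I := 𝓡 n) q
  refine (hasMFDerivAt_iff_chart (α := fun q => flat q (u t q)) hq).2 ?_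
  exact hasFDerivAt_duhamel hT (isOpen_extChartAt_target (I := 𝓡 n) q) (c ^ (-p))
    ((contDiffOn_velForm hu q).of_le (by exact_mod_cast le_trans (by norm_num) hm))
    (h.continuousOn_bernoulli hp hV q)
    (fun t ht y hy => h.hasFDerivAt_bernoulli hp hc hT hm hV ht (hω t ht) hy)
    (mem_extChartAt_target q)
    ((hasMFDerivAt_iff_chart (α := fun q => flat q (u 0 q)) hq).1 (hφ q)) ht

/-- A gradient is irrotational. -/
theorem vorticity_eq_zero_of_hasMFDerivAt (hm : 2 ≤ m)
    (hu : ContMDiffOn (𝓘(ℝ, ℝ).prod (𝓡 n)) (𝓡 n).tangent (m : ℕ∞ω)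
      (fun z : ℝ × M => (⟨z.2, u z.1 z.2⟩ : TangentBundle (𝓡 n) M)) (Icc 0 T ×ˢ univ))
    {t : ℝ} (ht : t ∈ Icc 0 T) {φ : M → ℝ}
    (hφ : ∀ q, HasMFDerivAt (𝓡 n) 𝓘(ℝ, ℝ) φ q (flat q (u t q))) (q : M)
    (a b : TangentSpace (𝓡 n) q) : vorticity u t q a b = 0 := by
  have hq := mem_extChartAt_source (I := 𝓡 n) q
  have hy := mem_extChartAt_target (I := 𝓡 n) q
  rw [vorticity_eq_vortForm hm hu ht hq]
  refine fderiv_fderiv_symm_of_eventually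
    (f := fun y => φ ((extChartAt (𝓡 n) q).symm y)) ?_ (differentiableAt_velForm hm hu ht hy) _ _
  filter_upwards [(isOpen_extChartAt_target (I := 𝓡 n) q).mem_nhds hy] with y hy
  have := (hasMFDerivAt_iff_chart (α := fun q => flat q (u t q))
    ((extChartAt (𝓡 n) q).map_target hy)).1 (hφ _)
  rwa [(extChartAt (𝓡 n) q).right_inv hy] at this

/-- On the Euclidean space an irrotational field is a gradient. -/
theorem IsEuclidean.exists_potential (hE : IsEuclidean n M) (hm : 2 ≤ m)
    (hu : ContMDiffOn (𝓘(ℝ, ℝ).prod (𝓡 n)) (𝓡 n).tangent (m : ℕ∞ω)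
      (fun z : ℝ × M => (⟨z.2, u z.1 z.2⟩ : TangentBundle (𝓡 n) M)) (Icc 0 T ×ˢ univ))
    {t : ℝ} (ht : t ∈ Icc 0 T)
    (hω : ∀ (q : M) (a b : TangentSpace (𝓡 n) q), vorticity u t q a b = 0) :
    ∃ φ : M → ℝ, ∀ q, HasMFDerivAt (𝓡 n) 𝓘(ℝ, ℝ) φ q (flat q (u t q)) := by
  obtain ⟨Φ, -⟩ := hE
  have hs : ContMDiff 𝓘(ℝ, Eucl n) (𝓡 n) ∞ Φ.symm := Φ.symm.contMDiff
  set β : Eucl n → Eucl n →L[ℝ] ℝ := fun z =>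
    (flat (Φ.symm z) (u t (Φ.symm z))).comp (mfderiv 𝓘(ℝ, Eucl n) (𝓡 n) Φ.symm z) with hβ
  set τ : M → Eucl n → Eucl n := fun x z => extChartAt (𝓡 n) x (Φ.symm z) with hτ
  have hτs : ∀ x z, Φ.symm z ∈ (extChartAt (𝓡 n) x).source → ContDiffAt ℝ 2 (τ x) z := by
    intro x z hz
    refine contMDiffAt_iff_contDiffAt.1 ?_
    rw [extChartAt_source] at hz
    exact ((contMDiffAt_extChartAt' hz).comp z (hs z)).of_le (by norm_cast)
  have hτd : ∀ x z, Φ.symm z ∈ (extChartAt (𝓡 n) x).source → ∀ a, fderiv ℝ (τ x) z a =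
      toChart x (Φ.symm z) (mfderiv 𝓘(ℝ, Eucl n) (𝓡 n) Φ.symm z a) := by
    intro x z hz a
    rw [extChartAt_source] at hz
    rw [← mfderiv_eq_fderiv]
    exact DFunLike.congr_fun (mfderiv_comp z (mdifferentiableAt_extChartAt hz)
      ((hs z).mdifferentiableAt (by simp))) a
  have hβτ : ∀ x z, Φ.symm z ∈ (extChartAt (𝓡 n) x).source →
      β z = (velForm u x (t, τ x z)).comp (fderiv ℝ (τ x) z) := by
    intro x z hz
    refine ContinuousLinearMap.ext fun a => ?_
    rw [ContinuousLinearMap.comp_apply, hτd x z hz]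
    exact (formInChart_toChart (fun q => flat q (u t q)) hz _).symm
  have hβd : ∀ z, DifferentiableAt ℝ β z ∧ ∀ a b, dForm β z a b = 0 := by
    intro z
    set x := Φ.symm z with hx
    have hz : Φ.symm z ∈ (extChartAt (𝓡 n) x).source := mem_extChartAt_source x
    have hty : τ x z ∈ (extChartAt (𝓡 n) x).target := (extChartAt (𝓡 n) x).map_source hz
    obtain ⟨h1, h2⟩ := dForm_pullback (hτs x z hz) (differentiableAt_velForm hm hu ht hty)
      (α := β) (by
        filter_upwards [(hs.continuous.continuousAt (x := z)).preimage_mem_nhds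
          (extChartAt_source_mem_nhds' hz)] with w hw using hβτ x w hw)
    refine ⟨h1, fun a b => ?_⟩
    rw [h2]
    exact DFunLike.congr_fun (DFunLike.congr_fun (vortForm_eq_zero hm hu ht hω hty) _) _
  obtain ⟨f, hf⟩ := (convex_univ (𝕜 := ℝ) (E := Eucl n)).exists_forall_hasFDerivAt_of_fderiv_symmetric
    isOpen_univ (fun z _ => (hβd z).1.differentiableWithinAt (s := univ))
    fun z _ a b => sub_eq_zero.1 ((hβd z).2 a b)
  refine ⟨fun q => f (Φ q), fun q => ?_⟩
  have hq := mem_extChartAt_source (I := 𝓡 n) q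
  have hy := mem_extChartAt_target (I := 𝓡 n) q
  refine (hasMFDerivAt_iff_chart (α := fun q => flat q (u t q)) hq).2 ?_
  set σ : Eucl n → Eucl n := fun y => Φ ((extChartAt (𝓡 n) q).symm y) with hσ
  have hσd : DifferentiableAt ℝ σ (extChartAt (𝓡 n) q q) := by
    have h1 : ContMDiffOn 𝓘(ℝ, Eucl n) 𝓘(ℝ, Eucl n) 1 σ (extChartAt (𝓡 n) q).target :=
      (Φ.contMDiff.of_le (by exact_mod_cast le_top)).comp_contMDiffOn
        (contMDiffOn_extChartAt_symm' (k := 1) q)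
    exact ((contMDiffOn_iff_contDiffOn.1 h1).contDiffAt
      ((isOpen_extChartAt_target (I := 𝓡 n) q).mem_nhds hy)).differentiableAt (by norm_num)
  have hσq : σ (extChartAt (𝓡 n) q q) = Φ q := by simp only [hσ, extChartAt_to_inv]
  have hz : Φ.symm (σ (extChartAt (𝓡 n) q q)) ∈ (extChartAt (𝓡 n) q).source := by
    rw [hσq, Φ.symm_apply_apply]; exact hq
  have hid : (fun y => τ q (σ y)) =ᶠ[𝓝 (extChartAt (𝓡 n) q q)] id := by
    filter_upwards [(isOpen_extChartAt_target (I := 𝓡 n) q).mem_nhds hy] with y hy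
    simp only [hτ, hσ, Φ.symm_apply_apply, (extChartAt (𝓡 n) q).right_inv hy, id]
  have h1 := (hf _ (mem_univ (σ (extChartAt (𝓡 n) q q)))).comp _ hσd.hasFDerivAt
  have h2 := (((hτs q _ hz).differentiableAt (by norm_num)).hasFDerivAt.comp _
    hσd.hasFDerivAt).unique (hid.hasFDerivAt_iff.2 (hasFDerivAt_id _))
  have h3 : τ q (σ (extChartAt (𝓡 n) q q)) = extChartAt (𝓡 n) q q := hid.self_of_nhds
  rw [hβτ q _ hz, ContinuousLinearMap.comp_assoc, h2, h3, ContinuousLinearMap.comp_id] at h1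
  exact h1

end Potentials

/-! ### Preservation of irrotationality -/

section Confinement

open scoped Bundle

variable {n : ℕ} {M : Type*} [TopologicalSpace M] [ChartedSpace (Eucl n) M]
  [Bundle.RiemannianBundle (fun x : M => TangentSpace (𝓡 n) x)] {p T : ℝ}
  {u : ℝ → (x : M) → TangentSpace (𝓡 n) x}

theorem BoundedBy.exists_isBarrier {C : ℝ} (h : BoundedBy T C u)
    (hM : IsEuclidean n M ∨ CompactSpace M) (hp : 2 ≤ p) : ∃ r B, IsBarrier p T u r B := by
  rcases hM with hE | hM
  · exact hE.exists_isBarrier hp (abs_nonneg C) fun t ht q => (h t ht q).1.trans (le_abs_self C)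
  · exact ⟨_, _, isBarrier_of_compactSpace p T u⟩

/-- A solution on a compact manifold, or a bounded one, which is irrotational at the initial time
remains so. -/
theorem IsSolution.irrotational [IsManifold (𝓡 n) ∞ M] [SmoothMetric n M] [MeasurableSpace M]
    [BorelSpace M] [T2Space M] [SigmaCompactSpace M] {m : ℕ∞} {c : ℝ} {V : ℝ → ℝ} {ρ : ℝ → M → ℝ}
    (h : IsSolution m c p T V ρ u) (hM : IsEuclidean n M ∨ CompactSpace M) (hp : 2 ≤ p)
    (hc : 0 < c) (hT : 0 < T) (hm : 2 ≤ m) (hV : ContDiffOn ℝ 3 V (Ioi 0))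
    (hb : CompactSpace M ∨ ∃ C : ℝ, BoundedBy T C u)
    (h0 : ∀ (x : M) (a b : TangentSpace (𝓡 n) x), vorticity u 0 x a b = 0) :
    ∀ t ∈ Icc 0 T, ∀ (x : M) (a b : TangentSpace (𝓡 n) x), vorticity u t x a b = 0 := by
  rcases hb with hb | ⟨C, hC⟩
  · obtain ⟨K, hK⟩ := exists_lieBoundAt (M := M) hT hp hm h.contMDiffOn_u
    exact fun t ht => h.vorticity_eq_zero hp hc hT hm hV hK (isBarrier_of_compactSpace p T u) h0 ht
  · obtain ⟨r, B, hr⟩ := hC.exists_isBarrier hM hp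
    exact fun t ht => h.vorticity_eq_zero hp hc hT hm hV
      (fun t ht q => hC.lieBoundAt hp hm h.contMDiffOn_u ht q) hr h0 ht

end Confinement

end PEuler

end

theorem theorem5p3 {n : ℕ} {M : Type*} [TopologicalSpace M] [ChartedSpace (PEuler.Eucl n) M]
    [IsManifold (𝓡 n) ∞ M] [T2Space M] [SigmaCompactSpace M] [MeasurableSpace M] [BorelSpace M]
    [Bundle.RiemannianBundle (fun x : M => TangentSpace (𝓡 n) x)]
    [PEuler.SmoothMetric n M]
    (hM : PEuler.IsEuclidean n M ∨ CompactSpace M)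
    (p : ℝ) (hp : 2 ≤ p) :
    ∃ C' : ℝ → ℝ, ∀ (m : ℕ∞) (c T : ℝ) (V : ℝ → ℝ) (ρ : ℝ → M → ℝ)
      (u : ℝ → (x : M) → TangentSpace (𝓡 n) x),
      2 ≤ m → 0 < c → 0 < T → ContDiffOn ℝ 3 V (Ioi 0) →
      PEuler.IsSolution m c p T V ρ u →
      -- the equation `∂ₜω + d(|u|^{p-2} ∇_u u^*) = -c^{-p} ω`
      (∀ t ∈ Icc 0 T, ∀ x : M,
        PEuler.FormDifferentiableAt (fun y => PEuler.flat y (u t y)) x ∧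
        PEuler.FormDifferentiableAt (PEuler.convection p u t) x ∧
        ∀ a b : TangentSpace (𝓡 n) x, ∃ w : ℝ,
          HasDerivWithinAt (fun s => PEuler.vorticity u s x a b) w (Icc 0 T) t ∧
          w + PEuler.extD (PEuler.convection p u t) x a b
            = - c ^ (-p) * PEuler.vorticity u t x a b) ∧
      -- the Gronwall bound
      (∀ C : ℝ, PEuler.BoundedBy T C u → ∀ t ∈ Icc 0 T,
        eLpNorm (fun x => PEuler.hsNorm x (PEuler.vorticity u t x)) (ENNReal.ofReal p)
            (PEuler.riemVolume n M)
          ≤ ENNReal.ofReal (Real.exp ((C' C - c ^ (-p)) * t)) *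
            eLpNorm (fun x => PEuler.hsNorm x (PEuler.vorticity u 0 x)) (ENNReal.ofReal p)
              (PEuler.riemVolume n M)) ∧
      (CompactSpace M ∨ (∃ C : ℝ, PEuler.BoundedBy T C u) →
        -- closedness is preserved, and closed fields have local potentials
        ((∀ (x : M) (a b : TangentSpace (𝓡 n) x), PEuler.vorticity u 0 x a b = 0) →
          (∀ t ∈ Icc 0 T, ∀ (x : M) (a b : TangentSpace (𝓡 n) x), PEuler.vorticity u t x a b = 0) ∧
          (∀ x : M, ∃ U : Set M, IsOpen U ∧ x ∈ U ∧
            ∃ φ : ℝ → M → ℝ, PEuler.IsPotentialOn m T U u φ) ∧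
          (PEuler.IsEuclidean n M → ∃ φ : ℝ → M → ℝ, PEuler.IsPotentialOn m T univ u φ)) ∧
        -- the gradient structure is preserved
        ((∃ φ₀ : M → ℝ, ContMDiff (𝓡 n) 𝓘(ℝ, ℝ) 1 φ₀ ∧
            ∀ x, u 0 x = PEuler.grad φ₀ x) →
          ∃ φ : ℝ → M → ℝ, PEuler.IsPotentialOn m T univ u φ)) := by
  -- `|L_v g| ≤ 2 K g` with `K = (p - 1) C^{p-1}` costs `2 K` for `|ω|`, and `n K / p` for the
  -- volume
  refine ⟨fun C => (2 + n / p) * ((p - 1) * C ^ (p - 1)), fun m c T V ρ u hm hc hT hV h =>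
    ⟨fun t ht x => h.vorticity_equation hc hT hm hV ht x, fun C hC t ht => ?_, fun hb => ?_⟩⟩
  · obtain ⟨r, B, hr⟩ := hC.exists_isBarrier hM hp
    exact h.eLpNorm_vorticity_le hp hc hT hm hV
      (fun t ht q => hC.lieBoundAt hp hm h.contMDiffOn_u ht q) hr ht
  · have h0 : (0 : ℝ) ∈ Icc 0 T := left_mem_Icc.2 hT.le
    refine ⟨fun hω0 => ?_, ?_⟩
    · have hω := h.irrotational hM hp hc hT hm hV hb hω0
      refine ⟨hω, fun x => ?_, fun hE => ?_⟩
      · obtain ⟨U, hU, hx, -, φ, hφ, -⟩ :=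
          PEuler.exists_local_potential hT hm h.contMDiffOn_u hω x
        exact ⟨U, hU, hx, φ, hφ⟩
      · obtain ⟨φ₀, hφ₀⟩ := hE.exists_potential hm h.contMDiffOn_u h0 hω0
        exact h.exists_potential hp hc hT hm hV hω hφ₀
    · rintro ⟨φ₀, hφ₀, hgrad⟩
      have hd : ∀ q, HasMFDerivAt (𝓡 n) 𝓘(ℝ, ℝ) φ₀ q (PEuler.flat q (u 0 q)) := fun q => by
        rw [hgrad q, PEuler.flat_grad]
        exact (hφ₀.mdifferentiableAt (by norm_num)).hasMFDerivAt
      exact h.exists_potential hp hc hT hm hV (h.irrotational hM hp hc hT hm hV hb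
        (PEuler.vorticity_eq_zero_of_hasMFDerivAt hm h.contMDiffOn_u h0 hd)) hd
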